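/- Let $d,m,p,q,r$ be integers with $p>q\ge 0$ and $0<r<d$. Let $L=(L(t))_{t\ge0}$ be an $\mathbb R^m$-valued Lévy process on a probability space $(\Omega,\mathcal F,\mathbb P)$ with $\mathbb E L(1)=0$, $\mathbb E\|L(1)\|^2<\infty$ and $\mathbb E[L(1)L(1)^{\mathsf T}]$ nonsingular. Let $P(z)=I_dz^p+P_1z^{p-1}+\dots+P_p$ with $P_i\in\mathbb R^{d\times d}$ (and $P_0:=I_d$), and $Q(z)=Q_0z^q+\dots+Q_q$ with $Q_j\in\mathbb R^{d\times m}$. A solution $Y$ of $P(D)Y=Q(D)DL$ on $[0,\infty)$ (an MCARMA$(p,q)$ process) is by definition $Y=CX$, where $X$ is an $\mathbb R^{pd}$-valued solution of $$dX(t)=AX(t)\,dt+B\,dL(t),\qquad t\ge 0,$$ with an arbitrary random initial state $X(0)$; here $A$ is the block companion matrix with identity blocks on the superdiagonal and last block row $(-P_p,-P_{p-1},\dots,-P_1)$, $C=(I_d,0,\dots,0)$, and $B=(\beta_1^{\mathsf T},\dots,\beta_p^{\mathsf T})^{\mathsf T}$ with $\beta_k=0$ for $k<p-q$ and $\beta_k=Q_{k+q-p}-\sum_{i=1}^{k-1}P_i\beta_{k-i}$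 for $p-q\le k\le p$. Assume: (a) every $z\in\mathbb C$ with $\det P(z)=0$ satisfies $\operatorname{Re} z<0$ or $z=0$; (b) $P_p=\alpha\beta^{\mathsf T}$ with $\alpha,\beta\in\mathbb R^{d\times r}$ of rank $r$; (c) $\alpha^{\perp\mathsf T}P_{p-1}\beta^\perp$ has full rank $d-r$, where $\alpha^\perp,\beta^\perp\in\mathbb R^{d\times(d-r)}$ have rank $d-r$ and $\alpha^{\mathsf T}\alpha^\perp=0$, $\beta^{\mathsf T}\beta^\perp=0$. Then the following hold. (1) All eigenvalues of $A$ have negative real part or are zero, and the eigenvalue $0$ has algebraic and geometric multiplicity $d-r\in(0,d)$. Consequently, if $(A,B,C)$ is minimal (its transfer function $C(zI-A)^{-1}B$ has no realization of dimension less than $pd$), the MCARMA process is cointegrated in the sense that $(A,B,C)$ is minimal with an eigenvalue structure of this kind; moreover $\alpha^{\perp\mathsf T}Q_q\neq0$ in that case. (2) There is a probability law $\pi$ on $\mathbb R^{pd}$ such that, on the enlarged space $(\Omega\times\mathbb R^{pd},\mathbb P\otimes\pi)$, the solution $Y^\circ=CX^\circ$ whose initial state $X^\circ(0)$ is the second coordinate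 (so has law $\pi$ and is independent of $L$) has finite second moments (i.e. $\mathbb E\|X^\circ(t)\|^2<\infty$ for all $t\ge 0$), starts at zero in the directions $\beta^\perp$, i.e. $\beta^{\perp\mathsf T}Y^\circ(0)=0$ a.s., and satisfies: $\beta^{\mathsf T}Y^\circ$ is strictly stationary; $Y^\circ$ has strictly stationary increments; and, if $p>q+1$, the mean square derivative $DY^\circ$ exists and is strictly stationary. If $\alpha^{\perp\mathsf T}Q_q\ne0$, then $Y^\circ$ is cointegrated: it is non-stationary, has stationary increments, and $v^{\mathsf T}Y^\circ$ is stationary for some $v\in\mathbb R^d\setminus\{0\}$. (3) There are constants $K$ and $\lambda>0$ such that every solution $Y=CX$ on $\Omega$, in particular every one with $Y(0)=0$, satisfies, $\mathbb P\otimes\pi$-almost surely, for all $t,h\ge0$, $$\|\beta^{\mathsf T}Y(t)-\beta^{\mathsf T}Y^\circ(t)\|\le Ke^{-\lambda t}\|X(0)-X^\circ(0)\|,$$ $$\|(Y(t+h)-Y(t))-(Y^\circ(t+h)-Y^\circ(t))\|\le Kh\,e^{-\lambda t}\|X(0)-X^\circ(0)\| .$$ So $\beta^{\mathsf T}Y$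 and the increments of $Y$ are asymptotically stationary, with limits $\beta^{\mathsf T}Y^\circ$ and the increments of $Y^\circ$. If $\alpha^{\perp\mathsf T}Q_q\ne0$, no solution $Y$ on $\Omega$ is strictly stationary. -/

import Mathlib

open MeasureTheory ProbabilityTheory Filter Topology
open scoped NNReal ENNReal Matrix

namespace MCARMA

noncomputable section

/-! ### Processes indexed by `[0, ∞)` -/

/-- Strict stationarity: for every `s ≥ 0` the processes `(Z (s + t))_t` and `(Z t)_t` have the same
law (for the product σ-algebra, i.e. the same finite-dimensional distributions). -/
def IsStrictlyStationary {Ω E : Type*} [MeasurableSpace Ω] [MeasurableSpace E]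
    (μ : Measure Ω) (Z : ℝ≥0 → Ω → E) : Prop :=
  ∀ s : ℝ≥0, IdentDistrib (fun ω t => Z (s + t) ω) (fun ω t => Z t ω) μ μ

/-- Stationary increments: the law of `(Z (s + t) - Z s)_t` does not depend on `s ≥ 0`. -/
def HasStrictlyStationaryIncrements {Ω E : Type*} [MeasurableSpace Ω] [MeasurableSpace E] [Sub E]
    (μ : Measure Ω) (Z : ℝ≥0 → Ω → E) : Prop :=
  ∀ s : ℝ≥0, IdentDistrib (fun ω t => Z (s + t) ω - Z s ω) (fun ω t => Z t ω - Z 0 ω) μ μ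

/-- `DZ` is the mean square (i.e. `L²`) derivative of `Z` on `[0, ∞)`. -/
def IsMeanSquareDeriv {Ω E : Type*} [MeasurableSpace Ω] [NormedAddCommGroup E] [NormedSpace ℝ E]
    (μ : Measure Ω) (Z DZ : ℝ≥0 → Ω → E) : Prop :=
  ∀ t : ℝ≥0, MemLp (DZ t) 2 μ ∧
    Tendsto (fun s : ℝ≥0 =>
        eLpNorm (fun ω => ((s : ℝ) - t)⁻¹ • (Z s ω - Z t ω) - DZ t ω) 2 μ)
      (𝓝[≠] t) (𝓝 0)

/-- An `ℝᵈ`-valued process is cointegrated if it is integrated (i.e. non-stationary with stationary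
increments) and `vᵀ Z` is stationary for some non-zero vector `v`. -/
def IsCointegratedProcess {Ω : Type*} [MeasurableSpace Ω] {d : ℕ}
    (μ : Measure Ω) (Z : ℝ≥0 → Ω → (Fin d → ℝ)) : Prop :=
  ¬ IsStrictlyStationary μ Z ∧ HasStrictlyStationaryIncrements μ Z ∧
    ∃ v : Fin d → ℝ, v ≠ 0 ∧ IsStrictlyStationary μ (fun t ω => v ⬝ᵥ Z t ω)

/-- An `ℝᵐ`-valued Lévy process: `L 0 = 0` a.s., independent and stationary increments, and
càdlàg paths. -/
structure IsLevyProcess {Ω : Type*} [MeasurableSpace Ω] {m : ℕ}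
    (μ : Measure Ω) (L : ℝ≥0 → Ω → (Fin m → ℝ)) : Prop where
  measurable : ∀ t, Measurable (L t)
  zero : ∀ᵐ ω ∂μ, L 0 ω = 0
  indepIncrements : HasIndepIncrements L μ
  stationaryIncrements : ∀ s t : ℝ≥0,
    IdentDistrib (fun ω => L (s + t) ω - L s ω) (L t) μ μ
  cadlag : ∀ᵐ ω ∂μ, ∀ t : ℝ≥0,
    ContinuousWithinAt (fun s => L s ω) (Set.Ici t) t ∧
      ∃ l, Tendsto (fun s => L s ω) (𝓝[<] t) (𝓝 l)

/-- The second-order assumption on the driving process: `E L(1) = 0`, `E ‖L(1)‖² < ∞` and the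
covariance matrix `E [L(1) L(1)ᵀ]` is non-singular. -/
structure IsCenteredNondegenerate {Ω : Type*} [MeasurableSpace Ω] {m : ℕ}
    (μ : Measure Ω) (L : ℝ≥0 → Ω → (Fin m → ℝ)) : Prop where
  memLp : MemLp (L 1) 2 μ
  mean : ∫ ω, L 1 ω ∂μ = 0
  cov : (Matrix.of fun i j => ∫ ω, L 1 ω i * L 1 ω j ∂μ).det ≠ 0

/-! ### Linear state-space models -/

/-- `X` solves `dX = A X dt + B dL` on `[0, ∞)`. As the coefficient of `dL` is constant, the integral
form is `X(t) = X(0) + ∫₀ᵗ A X(s) ds + B (L(t) - L(0))`, for all `t` almost surely. -/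
structure IsStateSolution {Ω ι : Type*} [MeasurableSpace Ω] [Fintype ι] {m : ℕ}
    (μ : Measure Ω) (A : Matrix ι ι ℝ) (B : Matrix ι (Fin m) ℝ)
    (L : ℝ≥0 → Ω → (Fin m → ℝ)) (X : ℝ≥0 → Ω → (ι → ℝ)) : Prop where
  measurable : ∀ t, Measurable (X t)
  integrable : ∀ᵐ ω ∂μ, ∀ t : ℝ≥0,
    IntervalIntegrable (fun s : ℝ => X s.toNNReal ω) volume 0 t
  equation : ∀ᵐ ω ∂μ, ∀ t : ℝ≥0,
    X t ω = X 0 ω + (∫ s in (0 : ℝ)..t, A *ᵥ X s.toNNReal ω) + B *ᵥ (L t ω - L 0 ω)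

/-- The transfer function `z ↦ C (z I - A)⁻¹ B`, a matrix of rational functions. -/
def transferFunction {ι : Type*} [Fintype ι] [DecidableEq ι] {d m : ℕ}
    (A : Matrix ι ι ℝ) (B : Matrix ι (Fin m) ℝ) (C : Matrix (Fin d) ι ℝ) :
    Matrix (Fin d) (Fin m) (RatFunc ℝ) :=
  C.map RatFunc.C * (Matrix.scalar ι (RatFunc.X : RatFunc ℝ) - A.map RatFunc.C)⁻¹ *
    B.map RatFunc.C

/-- `(A, B, C)` is minimal: no realization of its transfer function has a smaller dimension. -/
def IsMinimal {ι : Type*} [Fintype ι] [DecidableEq ι] {d m : ℕ}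
    (A : Matrix ι ι ℝ) (B : Matrix ι (Fin m) ℝ) (C : Matrix (Fin d) ι ℝ) : Prop :=
  ∀ (n : ℕ) (A' : Matrix (Fin n) (Fin n) ℝ) (B' : Matrix (Fin n) (Fin m) ℝ)
    (C' : Matrix (Fin d) (Fin n) ℝ),
    transferFunction A' B' C' = transferFunction A B C → Fintype.card ι ≤ n

/-- All eigenvalues of `A` have negative real part or are zero, and the eigenvalue zero has
algebraic and geometric multiplicity `c`. -/
structure HasCointegratedSpectrum {ι : Type*} [Fintype ι] [DecidableEq ι]
    (A : Matrix ι ι ℝ) (c : ℕ) : Prop where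
  spectrum : ∀ z ∈ spectrum ℂ (A.map (algebraMap ℝ ℂ)), z.re < 0 ∨ z = 0
  algebraic : A.charpoly.rootMultiplicity 0 = c
  geometric : Module.finrank ℝ (LinearMap.ker A.mulVecLin) = c

/-- The condition on `(A, B, C)` in the formal definition of a cointegrated state-space model, and
of a cointegrated MCARMA process when `(A, B, C)` is the MCARMA triple below. -/
def IsCointegratedModel {ι : Type*} [Fintype ι] [DecidableEq ι] {d m : ℕ}
    (A : Matrix ι ι ℝ) (B : Matrix ι (Fin m) ℝ) (C : Matrix (Fin d) ι ℝ) : Prop :=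
  IsMinimal A B C ∧ ∃ c : ℕ, 0 < c ∧ c < d ∧ HasCointegratedSpectrum A c

/-! ### MCARMA processes

The coefficients `P 0 = I, P 1, …, P p` and `Q 0, …, Q q` are the values of two sequences of matrices;
the later values are irrelevant. The state space `ℝᵖᵈ` is indexed by `Fin p × Fin d`
(block, position in the block). -/

/-- The autoregressive polynomial `P(z) = P₀ zᵖ + P₁ zᵖ⁻¹ + ⋯ + Pₚ` (with `P₀ = I`). -/
def arPoly {d : ℕ} (p : ℕ) (P : ℕ → Matrix (Fin d) (Fin d) ℝ) (z : ℂ) :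
    Matrix (Fin d) (Fin d) ℂ :=
  ∑ k ∈ Finset.range (p + 1), z ^ (p - k) • (P k).map (algebraMap ℝ ℂ)

/-- The block companion matrix, with last block row `(-Pₚ, -Pₚ₋₁, …, -P₁)`. -/
def companion {d : ℕ} (p : ℕ) (P : ℕ → Matrix (Fin d) (Fin d) ℝ) :
    Matrix (Fin p × Fin d) (Fin p × Fin d) ℝ :=
  Matrix.of fun i j =>
    if (i.1 : ℕ) + 1 = p then -P (p - j.1) i.2 j.2
    else if (j.1 : ℕ) = i.1 + 1 then (1 : Matrix (Fin d) (Fin d) ℝ) i.2 j.2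
    else 0

/-- The blocks `β₁, …, βₚ` of the input matrix: `βₖ = 0` for `1 ≤ k ≤ p - q - 1` and
`βₖ = Q_{k + q - p} - ∑_{i=1}^{k-1} Pᵢ βₖ₋ᵢ` for `p - q ≤ k ≤ p`. -/
def inputBlock {d m : ℕ} (p q : ℕ) (P : ℕ → Matrix (Fin d) (Fin d) ℝ)
    (Q : ℕ → Matrix (Fin d) (Fin m) ℝ) : ℕ → Matrix (Fin d) (Fin m) ℝ
  | 0 => 0
  | n + 1 =>
    if n + 1 + q < p then 0
    else Q (n + 1 + q - p) - ∑ i : Fin n, P (i + 1) * inputBlock p q P Q (n - i)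
  termination_by k => k
  decreasing_by omega

/-- The input matrix `B = (β₁ᵀ, …, βₚᵀ)ᵀ`. -/
def inputMatrix {d m : ℕ} (p q : ℕ) (P : ℕ → Matrix (Fin d) (Fin d) ℝ)
    (Q : ℕ → Matrix (Fin d) (Fin m) ℝ) : Matrix (Fin p × Fin d) (Fin m) ℝ :=
  Matrix.of fun i j => inputBlock p q P Q (i.1 + 1) i.2 j

/-- The observation matrix `C = (I, 0, …, 0)`. -/
def outputMatrix (p d : ℕ) : Matrix (Fin d) (Fin p × Fin d) ℝ :=
  Matrix.of fun i j => if (j.1 : ℕ) = 0 then (1 : Matrix (Fin d) (Fin d) ℝ) i j.2 else 0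

/-- `X` is the state process of a solution of `P(D) Y = Q(D) D L` on `[0, ∞)`, which means that
`dX = A X dt + B dL` for the matrices above. -/
def IsMCARMAState {Ω : Type*} [MeasurableSpace Ω] {d m : ℕ} (μ : Measure Ω) (p q : ℕ)
    (P : ℕ → Matrix (Fin d) (Fin d) ℝ) (Q : ℕ → Matrix (Fin d) (Fin m) ℝ)
    (L : ℝ≥0 → Ω → (Fin m → ℝ)) (X : ℝ≥0 → Ω → (Fin p × Fin d → ℝ)) : Prop :=
  IsStateSolution μ (companion p P) (inputMatrix p q P Q) L X

/-- The MCARMA process `Y = C X` with state process `X`. -/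
def output {Ω : Type*} {p d : ℕ} (X : ℝ≥0 → Ω → (Fin p × Fin d → ℝ)) :
    ℝ≥0 → Ω → (Fin d → ℝ) :=
  fun t ω => outputMatrix p d *ᵥ X t ω

end

end MCARMA

/-!
Write `A`, `B`, `C` for the MCARMA triple.

**Algebra.** A complex eigenvector of the companion matrix `A` has the form `(v, z v, …, zᵖ⁻¹ v)` with
`P(z) v = 0`, so `ha` locates the spectrum (`det_arPoly_eq_zero_of_eigenvector`). By `hb` the kernel
of `A` is the range of `N : u ↦ (βp u, 0, …, 0)`, and the rows of `W = αpᵀ (Pₚ₋₁, …, P₁, P₀)` are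
left null vectors. Since `W N = αpᵀ Pₚ₋₁ βp`, condition `hc` says that the eigenvalue zero is
semisimple, and `R = N (W N)⁻¹ W` (`kerProj`) is its spectral projection
(`isKernelSplitting_companion`). Moreover `W B = αpᵀ Q_q`. If this vanishes, the state space can be
cut down to the orthogonal complement of a row of `W`, so `(A, B, C)` is not minimal
(`not_isMinimal_of_vecMul_eq_zero`).

**Decomposition.** As `R A = A R = 0`, the part `R X` of a state process satisfies
`R X(t) = R X(0) + R B (L(t) - L(0))`, while `V = (1 - R) X` solves
`dV = (A - R) V dt + (1 - R) B dL`, whose coefficient `A - R` is Hurwitz, because subtracting `R` only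
moves the eigenvalue zero to `-1` (`IsKernelSplitting.re_neg_of_eigenvector`). Since `βᵀ C R = 0`, the
process `βᵀ Y` depends only on `V`, and the increments of `Y` depend only on `V` and the
increments of `L`. The difference of two solutions with the same driving path is
`exp (t A)` applied to the initial difference, and the exponential decay of
`exp (t (A - R))` gives both estimates for the convergence (`IsPathSolution.norm_sub_le`,
`IsPathSolution.norm_increment_sub_le`).

**Stationary solution.** All solutions are pathwise: an integration by parts gives the solution
`solve A B x l t = exp (t A) x + B l(t) + ∫₀ᵗ exp ((t - u) A) A B l(u) du` for a driving path `l` with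
`l 0 = 0`. The integral is written as a limit of Riemann sums (`memory`), so that it is a measurable
function of the path for the product σ-algebra. With `Zₖ` the solution at time one started from zero
and driven by the increments after time `k`, the sum `∑ₖ exp (k (A - R)) Zₖ` converges in mean square
and has a law `ν` which is invariant for the stable equation (`exists_isInvariantLaw`). Started from
`ν` independently of `L`, the stable part `V` is stationary jointly with the later increments of `L`
(`IsInvariantLaw.identDistrib_process`). The condition `βpᵀ Y(0) = 0` is achieved by a correction of
the initial state along the kernel of `A`, which does not affect `V`. If `q + 1 < p`, then `C B = 0`, so
`Y` is the integral of `C A X = C A V`, which is continuous in mean square by stationarity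
(`isMeanSquareDeriv_of_integral`).

**Non-stationarity.** We have `C R B = βp (W N)⁻¹ αpᵀ Q_q`, which is nonzero if `αpᵀ Q_q` is. If `Y` were
stationary, then for a nonzero row `u` of `C R B` the random walk `u · (L(n) - L(0))` would differ
from a stationary sequence by errors bounded in probability, so that after division by `√n` it
would tend to zero in probability. By the central limit theorem `u · L(1)` has variance zero
(`variance_eq_zero_of_identDistrib`), which contradicts the nonsingularity of the covariance.
-/

namespace MCARMA

set_option linter.unusedSectionVars false

/-! ### Right-continuous paths and Riemann sums -/

/-- A path on `[0, ∞)` that is right-continuous and bounded on bounded intervals. -/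
structure IsRegularPath {E : Type*} [NormedAddCommGroup E] (l : ℝ≥0 → E) : Prop where
  rightCts : ∀ t, ContinuousWithinAt l (Set.Ici t) t
  bdd : ∀ T, ∃ M, ∀ u ≤ T, ‖l u‖ ≤ M

section Paths

variable {E F : Type*} [NormedAddCommGroup E] [NormedSpace ℝ E]
  [NormedAddCommGroup F] [NormedSpace ℝ F]

theorem isRegularPath_of_cadlag {l : ℝ≥0 → E}
    (h : ∀ t : ℝ≥0, ContinuousWithinAt l (Set.Ici t) t ∧ ∃ y, Tendsto l (𝓝[<] t) (𝓝 y)) :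
    IsRegularPath l := by
  refine ⟨fun t => (h t).1, fun T => ?_⟩
  have key : ∃ M, ∀ u ∈ Set.Icc 0 T, ‖l u‖ ≤ M := by
    refine (isCompact_Icc (a := (0 : ℝ≥0)) (b := T)).induction_on (p := fun s => ∃ M, ∀ u ∈ s, ‖l u‖ ≤ M)
      ⟨0, by simp⟩ (fun s t hst ⟨M, hM⟩ => ⟨M, fun u hu => hM u (hst hu)⟩) ?_ ?_
    · rintro s t ⟨M, hM⟩ ⟨N, hN⟩
      refine ⟨max M N, ?_⟩
      rintro u (hu | hu)
      · exact (hM u hu).trans (le_max_left _ _)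
      · exact (hN u hu).trans (le_max_right _ _)
    · intro x _
      obtain ⟨hr, y, hy⟩ := h x
      have h1 : ∀ᶠ u in 𝓝[≥] x, ‖l u‖ ≤ ‖l x‖ + 1 :=
        (hr.norm.eventually_lt_const (lt_add_one _)).mono fun _ h => h.le
      have h2 : ∀ᶠ u in 𝓝[<] x, ‖l u‖ ≤ ‖y‖ + 1 :=
        (hy.norm.eventually_lt_const (lt_add_one _)).mono fun _ h => h.le
      have h3 : ∀ᶠ u in 𝓝 x, ‖l u‖ ≤ max (‖l x‖ + 1) (‖y‖ + 1) := by
        rw [← nhdsLT_sup_nhdsGE]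
        exact Filter.eventually_sup.2 ⟨h2.mono fun _ h => h.trans (le_max_right _ _),
          h1.mono fun _ h => h.trans (le_max_left _ _)⟩
      exact ⟨_, mem_nhdsWithin_of_mem_nhds h3, _, fun u hu => hu⟩
  obtain ⟨M, hM⟩ := key
  exact ⟨M, fun u hu => hM u ⟨zero_le, hu⟩⟩

/-- The right end points `(k + 1) t / n` of the partition of `[0, t]` into `n` equal intervals. -/
noncomputable def gridPoint (t : ℝ≥0) (n k : ℕ) : ℝ≥0 := ((k + 1 : ℝ≥0) / n) * t

theorem gridPoint_le {t : ℝ≥0} {n k : ℕ} (h : k < n) : gridPoint t n k ≤ t := by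
  unfold gridPoint
  refine mul_le_of_le_one_left zero_le (div_le_one_of_le₀ ?_ zero_le)
  exact_mod_cast h

/-- The Riemann sum of `f` over `[0, t]` with `n` equal intervals and values at right end points. -/
noncomputable def riemannSum (f : ℝ≥0 → E) (t : ℝ≥0) (n : ℕ) : E :=
  (t / n : ℝ) • ∑ k ∈ Finset.range n, f (gridPoint t n k)

/-- For the partition of `[0, ∞)` into intervals of length `1 / n`, the right end point of the interval
containing `u` tends to `u` from the right. -/
theorem tendsto_floor_add_one_div {u : ℝ} (hu : 0 ≤ u) :
    Tendsto (fun n : ℕ => ((⌊(n : ℝ) * u⌋₊ : ℝ) + 1) / n) atTop (𝓝[≥] u) := by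
  refine tendsto_nhdsWithin_iff.2 ⟨?_, ?_⟩
  · have h1 : Tendsto (fun n : ℕ => u + 1 / (n : ℝ)) atTop (𝓝 (u + 0)) :=
      tendsto_const_nhds.add tendsto_one_div_atTop_nhds_zero_nat
    rw [add_zero] at h1
    refine tendsto_of_tendsto_of_tendsto_of_le_of_le' tendsto_const_nhds h1 ?_ ?_
    · filter_upwards [eventually_gt_atTop 0] with n hn
      have hn' : (0 : ℝ) < n := by exact_mod_cast hn
      rw [le_div_iff₀ hn', mul_comm]
      exact (Nat.lt_floor_add_one _).le
    · filter_upwards [eventually_gt_atTop 0] with n hn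
      have hn' : (0 : ℝ) < n := by exact_mod_cast hn
      rw [div_le_iff₀ hn', add_mul, one_div, inv_mul_cancel₀ hn'.ne', mul_comm u]
      gcongr
      exact Nat.floor_le (by positivity)
  · filter_upwards [eventually_gt_atTop 0] with n hn
    have hn' : (0 : ℝ) < n := by exact_mod_cast hn
    simp only [Set.mem_Ici]
    rw [le_div_iff₀ hn', mul_comm]
    exact (Nat.lt_floor_add_one _).le

theorem IsRegularPath.rightCts_real {f : ℝ≥0 → E} (hf : IsRegularPath f) (u : ℝ) :
    ContinuousWithinAt (fun s : ℝ => f s.toNNReal) (Set.Ici u) u := by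
  have h1 := hf.rightCts u.toNNReal
  refine h1.comp continuous_real_toNNReal.continuousWithinAt ?_
  intro s hs
  exact Real.toNNReal_le_toNNReal hs

theorem IsRegularPath.aestronglyMeasurable [CompleteSpace E] {f : ℝ≥0 → E} (hf : IsRegularPath f) :
    AEStronglyMeasurable (fun s : ℝ => f s.toNNReal) (volume.restrict (Set.Ici 0)) := by
  refine aestronglyMeasurable_of_tendsto_ae atTop
    (f := fun (n : ℕ) (s : ℝ) => f (((⌊(n : ℝ) * s⌋₊ : ℝ) + 1) / n).toNNReal) ?_ ?_
  · intro n
    have h1 : StronglyMeasurable (fun k : ℕ => f (((k : ℝ) + 1) / n).toNNReal) :=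
      StronglyMeasurable.of_discrete
    have h2 : Measurable (fun s : ℝ => ⌊(n : ℝ) * s⌋₊) := Nat.measurable_floor.comp (by fun_prop)
    exact (h1.comp_measurable h2).aestronglyMeasurable
  · refine (ae_restrict_iff' measurableSet_Ici).2 (ae_of_all _ fun s hs => ?_)
    exact (hf.rightCts_real s).tendsto.comp (tendsto_floor_add_one_div hs)

theorem IsRegularPath.intervalIntegrable [CompleteSpace E] {f : ℝ≥0 → E} (hf : IsRegularPath f)
    {a b : ℝ} (ha : 0 ≤ a) (hb : 0 ≤ b) :
    IntervalIntegrable (fun s : ℝ => f s.toNNReal) volume a b := by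
  obtain ⟨M, hM⟩ := hf.bdd (max a b).toNNReal
  have hsub : Set.uIoc a b ⊆ Set.Ici 0 := fun x hx => by
    have := hx.1
    simp only [Set.mem_Ici]
    exact (le_min ha hb).trans this.le
  have hc : IntervalIntegrable (fun _ : ℝ => M) volume a b := intervalIntegrable_const
  refine hc.mono_fun (hf.aestronglyMeasurable.mono_measure (Measure.restrict_mono hsub le_rfl)) ?_
  refine (ae_restrict_iff' measurableSet_uIoc).2 (ae_of_all _ fun s hs => ?_)
  exact (hM _ (Real.toNNReal_le_toNNReal hs.2)).trans (le_abs_self _)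

theorem tendsto_riemannSum_one [CompleteSpace E] {f : ℝ≥0 → E} (hf : IsRegularPath f) :
    Tendsto (riemannSum f 1) atTop (𝓝 (∫ u in (0 : ℝ)..1, f u.toNNReal)) := by
  obtain ⟨M, hM⟩ := hf.bdd 2
  have hstep : ∀ᶠ n : ℕ in atTop, riemannSum f 1 n
      = ∫ u in (0 : ℝ)..1, f (((⌊(n : ℝ) * u⌋₊ : ℝ) + 1) / n).toNNReal := by
    filter_upwards [eventually_gt_atTop 0] with n hn
    have hn' : (0 : ℝ) < n := by exact_mod_cast hn
    have hpiece : ∀ k : ℕ, Set.EqOn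
        (fun u : ℝ => f (((⌊(n : ℝ) * u⌋₊ : ℝ) + 1) / n).toNNReal)
        (fun _ => f (gridPoint 1 n k)) (Set.Ioo ((k : ℝ) / n) (((k + 1 : ℕ) : ℝ) / n)) := by
      intro k u hu
      have h1 : ⌊(n : ℝ) * u⌋₊ = k := by
        rw [Nat.floor_eq_iff (by have := hu.1; have : 0 ≤ u := le_trans (by positivity) this.le
                                 positivity)]
        have h1 := hu.1
        have h2 := hu.2
        rw [div_lt_iff₀ hn'] at h1
        rw [lt_div_iff₀ hn'] at h2
        push_cast at h2
        constructor <;> linarith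
      simp only [h1, gridPoint, mul_one]
      congr 1
      rw [Real.toNNReal_div (by positivity), Real.toNNReal_natCast,
        Real.toNNReal_add (by positivity) zero_le_one]
      simp
    have hle : ∀ k : ℕ, (k : ℝ) / n ≤ ((k + 1 : ℕ) : ℝ) / n := fun k => by
      gcongr; exact_mod_cast Nat.le_succ k
    have hae : ∀ k : ℕ, ∀ᵐ u ∂(volume.restrict (Set.uIoc ((k : ℝ) / n) (((k + 1 : ℕ) : ℝ) / n))),
        f (((⌊(n : ℝ) * u⌋₊ : ℝ) + 1) / n).toNNReal = f (gridPoint 1 n k) := by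
      intro k
      rw [Set.uIoc_of_le (hle k), ← restrict_Ioo_eq_restrict_Ioc]
      exact (ae_restrict_iff' measurableSet_Ioo).2 (ae_of_all _ fun u hu => hpiece k hu)
    have hint : ∀ k < n, IntervalIntegrable
        (fun u : ℝ => f (((⌊(n : ℝ) * u⌋₊ : ℝ) + 1) / n).toNNReal) volume
        ((k : ℝ) / n) (((k + 1 : ℕ) : ℝ) / n) := by
      intro k _
      exact (intervalIntegrable_const (c := f (gridPoint 1 n k))).congr_ae
        ((hae k).mono fun _ h => h.symm)
    have hsum := intervalIntegral.sum_integral_adjacent_intervals hint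
    rw [Nat.cast_zero, zero_div, div_self hn'.ne'] at hsum
    rw [← hsum, riemannSum, Finset.smul_sum]
    refine Finset.sum_congr rfl fun k _ => ?_
    rw [intervalIntegral.integral_congr_ae_restrict (hae k), intervalIntegral.integral_const]
    congr 1
    push_cast
    field_simp
    ring
  refine Tendsto.congr' (EventuallyEq.symm hstep) ?_
  refine intervalIntegral.tendsto_integral_filter_of_dominated_convergence (fun _ => M) ?_ ?_ ?_ ?_
  · refine Eventually.of_forall fun n => ?_
    have h1 : StronglyMeasurable (fun k : ℕ => f (((k : ℝ) + 1) / n).toNNReal) :=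
      StronglyMeasurable.of_discrete
    have h2 : Measurable (fun s : ℝ => ⌊(n : ℝ) * s⌋₊) := Nat.measurable_floor.comp (by fun_prop)
    exact (h1.comp_measurable h2).aestronglyMeasurable
  · filter_upwards [eventually_gt_atTop 0] with n hn
    refine ae_of_all _ fun u hu => hM _ ?_
    rw [Set.uIoc_of_le zero_le_one] at hu
    have hn' : (1 : ℝ) ≤ n := by exact_mod_cast hn
    rw [Real.toNNReal_le_iff_le_coe, div_le_iff₀ (by linarith)]
    have h3 := Nat.floor_le (a := (n : ℝ) * u) (mul_nonneg (by linarith) hu.1.le)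
    have h4 : (n : ℝ) * u ≤ n := mul_le_of_le_one_right (by linarith) hu.2
    push_cast
    linarith
  · exact intervalIntegrable_const
  · refine ae_of_all _ fun u hu => ?_
    rw [Set.uIoc_of_le zero_le_one] at hu
    exact (hf.rightCts_real u).tendsto.comp (tendsto_floor_add_one_div hu.1.le)

theorem IsRegularPath.comp_mul {f : ℝ≥0 → E} (hf : IsRegularPath f) (t : ℝ≥0) :
    IsRegularPath (fun u => f (u * t)) := by
  refine ⟨fun u => ?_, fun T => ?_⟩
  · refine ContinuousWithinAt.comp (g := f) (f := fun v => v * t) (hf.rightCts (u * t))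
      (continuous_mul_const t).continuousWithinAt ?_
    intro s hs
    exact mul_le_mul_left hs t
  · obtain ⟨M, hM⟩ := hf.bdd (T * t)
    exact ⟨M, fun u hu => hM _ (mul_le_mul_left hu t)⟩

theorem tendsto_riemannSum [CompleteSpace E] {f : ℝ≥0 → E} (hf : IsRegularPath f) (t : ℝ≥0) :
    Tendsto (riemannSum f t) atTop (𝓝 (∫ u in (0 : ℝ)..t, f u.toNNReal)) := by
  have h := (tendsto_riemannSum_one (hf.comp_mul t)).const_smul (t : ℝ)
  have h1 : (t : ℝ) • ∫ u in (0 : ℝ)..1, f (u.toNNReal * t) = ∫ u in (0 : ℝ)..t, f u.toNNReal := by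
    have h2 := intervalIntegral.smul_integral_comp_mul_right (a := 0) (b := 1)
      (fun u : ℝ => f u.toNNReal) (t : ℝ)
    rw [zero_mul, one_mul] at h2
    rw [← h2]
    congr 1
    refine intervalIntegral.integral_congr fun u hu => ?_
    rw [Set.uIcc_of_le zero_le_one] at hu
    simp only [Real.toNNReal_mul hu.1, Real.toNNReal_coe]
  rw [h1] at h
  refine h.congr fun n => ?_
  simp only [riemannSum, gridPoint, mul_one, smul_smul]
  congr 1
  simp [div_eq_mul_inv]

theorem IsRegularPath.add {f g : ℝ≥0 → E} (hf : IsRegularPath f) (hg : IsRegularPath g) :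
    IsRegularPath (fun u => f u + g u) := by
  refine ⟨fun t => (hf.rightCts t).add (hg.rightCts t), fun T => ?_⟩
  obtain ⟨M, hM⟩ := hf.bdd T
  obtain ⟨N, hN⟩ := hg.bdd T
  exact ⟨M + N, fun u hu => (norm_add_le _ _).trans (add_le_add (hM u hu) (hN u hu))⟩

theorem isRegularPath_const (c : E) : IsRegularPath (fun _ => c) :=
  ⟨fun _ => continuousWithinAt_const, fun _ => ⟨‖c‖, fun _ _ => le_rfl⟩⟩

theorem isRegularPath_of_continuous {f : ℝ≥0 → E} (hf : Continuous f) : IsRegularPath f := by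
  refine ⟨fun t => hf.continuousWithinAt, fun T => ?_⟩
  obtain ⟨M, hM⟩ := (isCompact_Icc (a := (0 : ℝ≥0)) (b := T)).exists_bound_of_continuousOn
    hf.continuousOn
  exact ⟨M, fun u hu => hM u ⟨zero_le, hu⟩⟩

theorem IsRegularPath.sub_const {f : ℝ≥0 → E} (hf : IsRegularPath f) (c : E) :
    IsRegularPath (fun u => f u - c) := by
  simpa [sub_eq_add_neg] using hf.add (isRegularPath_const (-c))

theorem IsRegularPath.clm_apply {f : ℝ≥0 → E} {g : ℝ≥0 → E →L[ℝ] F} (hg : IsRegularPath g)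
    (hf : IsRegularPath f) : IsRegularPath (fun u => g u (f u)) := by
  refine ⟨fun t => (hg.rightCts t).clm_apply (hf.rightCts t), fun T => ?_⟩
  obtain ⟨M, hM⟩ := hf.bdd T
  obtain ⟨N, hN⟩ := hg.bdd T
  refine ⟨N * M, fun u hu => ?_⟩
  exact (ContinuousLinearMap.le_opNorm _ _).trans (mul_le_mul (hN u hu) (hM u hu) (norm_nonneg _)
    ((norm_nonneg _).trans (hN u hu)))

theorem IsRegularPath.map {f : ℝ≥0 → E} (hf : IsRegularPath f) (T : E →L[ℝ] F) :
    IsRegularPath (fun u => T (f u)) :=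
  (isRegularPath_const T).clm_apply hf

theorem IsRegularPath.comp_add {f : ℝ≥0 → E} (hf : IsRegularPath f) (s : ℝ≥0) :
    IsRegularPath (fun u => f (s + u)) := by
  refine ⟨fun u => ?_, fun T => ?_⟩
  · refine ContinuousWithinAt.comp (g := f) (f := fun v => s + v) (hf.rightCts (s + u))
      (by fun_prop) ?_
    intro v hv
    exact add_le_add_right hv s
  · obtain ⟨M, hM⟩ := hf.bdd (s + T)
    exact ⟨M, fun u hu => hM _ (add_le_add_right hu s)⟩

/-- Minkowski's integral inequality for processes with regular paths, by Fatou's lemma for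
Riemann sums; no joint measurability is needed. -/
theorem eLpNorm_integral_le [CompleteSpace E] {Ω : Type*} [MeasurableSpace Ω] {μ : Measure Ω}
    {f : ℝ≥0 → Ω → E} (hmeas : ∀ u, AEStronglyMeasurable (f u) μ)
    (hreg : ∀ᵐ ω ∂μ, IsRegularPath (fun u => f u ω)) {t : ℝ≥0} {M : ℝ≥0∞}
    (hM : ∀ u ≤ t, eLpNorm (f u) 2 μ ≤ M) :
    eLpNorm (fun ω => ∫ u in (0 : ℝ)..t, f u.toNNReal ω) 2 μ ≤ t * M := by
  refine (Lp.eLpNorm_lim_le_liminf_eLpNorm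
    (f := fun n ω => riemannSum (fun u => f u ω) t n) ?_ _ ?_).trans ?_
  · intro n
    unfold riemannSum
    exact (Finset.aestronglyMeasurable_fun_sum _ fun k _ => hmeas _).const_smul _
  · filter_upwards [hreg] with ω hω using tendsto_riemannSum hω t
  · refine liminf_le_of_le (by isBoundedDefault) fun b hb => ?_
    obtain ⟨n, hbn, hn⟩ := (hb.and (eventually_gt_atTop 0)).exists
    refine hbn.trans ?_
    have h1 : eLpNorm (fun ω => riemannSum (fun u => f u ω) t n) 2 μ
        = ‖(t / n : ℝ)‖ₑ * eLpNorm (fun ω => ∑ k ∈ Finset.range n, f (gridPoint t n k) ω) 2 μ :=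
      eLpNorm_const_smul _ _ _ _
    have h2 : eLpNorm (fun ω => ∑ k ∈ Finset.range n, f (gridPoint t n k) ω) 2 μ ≤ n * M := by
      have h3 := eLpNorm_sum_le (p := 2) (μ := μ) (s := Finset.range n)
        (f := fun k => f (gridPoint t n k)) (fun k _ => hmeas _) (by norm_num)
      have h4 : (∑ k ∈ Finset.range n, f (gridPoint t n k))
          = fun ω => ∑ k ∈ Finset.range n, f (gridPoint t n k) ω := by ext; simp
      rw [h4] at h3
      refine h3.trans ?_
      have h5 : ∑ k ∈ Finset.range n, eLpNorm (f (gridPoint t n k)) 2 μ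
          ≤ ∑ k ∈ Finset.range n, M :=
        Finset.sum_le_sum fun k hk => hM _ (gridPoint_le (Finset.mem_range.1 hk))
      simpa using h5
    rw [h1]
    refine (mul_le_mul_right h2 _).trans ?_
    rw [← mul_assoc]
    gcongr
    have : (t / n : ℝ) = ((t / n : ℝ≥0) : ℝ) := by push_cast; rfl
    rw [this, Real.enorm_eq_ofReal (NNReal.coe_nonneg _), ENNReal.ofReal_coe_nnreal]
    have hn0 : (n : ℝ≥0) ≠ 0 := by exact_mod_cast hn.ne'
    have : ((n : ℕ) : ℝ≥0∞) = ((n : ℝ≥0) : ℝ≥0∞) := by simp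
    rw [this, ← ENNReal.coe_mul, div_mul_cancel₀ _ hn0]

end Paths

/-! ### Linear equations driven by a regular path -/

section Flow

variable {E F : Type*} [NormedAddCommGroup E] [NormedSpace ℝ E] [CompleteSpace E]
  [NormedAddCommGroup F] [NormedSpace ℝ F]

/-- The flow `exp (t A)` of the linear equation `x' = A x`. -/
noncomputable def flow (A : E →L[ℝ] E) (t : ℝ) : E →L[ℝ] E := NormedSpace.exp (t • A)

theorem hasDerivAt_flow (A : E →L[ℝ] E) (t : ℝ) : HasDerivAt (flow A) (A * flow A t) t :=
  hasDerivAt_exp_smul_const' A t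

theorem hasDerivAt_flow' (A : E →L[ℝ] E) (t : ℝ) : HasDerivAt (flow A) (flow A t * A) t :=
  hasDerivAt_exp_smul_const A t

theorem continuous_flow (A : E →L[ℝ] E) : Continuous (flow A) :=
  continuous_iff_continuousAt.2 fun t => (hasDerivAt_flow A t).continuousAt

@[simp]
theorem flow_zero (A : E →L[ℝ] E) : flow A 0 = 1 := by simp [flow]

theorem flow_add (A : E →L[ℝ] E) (s t : ℝ) : flow A (s + t) = flow A s * flow A t := by
  unfold flow
  rw [add_smul]
  let _ : NormedAlgebra ℚ (E →L[ℝ] E) := NormedAlgebra.restrictScalars ℚ ℝ _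
  exact NormedSpace.exp_add_of_commute (((Commute.refl A).smul_left s).smul_right t)

theorem flow_natCast_mul (A : E →L[ℝ] E) (n : ℕ) (t : ℝ) : flow A (n * t) = flow A t ^ n := by
  induction n with
  | zero => simp
  | succ n ih => rw [Nat.cast_succ, add_mul, one_mul, flow_add, ih, pow_succ]

theorem flow_mul_flow_neg (A : E →L[ℝ] E) (t : ℝ) : flow A t * flow A (-t) = 1 := by
  rw [← flow_add, add_neg_cancel, flow_zero]

theorem flow_apply_flow_neg (A : E →L[ℝ] E) (t : ℝ) (x : E) : flow A t (flow A (-t) x) = x := by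
  have := congrArg (fun T : E →L[ℝ] E => T x) (flow_mul_flow_neg A t)
  simpa using this

/-- A locally integrable solution of the homogeneous linear integral equation is given by the
flow. -/
theorem eq_flow_of_integral_eq (A : E →L[ℝ] E) {D : ℝ≥0 → E}
    (hint : ∀ t : ℝ≥0, IntervalIntegrable (fun s : ℝ => D s.toNNReal) volume 0 t)
    (heq : ∀ t : ℝ≥0, D t = D 0 + ∫ s in (0 : ℝ)..t, A (D s.toNNReal)) (t : ℝ≥0) :
    D t = flow A t (D 0) := by
  have hint0 : ∀ a : ℝ, IntervalIntegrable (fun s : ℝ => D s.toNNReal) volume 0 a := by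
    intro a
    rcases le_total 0 a with ha | ha
    · simpa [Real.coe_toNNReal a ha] using hint a.toNNReal
    · refine (intervalIntegrable_const (c := D 0)).congr ?_
      intro s hs
      rw [Set.uIoc_of_ge ha] at hs
      simp only [Real.toNNReal_of_nonpos hs.2]
  have hint' : ∀ a b : ℝ, IntervalIntegrable (fun s : ℝ => D s.toNNReal) volume a b :=
    fun a b => (hint0 a).symm.trans (hint0 b)
  have hintA : ∀ a b : ℝ, IntervalIntegrable (fun s : ℝ => A (D s.toNNReal)) volume a b :=
    fun a b => ⟨A.integrable_comp (hint' a b).1, A.integrable_comp (hint' a b).2⟩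
  have hw := intervalIntegral.continuous_primitive hintA 0
  have hcont : Continuous fun s : ℝ => D s.toNNReal := by
    have h1 : (fun s : ℝ => D s.toNNReal)
        = fun s : ℝ => D 0 + ∫ u in (0 : ℝ)..(s.toNNReal : ℝ), A (D u.toNNReal) := by
      ext s; exact heq s.toNNReal
    rw [h1]
    exact continuous_const.add (hw.comp (by fun_prop))
  have hderiv : ∀ s : ℝ, HasDerivAt (fun v => ∫ u in (0 : ℝ)..v, A (D u.toNNReal))
      (A (D s.toNNReal)) s := fun s =>
    intervalIntegral.integral_hasDerivAt_right (hintA 0 s)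
      (A.continuous.comp hcont).stronglyMeasurable.stronglyMeasurableAtFilter
      (A.continuous.comp hcont).continuousAt
  have hneg : ∀ s : ℝ, HasDerivAt (fun v => flow A (-v)) (-(flow A (-s) * A)) s := fun s => by
    simpa [Function.comp_def] using (hasDerivAt_flow' A (-s)).scomp s (hasDerivAt_neg s)
  have hφ : ∀ s : ℝ, HasDerivAt
      (fun v => flow A (-v) (D 0 + ∫ u in (0 : ℝ)..v, A (D u.toNNReal)))
      ((-(flow A (-s) * A)) (D 0 + ∫ u in (0 : ℝ)..s, A (D u.toNNReal))
        + flow A (-s) (A (D s.toNNReal))) s := fun s =>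
    (hneg s).clm_apply ((hderiv s).const_add (D 0))
  have hconst := constant_of_has_deriv_right_zero (a := 0) (b := (t : ℝ))
    (f := fun v => flow A (-v) (D 0 + ∫ u in (0 : ℝ)..v, A (D u.toNNReal)))
    (fun s _ => (hφ s).continuousAt.continuousWithinAt) (fun s hs => by
      have h1 := (hφ s).hasDerivWithinAt (s := Set.Ici s)
      have h2 : D s.toNNReal = D 0 + ∫ u in (0 : ℝ)..s, A (D u.toNNReal) := by
        simpa [Real.coe_toNNReal s hs.1] using heq s.toNNReal
      rw [← h2] at h1
      simpa using h1) t ⟨t.coe_nonneg, le_rfl⟩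
  rw [← heq t] at hconst
  simp only [neg_zero, flow_zero, intervalIntegral.integral_same, add_zero,
    one_apply_eq_self] at hconst
  rw [← hconst, flow_apply_flow_neg]

/-- `X` solves `X(t) = X(0) + ∫₀ᵗ A X(s) ds + B l(t)` for all `t ≥ 0`. -/
structure IsPathSolution (A : E →L[ℝ] E) (B : F →L[ℝ] E) (l : ℝ≥0 → F) (X : ℝ≥0 → E) : Prop where
  integrable : ∀ t : ℝ≥0, IntervalIntegrable (fun s : ℝ => X s.toNNReal) volume 0 t
  equation : ∀ t : ℝ≥0, X t = X 0 + (∫ s in (0 : ℝ)..t, A (X s.toNNReal)) + B (l t)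

theorem IsPathSolution.sub_eq {A : E →L[ℝ] E} {B : F →L[ℝ] E} {l : ℝ≥0 → F} {X Y : ℝ≥0 → E}
    (hX : IsPathSolution A B l X) (hY : IsPathSolution A B l Y) (t : ℝ≥0) :
    X t - Y t = flow A t (X 0 - Y 0) := by
  refine eq_flow_of_integral_eq A (D := fun t => X t - Y t)
    (fun t => (hX.integrable t).sub (hY.integrable t)) (fun t => ?_) t
  have h1 : IntervalIntegrable (fun s : ℝ => A (X s.toNNReal)) volume 0 t :=
    ⟨A.integrable_comp (hX.integrable t).1, A.integrable_comp (hX.integrable t).2⟩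
  have h2 : IntervalIntegrable (fun s : ℝ => A (Y s.toNNReal)) volume 0 t :=
    ⟨A.integrable_comp (hY.integrable t).1, A.integrable_comp (hY.integrable t).2⟩
  simp only [map_sub]
  rw [intervalIntegral.integral_sub h1 h2]
  nth_rewrite 1 [hX.equation t, hY.equation t]
  abel

theorem IsPathSolution.unique {A : E →L[ℝ] E} {B : F →L[ℝ] E} {l : ℝ≥0 → F} {X Y : ℝ≥0 → E}
    (hX : IsPathSolution A B l X) (hY : IsPathSolution A B l Y) (h0 : X 0 = Y 0) (t : ℝ≥0) :
    X t = Y t := by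
  have := hX.sub_eq hY t
  rwa [h0, sub_self, map_zero, sub_eq_zero] at this

theorem IsPathSolution.map {E' : Type*} [NormedAddCommGroup E'] [NormedSpace ℝ E']
    [CompleteSpace E'] {A : E →L[ℝ] E} {B : F →L[ℝ] E} {l : ℝ≥0 → F} {X : ℝ≥0 → E}
    (hX : IsPathSolution A B l X) (T : E →L[ℝ] E') {A' : E' →L[ℝ] E'}
    (hT : ∀ x, T (A x) = A' (T x)) : IsPathSolution A' (T ∘L B) l (fun t => T (X t)) := by
  refine ⟨fun t => ⟨T.integrable_comp (hX.integrable t).1, T.integrable_comp (hX.integrable t).2⟩,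
    fun t => ?_⟩
  have h1 : IntervalIntegrable (fun s : ℝ => A (X s.toNNReal)) volume 0 t :=
    ⟨A.integrable_comp (hX.integrable t).1, A.integrable_comp (hX.integrable t).2⟩
  simp only [← hT]
  rw [T.intervalIntegral_comp_comm h1, hX.equation t]
  simp

/-- The increments of `l` after time `s`. -/
def shift (s : ℝ≥0) (l : ℝ≥0 → F) : ℝ≥0 → F := fun t => l (s + t) - l s

/-- The path `l` stopped at time `s`. -/
def stopAt (s : ℝ≥0) (l : ℝ≥0 → F) : ℝ≥0 → F := fun t => l (min t s)

theorem IsRegularPath.shift {l : ℝ≥0 → F} (hl : IsRegularPath l) (s : ℝ≥0) :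
    IsRegularPath (shift s l) :=
  (hl.comp_add s).sub_const _

@[simp]
theorem shift_zero (s : ℝ≥0) (l : ℝ≥0 → F) : shift s l 0 = 0 := by simp [shift]

theorem shift_shift (s t : ℝ≥0) (l : ℝ≥0 → F) : shift t (shift s l) = shift (s + t) l := by
  ext u; simp [shift, add_assoc]

theorem IsPathSolution.shift {A : E →L[ℝ] E} {B : F →L[ℝ] E} {l : ℝ≥0 → F} {X : ℝ≥0 → E}
    (hX : IsPathSolution A B l X) (s : ℝ≥0) :
    IsPathSolution A B (shift s l) (fun t => X (s + t)) := by
  have hshift : ∀ (t : ℝ≥0), Set.EqOn (fun v : ℝ => X ((s : ℝ) + v).toNNReal)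
      (fun v : ℝ => X (s + v.toNNReal)) (Set.uIcc 0 (t : ℝ)) := by
    intro t v hv
    rw [Set.uIcc_of_le t.coe_nonneg] at hv
    simp only [Real.toNNReal_add s.coe_nonneg hv.1, Real.toNNReal_coe]
  have hi : ∀ t : ℝ≥0, IntervalIntegrable (fun v : ℝ => X v.toNNReal) volume s ((s + t : ℝ≥0) : ℝ) :=
    fun t => (hX.integrable s).symm.trans (hX.integrable (s + t))
  refine ⟨fun t => ?_, fun t => ?_⟩
  · have h1 := (hi t).comp_add_left (s : ℝ)
    rw [sub_self, NNReal.coe_add, add_sub_cancel_left] at h1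
    refine h1.congr fun v hv => hshift t (Set.uIoc_subset_uIcc hv)
  · have h1 : ∀ t : ℝ≥0, IntervalIntegrable (fun s : ℝ => A (X s.toNNReal)) volume 0 t := fun t =>
      ⟨A.integrable_comp (hX.integrable t).1, A.integrable_comp (hX.integrable t).2⟩
    have h2 : ∫ v in (0 : ℝ)..t, A (X (s + v.toNNReal))
        = ∫ v in (s : ℝ)..((s + t : ℝ≥0) : ℝ), A (X v.toNNReal) := by
      have h3 := intervalIntegral.integral_comp_add_left (a := 0) (b := (t : ℝ))
        (fun v : ℝ => A (X v.toNNReal)) (s : ℝ)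
      rw [add_zero] at h3
      rw [NNReal.coe_add, ← h3]
      exact intervalIntegral.integral_congr fun v hv => by
        have := hshift t hv
        simp only at this ⊢
        rw [this]
    have h4 := intervalIntegral.integral_add_adjacent_intervals (h1 s)
      ((h1 s).symm.trans (h1 (s + t)))
    simp only [add_zero]
    rw [h2, hX.equation (s + t), hX.equation s, ← h4]
    simp only [MCARMA.shift, map_sub]
    abel

/-- The part `∫₀ᵗ exp ((t - u) A) A B l(u) du` of the solution with input `l`, defined for every path
as the limit of Riemann sums, which makes it measurable in `l`. -/
noncomputable def memory (A : E →L[ℝ] E) (B : F →L[ℝ] E) (l : ℝ≥0 → F) (t : ℝ≥0) : E :=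
  limUnder atTop (riemannSum (fun u : ℝ≥0 => flow A ((t : ℝ) - u) (A (B (l u)))) t)

/-- The solution of `dX = A X dt + B dl`, `X(0) = x`, written by means of an integration by parts as
`exp (t A) x + B l(t) + ∫₀ᵗ exp ((t - u) A) A B l(u) du`. -/
noncomputable def solve (A : E →L[ℝ] E) (B : F →L[ℝ] E) (x : E) (l : ℝ≥0 → F) (t : ℝ≥0) : E :=
  flow A t x + (B (l t) + memory A B l t)

theorem isRegularPath_memory_integrand (A : E →L[ℝ] E) (B : F →L[ℝ] E) {l : ℝ≥0 → F}
    (hl : IsRegularPath l) (t : ℝ) :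
    IsRegularPath (fun u : ℝ≥0 => flow A (t - u) (A (B (l u)))) :=
  (isRegularPath_of_continuous
    ((continuous_flow A).comp (by fun_prop : Continuous fun u : ℝ≥0 => t - (u : ℝ)))).clm_apply
    ((hl.map B).map A)

theorem memory_eq_integral (A : E →L[ℝ] E) (B : F →L[ℝ] E) {l : ℝ≥0 → F} (hl : IsRegularPath l)
    (t : ℝ≥0) :
    memory A B l t = ∫ u in (0 : ℝ)..t, flow A (t - u.toNNReal) (A (B (l u.toNNReal))) :=
  (tendsto_riemannSum (isRegularPath_memory_integrand A B hl t) t).limUnder_eq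

@[simp]
theorem memory_zero (A : E →L[ℝ] E) (B : F →L[ℝ] E) (l : ℝ≥0 → F) : memory A B l 0 = 0 := by
  refine Tendsto.limUnder_eq ?_
  have h : riemannSum (fun u : ℝ≥0 => flow A (((0 : ℝ≥0) : ℝ) - u) (A (B (l u)))) 0
      = fun _ => 0 := by
    ext n; simp [riemannSum]
  rw [h]
  exact tendsto_const_nhds

theorem solve_zero (A : E →L[ℝ] E) (B : F →L[ℝ] E) (x : E) {l : ℝ≥0 → F} (h0 : l 0 = 0) :
    solve A B x l 0 = x := by
  simp [solve, h0]

theorem solve_stopAt (A : E →L[ℝ] E) (B : F →L[ℝ] E) (x : E) (l : ℝ≥0 → F) (t : ℝ≥0) :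
    solve A B x (stopAt t l) t = solve A B x l t := by
  unfold solve memory
  congr 2
  · simp [stopAt]
  · congr 1
    ext n
    unfold riemannSum
    congr 1
    refine Finset.sum_congr rfl fun k hk => ?_
    simp only [stopAt, min_eq_left (gridPoint_le (Finset.mem_range.1 hk))]

theorem memory_eq_flow_integral (A : E →L[ℝ] E) (B : F →L[ℝ] E) {l : ℝ≥0 → F}
    (hl : IsRegularPath l) (t : ℝ≥0) :
    memory A B l t = flow A t (∫ u in (0 : ℝ)..t, flow A (-u.toNNReal) (A (B (l u.toNNReal)))) := by
  have h := (isRegularPath_memory_integrand A B hl 0).intervalIntegrable le_rfl t.coe_nonneg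
  simp only [zero_sub] at h
  rw [memory_eq_integral A B hl, ← (flow A t).intervalIntegral_comp_comm h]
  refine intervalIntegral.integral_congr fun u _ => ?_
  simp only [sub_eq_add_neg, flow_add, mul_apply_eq_comp]

theorem continuous_flow_integral (A : E →L[ℝ] E) (B : F →L[ℝ] E) {l : ℝ≥0 → F}
    (hl : IsRegularPath l) : ContinuousOn
      (fun t : ℝ => ∫ u in (0 : ℝ)..t, flow A (-u.toNNReal) (A (B (l u.toNNReal)))) (Set.Ici 0) := by
  intro t ht
  have hT : (0 : ℝ) ≤ t + 1 := by have : 0 ≤ t := ht; linarith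
  have h := (isRegularPath_memory_integrand A B hl 0).intervalIntegrable le_rfl hT
  simp only [zero_sub] at h
  have h1 := intervalIntegral.continuousOn_primitive_interval' h
    (by rw [Set.uIcc_of_le hT]; exact ⟨le_rfl, hT⟩)
  rw [Set.uIcc_of_le hT] at h1
  refine (h1 t ⟨ht, by linarith⟩).mono_of_mem_nhdsWithin ?_
  have h2 : Set.Iio (t + 1) ∈ 𝓝 t := Iio_mem_nhds (by linarith)
  filter_upwards [mem_nhdsWithin_of_mem_nhds h2, self_mem_nhdsWithin] with v hv hv'
  exact ⟨hv', hv.le⟩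

theorem isRegularPath_solve (A : E →L[ℝ] E) (B : F →L[ℝ] E) (x : E) {l : ℝ≥0 → F}
    (hl : IsRegularPath l) : IsRegularPath (solve A B x l) := by
  have h1 : Continuous fun t : ℝ≥0 => flow A t x :=
    ((continuous_flow A).comp NNReal.continuous_coe).clm_apply continuous_const
  have h2 : Continuous (memory A B l) := by
    have h3 : memory A B l = fun t : ℝ≥0 =>
        flow A t (∫ u in (0 : ℝ)..t, flow A (-u.toNNReal) (A (B (l u.toNNReal)))) := by
      ext t; exact memory_eq_flow_integral A B hl t
    rw [h3]
    refine ((continuous_flow A).comp NNReal.continuous_coe).clm_apply ?_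
    exact (continuous_flow_integral A B hl).comp_continuous NNReal.continuous_coe fun t => t.coe_nonneg
  exact (isRegularPath_of_continuous h1).add ((hl.map B).add (isRegularPath_of_continuous h2))

theorem isPathSolution_solve (A : E →L[ℝ] E) (B : F →L[ℝ] E) (x : E) {l : ℝ≥0 → F}
    (hl : IsRegularPath l) (h0 : l 0 = 0) : IsPathSolution A B l (solve A B x l) := by
  have hreg := isRegularPath_solve A B x hl
  refine ⟨fun t => hreg.intervalIntegrable le_rfl t.coe_nonneg, fun t => ?_⟩
  set h : ℝ → E := fun t => ∫ u in (0 : ℝ)..t, flow A (-u.toNNReal) (A (B (l u.toNNReal))) with hh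
  set k : ℝ → E := fun t => flow A t (x + h t) with hk
  have hsolve : ∀ s : ℝ≥0, solve A B x l s = k s + B (l s) := by
    intro s
    rw [solve, memory_eq_flow_integral A B hl, hk]
    simp only [map_add, hh]
    abel
  have hkc : ContinuousOn k (Set.uIcc 0 (t : ℝ)) := by
    rw [Set.uIcc_of_le t.coe_nonneg]
    refine (continuous_flow A).continuousOn.clm_apply (continuousOn_const.add ?_)
    exact (continuous_flow_integral A B hl).mono Set.Icc_subset_Ici_self
  have hreg' := isRegularPath_memory_integrand A B hl 0
  simp only [zero_sub] at hreg'
  have hderiv : ∀ s ∈ Set.Ioo (min 0 (t : ℝ)) (max 0 (t : ℝ)),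
      HasDerivWithinAt k (A (solve A B x l s.toNNReal)) (Set.Ioi s) s := by
    intro s hs
    rw [min_eq_left t.coe_nonneg, max_eq_right t.coe_nonneg] at hs
    have hs0 : 0 ≤ s := hs.1.le
    have h1 : HasDerivWithinAt h (flow A (-s.toNNReal) (A (B (l s.toNNReal)))) (Set.Ioi s) s := by
      refine (intervalIntegral.integral_hasDerivWithinAt_right
        (hreg'.intervalIntegrable le_rfl hs0) (s := Set.Ici s) (t := Set.Ioi s) ?_ ?_).mono
        Set.Ioi_subset_Ici_self
      · refine ⟨Set.Ici 0, ?_, hreg'.aestronglyMeasurable⟩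
        filter_upwards [self_mem_nhdsWithin] with v hv
        exact hs0.trans (le_of_lt hv)
      · exact (hreg'.rightCts_real s).mono Set.Ioi_subset_Ici_self
    have h2 := ((hasDerivAt_flow A s).hasDerivWithinAt (s := Set.Ioi s)).clm_apply
      (h1.const_add x)
    convert! h2 using 1
    have h3 := hsolve s.toNNReal
    rw [Real.coe_toNNReal s hs0] at h3
    rw [h3, Real.coe_toNNReal s hs0, flow_apply_flow_neg, map_add]
    simp [hk]
  have hA := hreg.map A
  have hftc := intervalIntegral.integral_eq_sub_of_hasDeriv_right hkc hderiv
    (hA.intervalIntegrable le_rfl t.coe_nonneg)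
  rw [hftc, solve_zero A B x h0, hsolve t]
  simp [hk, hh]

theorem solve_eq_of_isPathSolution {A : E →L[ℝ] E} {B : F →L[ℝ] E} {l : ℝ≥0 → F} {X : ℝ≥0 → E}
    (hl : IsRegularPath l) (h0 : l 0 = 0) (hX : IsPathSolution A B l X) (t : ℝ≥0) :
    X t = solve A B (X 0) l t :=
  hX.unique (isPathSolution_solve A B (X 0) hl h0) (solve_zero A B _ h0).symm t

/-- The cocycle property of the solution map. -/
theorem solve_add (A : E →L[ℝ] E) (B : F →L[ℝ] E) (x : E) {l : ℝ≥0 → F} (hl : IsRegularPath l)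
    (h0 : l 0 = 0) (s t : ℝ≥0) :
    solve A B x l (s + t) = solve A B (solve A B x l s) (shift s l) t := by
  have h := solve_eq_of_isPathSolution (hl.shift s) (shift_zero s l)
    ((isPathSolution_solve A B x hl h0).shift s) t
  simpa using h

theorem map_solve {E' : Type*} [NormedAddCommGroup E'] [NormedSpace ℝ E']
    [CompleteSpace E'] (A : E →L[ℝ] E) (B : F →L[ℝ] E) (x : E) {l : ℝ≥0 → F}
    (hl : IsRegularPath l) (h0 : l 0 = 0) (T : E →L[ℝ] E') {A' : E' →L[ℝ] E'}
    (hT : ∀ x, T (A x) = A' (T x)) (t : ℝ≥0) :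
    T (solve A B x l t) = solve A' (T ∘L B) (T x) l t := by
  have h := solve_eq_of_isPathSolution hl h0 ((isPathSolution_solve A B x hl h0).map T hT) t
  simpa [solve_zero A B x h0] using h

theorem solve_eq_flow_add (A : E →L[ℝ] E) (B : F →L[ℝ] E) (x : E) (l : ℝ≥0 → F) (t : ℝ≥0) :
    solve A B x l t = flow A t x + solve A B 0 l t := by
  simp [solve]

variable [MeasurableSpace E] [BorelSpace E] [SecondCountableTopology E]
  [MeasurableSpace F] [BorelSpace F] [SecondCountableTopology F]

theorem measurable_memory (A : E →L[ℝ] E) (B : F →L[ℝ] E) (t : ℝ≥0) :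
    Measurable (fun l : ℝ≥0 → F => memory A B l t) := by
  refine StronglyMeasurable.measurable ?_
  refine StronglyMeasurable.limUnder fun n => Measurable.stronglyMeasurable ?_
  unfold riemannSum
  refine Measurable.const_smul (Finset.measurable_fun_sum _ fun k _ => ?_) _
  exact (flow A _).measurable.comp (A.measurable.comp (B.measurable.comp (measurable_pi_apply _)))

theorem measurable_solve (A : E →L[ℝ] E) (B : F →L[ℝ] E) (t : ℝ≥0) :
    Measurable (fun p : E × (ℝ≥0 → F) => solve A B p.1 p.2 t) := by
  unfold solve
  exact ((flow A t).measurable.comp measurable_fst).add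
    ((B.measurable.comp ((measurable_pi_apply t).comp measurable_snd)).add
      ((measurable_memory A B t).comp measurable_snd))

theorem measurable_shift (s : ℝ≥0) : Measurable (shift s : (ℝ≥0 → F) → ℝ≥0 → F) :=
  measurable_pi_lambda _ fun t => (measurable_pi_apply (s + t)).sub (measurable_pi_apply s)

theorem measurable_stopAt (s : ℝ≥0) : Measurable (stopAt s : (ℝ≥0 → F) → ℝ≥0 → F) :=
  measurable_pi_lambda _ fun t => measurable_pi_apply (min t s)

end Flow

/-! ### Stability of Hurwitz matrices -/

/-- A real linear map intertwining a real and a complex operator intertwines their exponentials. -/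
theorem map_exp_apply {E E' : Type*} [NormedAddCommGroup E] [NormedSpace ℝ E] [CompleteSpace E]
    [NormedAddCommGroup E'] [NormedSpace ℂ E'] [CompleteSpace E'] (T : E →L[ℝ] E')
    (A : E →L[ℝ] E) (a : E' →L[ℂ] E') (h : ∀ x, T (A x) = a (T x)) (x : E) :
    T (NormedSpace.exp A x) = NormedSpace.exp a (T x) := by
  have hpow : ∀ n : ℕ, ∀ x, T ((A ^ n) x) = (a ^ n) (T x) := by
    intro n
    induction n with
    | zero => simp
    | succ n ih => intro x; simp only [pow_succ, mul_apply_eq_comp, ih, h]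
  have h1 := NormedSpace.exp_series_hasSum_exp' (𝕂 := ℝ) A
  have h2 := NormedSpace.exp_series_hasSum_exp' (𝕂 := ℝ) a
  have h3 := T.hasSum (((ContinuousLinearMap.apply ℝ E) x).hasSum h1)
  have h4 := ((ContinuousLinearMap.apply ℂ E') (T x)).hasSum h2
  refine h3.unique ?_
  convert! h4 using 2 with n
  simp only [ContinuousLinearMap.apply_apply, smul_apply, map_smul, hpow]

theorem exp_apply_of_eigenvector {E : Type*} [NormedAddCommGroup E] [NormedSpace ℂ E]
    [CompleteSpace E] (a : E →L[ℂ] E) {z : ℂ} {v : E} (h : a v = z • v) :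
    NormedSpace.exp a v = Complex.exp z • v := by
  have hpow : ∀ n : ℕ, (a ^ n) v = z ^ n • v := by
    intro n
    induction n with
    | zero => simp
    | succ n ih => rw [pow_succ, mul_apply_eq_comp, h, map_smul, ih, smul_smul, pow_succ, mul_comm]
  have h1 := ((ContinuousLinearMap.apply ℂ E) v).hasSum
    (NormedSpace.exp_series_hasSum_exp' (𝕂 := ℂ) a)
  have h2 := (NormedSpace.exp_series_hasSum_exp' (𝕂 := ℂ) z).smul_const v
  rw [← Complex.exp_eq_exp_ℂ] at h2
  refine h1.unique ?_
  convert! h2 using 2 with n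
  simp [hpow, smul_smul]

/-- The eigenspaces of `exp a` are invariant under `a`, so each of them contains an eigenvector of `a`
with some eigenvalue `z`, and the eigenvalue of `exp a` is `exp z`. -/
theorem norm_lt_one_of_mem_spectrum_exp {E : Type*} [NormedAddCommGroup E] [NormedSpace ℂ E]
    [FiniteDimensional ℂ E] [CompleteSpace E] (a : E →L[ℂ] E)
    (ha : ∀ (z : ℂ) (v : E), v ≠ 0 → a v = z • v → z.re < 0) {w : ℂ}
    (hw : w ∈ spectrum ℂ (NormedSpace.exp a)) : ‖w‖ < 1 := by
  have hw' : w ∈ spectrum ℂ ((NormedSpace.exp a : E →L[ℂ] E) : Module.End ℂ E) := by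
    refine fun hu => hw ?_
    have h1 : IsUnit (algebraMap ℂ (Module.End ℂ E) w - (NormedSpace.exp a : E →L[ℂ] E)) := hu
    change IsUnit (algebraMap ℂ (E →L[ℂ] E) w - NormedSpace.exp a)
    have h2 := (Module.End.isUnit_iff _).1 h1
    let e := LinearEquiv.ofBijective _ h2
    have h3 : algebraMap ℂ (E →L[ℂ] E) w - NormedSpace.exp a
        = (e.toContinuousLinearEquiv : E →L[ℂ] E) := by
      ext x
      simp [e, Algebra.algebraMap_eq_smul_one]
    rw [h3]
    exact (ContinuousLinearEquiv.unitsEquiv ℂ E).symm e.toContinuousLinearEquiv |>.isUnit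
  rw [← Module.End.hasEigenvalue_iff_mem_spectrum] at hw'
  set V := Module.End.eigenspace ((NormedSpace.exp a : E →L[ℂ] E) : Module.End ℂ E) w with hV
  have hcomm : Commute a (NormedSpace.exp a) := (Commute.refl a).exp_right
  have hmaps : ∀ x ∈ V, (a : E →ₗ[ℂ] E) x ∈ V := by
    intro x hx
    rw [hV, Module.End.mem_eigenspace_iff] at hx ⊢
    have := congrArg (fun T : E →L[ℂ] E => T x) hcomm.eq
    simp only [mul_apply_eq_comp] at this
    simp only [ContinuousLinearMap.coe_coe] at hx ⊢
    rw [← this, hx, map_smul]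
  have : Nontrivial V := (Submodule.nontrivial_iff_ne_bot).2 hw'
  obtain ⟨z, hz⟩ := Module.End.exists_eigenvalue ((a : E →ₗ[ℂ] E).restrict hmaps)
  obtain ⟨v, hv⟩ := hz.exists_hasEigenvector
  have hv1 : a (v : E) = z • (v : E) := by
    have := congrArg Subtype.val hv.apply_eq_smul
    simpa using this
  have hv0 : (v : E) ≠ 0 := fun h => hv.2 (Subtype.ext h)
  have h1 := exp_apply_of_eigenvector a hv1
  have h2 : NormedSpace.exp a (v : E) = w • (v : E) := Module.End.mem_eigenspace_iff.1 v.2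
  rw [h2] at h1
  rw [smul_left_injective ℂ hv0 h1, Complex.norm_exp, Real.exp_lt_one_iff]
  exact ha z v hv0 hv1

/-- By Gelfand's formula some power of `exp a` is a contraction if all eigenvalues of `a` have
negative real part. -/
theorem exists_norm_exp_pow_lt_one {E : Type*} [NormedAddCommGroup E] [NormedSpace ℂ E]
    [FiniteDimensional ℂ E] [CompleteSpace E] (a : E →L[ℂ] E)
    (ha : ∀ (z : ℂ) (v : E), v ≠ 0 → a v = z • v → z.re < 0) :
    ∃ n : ℕ, 0 < n ∧ ‖NormedSpace.exp a ^ n‖ < 1 := by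
  rcases subsingleton_or_nontrivial E with hE | hE
  · refine ⟨1, one_pos, ?_⟩
    rw [Subsingleton.elim (NormedSpace.exp a ^ 1) 0]
    simp
  · have h1 : spectralRadius ℂ (NormedSpace.exp a) < (1 : ℝ≥0) :=
      spectrum.spectralRadius_lt_of_forall_lt _ fun z hz =>
        norm_lt_one_of_mem_spectrum_exp a ha hz
    have h2 := (spectrum.pow_nnnorm_pow_one_div_tendsto_nhds_spectralRadius
      (NormedSpace.exp a)).eventually_lt_const h1
    obtain ⟨n, hn, hn0⟩ := (h2.and (eventually_gt_atTop 0)).exists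
    refine ⟨n, hn0, ?_⟩
    have hn' : (0 : ℝ) < 1 / n := by positivity
    by_contra hcon
    have h3 : (1 : ℝ≥0∞) ≤ ‖NormedSpace.exp a ^ n‖₊ := by exact_mod_cast not_lt.1 hcon
    exact absurd hn (not_lt.2 (by simpa using ENNReal.one_le_rpow h3 hn'))

/-- If the flow is a contraction at some integer time, it decays exponentially. -/
theorem exists_norm_flow_le_of_pow {E : Type*} [NormedAddCommGroup E] [NormedSpace ℝ E]
    [CompleteSpace E] (A : E →L[ℝ] E) {n : ℕ} (hn : 0 < n) (h : ‖flow A n‖ < 1) :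
    ∃ K lam : ℝ, 0 < lam ∧ ∀ t : ℝ, 0 ≤ t → ‖flow A t‖ ≤ K * Real.exp (-lam * t) := by
  obtain ⟨ρ, hρ, hρ1⟩ := exists_between h
  have hρ0 : 0 < ρ := (norm_nonneg _).trans_lt hρ
  obtain ⟨C, hC⟩ := (isCompact_Icc (a := (0 : ℝ)) (b := n)).exists_bound_of_continuousOn
    (continuous_flow A).continuousOn
  have hC0 : 0 ≤ C := (norm_nonneg _).trans (hC 0 ⟨le_rfl, n.cast_nonneg⟩)
  have hn' : (0 : ℝ) < n := by exact_mod_cast hn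
  have hlog : Real.log ρ < 0 := Real.log_neg hρ0 hρ1
  refine ⟨C * ρ⁻¹, -Real.log ρ / n, div_pos (by linarith) hn', fun t ht => ?_⟩
  set k := ⌊t / n⌋₊ with hk
  have hk1 : (k : ℝ) * n ≤ t := by
    rw [← le_div_iff₀ hn']
    exact Nat.floor_le (by positivity)
  have hk2 : t < ((k : ℝ) + 1) * n := by
    rw [← div_lt_iff₀ hn']
    exact Nat.lt_floor_add_one _
  have h1 : flow A t = flow A n ^ k * flow A (t - k * n) := by
    rw [← flow_natCast_mul, ← flow_add]
    congr 1
    ring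
  have h2 : ‖flow A n ^ k‖ ≤ ρ ^ k := by
    rcases Nat.eq_zero_or_pos k with h0 | h0
    · rw [h0, pow_zero, pow_zero]
      exact ContinuousLinearMap.norm_id_le
    · exact (norm_pow_le' _ h0).trans (pow_le_pow_left₀ (norm_nonneg _) hρ.le _)
  have h3 : ρ ^ k ≤ ρ⁻¹ * Real.exp (-(-Real.log ρ / n) * t) := by
    have h4 : ρ ^ (k + 1) ≤ Real.exp (-(-Real.log ρ / n) * t) := by
      rw [← Real.log_le_iff_le_exp (by positivity), Real.log_pow]
      push_cast
      have h5 : t / n ≤ (k : ℝ) + 1 := by rw [div_le_iff₀ hn']; exact hk2.le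
      have h6 : -(-Real.log ρ / n) * t = Real.log ρ * (t / n) := by field_simp
      rw [h6]
      nlinarith
    rw [inv_mul_eq_div, le_div_iff₀ hρ0, ← pow_succ]
    exact h4
  rw [h1]
  refine (norm_mul_le _ _).trans ?_
  have h5 := hC (t - k * n) ⟨by linarith, by nlinarith⟩
  calc ‖flow A n ^ k‖ * ‖flow A (t - k * n)‖ ≤ ρ ^ k * C := by gcongr
    _ ≤ (ρ⁻¹ * Real.exp (-(-Real.log ρ / n) * t)) * C := by gcongr
    _ = _ := by ring

/-- The continuous linear map `x ↦ M x`. -/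
noncomputable def toCLM {ι κ : Type*} [Fintype ι] [Fintype κ] (M : Matrix κ ι ℝ) :
    (ι → ℝ) →L[ℝ] (κ → ℝ) := LinearMap.toContinuousLinearMap M.mulVecLin

@[simp]
theorem toCLM_apply {ι κ : Type*} [Fintype ι] [Fintype κ] (M : Matrix κ ι ℝ) (x : ι → ℝ) :
    toCLM M x = M *ᵥ x := rfl

/-- The flow of a real matrix all of whose complex eigenvalues have negative real part decays
exponentially. -/
theorem exists_norm_flow_le {ι : Type*} [Fintype ι] (M : Matrix ι ι ℝ)
    (hM : ∀ (z : ℂ) (v : ι → ℂ), v ≠ 0 → M.map (algebraMap ℝ ℂ) *ᵥ v = z • v → z.re < 0) :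
    ∃ K lam : ℝ, 0 < lam ∧ ∀ t : ℝ, 0 ≤ t → ‖flow (toCLM M) t‖ ≤ K * Real.exp (-lam * t) := by
  let a : (ι → ℂ) →L[ℂ] (ι → ℂ) :=
    LinearMap.toContinuousLinearMap (M.map (algebraMap ℝ ℂ)).mulVecLin
  obtain ⟨n, hn, hlt⟩ := exists_norm_exp_pow_lt_one a hM
  let T : (ι → ℝ) →L[ℝ] (ι → ℂ) := ContinuousLinearMap.pi fun i =>
    Complex.ofRealCLM ∘L ContinuousLinearMap.proj i
  have hTn : ∀ x, ‖T x‖ = ‖x‖ := by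
    intro x
    simp only [Pi.norm_def]
    congr 2
    ext i
    simp [T]
  have hT : ∀ x, T (toCLM M x) = a (T x) := by
    intro x
    ext i
    simp [T, a, Matrix.mulVec, dotProduct]
  have hTexp : ∀ k : ℕ, ∀ x, T ((flow (toCLM M) 1 ^ k) x) = (NormedSpace.exp a ^ k) (T x) := by
    intro k
    induction k with
    | zero => simp
    | succ k ih =>
      intro x
      simp only [pow_succ, mul_apply_eq_comp, ih]
      congr 1
      have := map_exp_apply T (toCLM M) a hT x
      simpa [flow] using this
  refine exists_norm_flow_le_of_pow (toCLM M) hn ?_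
  have h1 : flow (toCLM M) n = flow (toCLM M) 1 ^ n := by
    rw [← flow_natCast_mul, mul_one]
  rw [h1]
  refine lt_of_le_of_lt ?_ hlt
  refine ContinuousLinearMap.opNorm_le_bound _ (norm_nonneg _) fun x => ?_
  rw [← hTn, hTexp, ← hTn x]
  exact ContinuousLinearMap.le_opNorm _ _

/-! ### Lévy processes -/

/-- Finitely many times belong to the range of a monotone sequence of times starting at zero. -/
theorem exists_monotone_covering (I : Finset ℝ≥0) :
    ∃ τ : ℕ → ℝ≥0, Monotone τ ∧ τ 0 = 0 ∧ ∀ x ∈ I, ∃ k, τ k = x := by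
  suffices H : ∃ (τ : ℕ → ℝ≥0) (N : ℕ), Monotone τ ∧ τ 0 = 0 ∧ (∀ x ∈ I, ∃ k ≤ N, τ k = x) ∧
      ∀ b, (∀ x ∈ I, x ≤ b) → τ N ≤ b by
    obtain ⟨τ, N, h1, h2, h3, -⟩ := H
    exact ⟨τ, h1, h2, fun x hx => (h3 x hx).imp fun _ h => h.2⟩
  induction I using Finset.induction_on_max with
  | empty => exact ⟨fun _ => 0, 0, monotone_const, rfl, by simp, fun b _ => zero_le⟩
  | insert a I ha ih =>
    obtain ⟨τ, N, h1, h2, h3, h4⟩ := ih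
    have hN : τ N ≤ a := h4 a fun x hx => (ha x hx).le
    refine ⟨fun k => if k ≤ N then τ k else a, N + 1, ?_, by simpa using h2, ?_, ?_⟩
    · intro i j hij
      by_cases hj : j ≤ N
      · simpa only [hj, hij.trans hj, if_true] using h1 hij
      · by_cases hi : i ≤ N
        · simpa only [hj, hi, if_true, if_false] using (h1 hi).trans hN
        · simp only [hj, hi, if_false, le_refl]
    · intro x hx
      rcases Finset.mem_insert.1 hx with rfl | hx
      · exact ⟨N + 1, le_rfl, by simp⟩
      · obtain ⟨k, hk, hk'⟩ := h3 x hx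
        exact ⟨k, hk.trans N.le_succ, by simpa [hk] using hk'⟩
    · intro b hb
      simpa using hb a (Finset.mem_insert_self a I)

section Levy

variable {Ω : Type*} [MeasurableSpace Ω] {m : ℕ} {μ : Measure Ω} [IsProbabilityMeasure μ]
  {L : ℝ≥0 → Ω → (Fin m → ℝ)}

/-- The path of `L` with its initial value subtracted. -/
def path (L : ℝ≥0 → Ω → (Fin m → ℝ)) (ω : Ω) : ℝ≥0 → (Fin m → ℝ) := fun t => L t ω - L 0 ω

@[simp]
theorem path_zero (ω : Ω) : path L ω 0 = 0 := by simp [path]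

theorem shift_path (s t : ℝ≥0) (ω : Ω) : shift s (path L ω) t = L (s + t) ω - L s ω := by
  simp [shift, path]

theorem IsLevyProcess.measurable_path (hL : IsLevyProcess μ L) : Measurable (path L) :=
  measurable_pi_lambda _ fun t => (hL.measurable t).sub (hL.measurable 0)

theorem IsLevyProcess.isRegularPath (hL : IsLevyProcess μ L) :
    ∀ᵐ ω ∂μ, IsRegularPath (path L ω) := by
  filter_upwards [hL.cadlag] with ω hω
  exact (isRegularPath_of_cadlag hω).sub_const _

/-- The value of a sum of the increments of `L` along `τ`. -/
theorem sum_increments (τ : ℕ → ℝ≥0) (ω : Ω) (i j : ℕ) (hij : i ≤ j) :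
    ∑ k ∈ Finset.Ico i j, (L (τ (k + 1)) ω - L (τ k) ω) = L (τ j) ω - L (τ i) ω :=
  Finset.sum_Ico_sub (fun k => L (τ k) ω) hij

/-- The increments after time `s` have the same law as the process itself. -/
theorem IsLevyProcess.identDistrib_shift (hL : IsLevyProcess μ L) (s : ℝ≥0) :
    IdentDistrib (fun ω => shift s (path L ω)) (path L) μ μ := by
  refine (identDistrib_iff_forall_finset_identDistrib
    (X := fun t ω => shift s (path L ω) t) (Y := fun t ω => path L ω t)
    ((measurable_shift s).comp hL.measurable_path).aemeasurable
    hL.measurable_path.aemeasurable).2 fun I => ?_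
  obtain ⟨τ, hτ, hτ0, hτI⟩ := exists_monotone_covering I
  have hincr : ∀ a b : ℝ≥0, a ≤ b → IdentDistrib (fun ω => L b ω - L a ω) (L (b - a)) μ μ := by
    intro a b hab
    have := hL.stationaryIncrements a (b - a)
    rwa [add_tsub_cancel_of_le hab] at this
  have h1 : IdentDistrib (fun ω k => L (s + τ (k + 1)) ω - L (s + τ k) ω)
      (fun ω k => L (τ (k + 1)) ω - L (τ k) ω) μ μ := by
    refine IdentDistrib.pi (fun k => ?_)
      (hL.indepIncrements.nat (t := fun k => s + τ k) fun a b h => add_le_add_right (hτ h) s)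
      (hL.indepIncrements.nat hτ)
    refine (hincr _ _ (add_le_add_right (hτ k.le_succ) s)).trans ?_
    rw [add_tsub_add_eq_tsub_left]
    exact (hincr _ _ (hτ k.le_succ)).symm
  -- the values at the times in `I` are sums of the increments along `τ`
  choose! κ hκ using hτI
  let u : (ℕ → Fin m → ℝ) → I → (Fin m → ℝ) := fun x t => ∑ k ∈ Finset.Ico 0 (κ t), x k
  have hu : Measurable u := measurable_pi_lambda _ fun t =>
    Finset.measurable_fun_sum _ fun k _ => measurable_pi_apply k
  have h2 := h1.comp hu
  convert! h2 using 1
  · ext ω t : 2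
    have := sum_increments (L := L) (fun k => s + τ k) ω 0 (κ t) zero_le
    simp only [Function.comp, u, this, Finset.restrict, shift_path, hτ0, hκ t t.2, add_zero]
  · ext ω t : 2
    have := sum_increments (L := L) τ ω 0 (κ t) zero_le
    simp only [Function.comp, u, this, Finset.restrict, path, hτ0, hκ t t.2]

/-- The increments after time `s` are independent of the process up to time `s`. -/
theorem IsLevyProcess.indepFun_stopAt_shift (hL : IsLevyProcess μ L) (s : ℝ≥0) :
    IndepFun (fun ω => stopAt s (path L ω)) (fun ω => shift s (path L ω)) μ := by
  have hm1 := (measurable_stopAt s).comp hL.measurable_path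
  have hm2 := (measurable_shift s).comp hL.measurable_path
  refine IndepFun.process_indepFun_process
    (X := fun t ω => stopAt s (path L ω) t) (Y := fun t ω => shift s (path L ω) t)
    (fun t => (measurable_pi_apply t).comp hm1) (fun t => (measurable_pi_apply t).comp hm2) ?_
  intro I J
  obtain ⟨τ, hτ, hτ0, hτI⟩ := exists_monotone_covering
    (insert s (I.image (fun t => min t s) ∪ J.image (fun t => s + t)))
  obtain ⟨k₀, hk₀⟩ := hτI s (Finset.mem_insert_self _ _)
  have hI : ∀ t ∈ I, ∃ k ≤ k₀, τ k = min t s := by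
    intro t ht
    obtain ⟨k, hk⟩ := hτI (min t s) (Finset.mem_insert_of_mem (Finset.mem_union_left _
      (Finset.mem_image_of_mem _ ht)))
    refine ⟨min k k₀, min_le_right _ _, ?_⟩
    rw [hτ.map_min, hk, hk₀, min_assoc, min_self]
  have hJ : ∀ t ∈ J, ∃ k ≥ k₀, τ k = s + t := by
    intro t ht
    obtain ⟨k, hk⟩ := hτI (s + t) (Finset.mem_insert_of_mem (Finset.mem_union_right _
      (Finset.mem_image_of_mem _ ht)))
    refine ⟨max k k₀, le_max_right _ _, ?_⟩
    rw [hτ.map_max, hk, hk₀, max_eq_left (le_add_of_nonneg_right zero_le)]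
  choose! κ hκ hκ' using hI
  choose! ρ hρ hρ' using hJ
  -- the past is a function of the increments along `τ` before `τ k₀ = s`, the future of the later ones
  let N := k₀ + J.sup ρ
  have hind := (hL.indepIncrements.nat hτ).indepFun_finset (Finset.range k₀)
    (Finset.Ico k₀ N) (by
      rw [Finset.disjoint_left]
      intro a ha hb
      exact absurd (Finset.mem_range.1 ha) (not_lt.2 (Finset.mem_Ico.1 hb).1))
    (fun k => (hL.measurable _).sub (hL.measurable _))
  let u : (Finset.range k₀ → Fin m → ℝ) → I → (Fin m → ℝ) :=
    fun x t => ∑ k : Finset.range k₀, if (k : ℕ) < κ t then x k else 0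
  let v : (Finset.Ico k₀ N → Fin m → ℝ) → J → (Fin m → ℝ) :=
    fun x t => ∑ k : Finset.Ico k₀ N, if (k : ℕ) < ρ t then x k else 0
  have hu : Measurable u := measurable_pi_lambda _ fun t =>
    Finset.measurable_fun_sum _ fun k _ => by
      by_cases h : (k : ℕ) < κ t
      · simpa only [h, if_true] using measurable_pi_apply k
      · simp only [h, if_false, measurable_const]
  have hv : Measurable v := measurable_pi_lambda _ fun t =>
    Finset.measurable_fun_sum _ fun k _ => by
      by_cases h : (k : ℕ) < ρ t
      · simpa only [h, if_true] using measurable_pi_apply k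
      · simp only [h, if_false, measurable_const]
  convert! hind.comp hu hv using 1
  · ext ω t : 2
    simp only [Function.comp, u]
    rw [Finset.sum_coe_sort (Finset.range k₀)
      (fun k => if k < κ t then L (τ (k + 1)) ω - L (τ k) ω else 0), ← Finset.sum_filter]
    have h1 : (Finset.range k₀).filter (fun k => k < κ t) = Finset.Ico 0 (κ t) := by
      ext k
      simp only [Finset.mem_filter, Finset.mem_range, Finset.mem_Ico]
      have := hκ t t.2
      omega
    rw [h1, sum_increments τ ω 0 (κ t) zero_le]
    simp only [stopAt, path, hκ' t t.2, hτ0]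
  · ext ω t : 2
    simp only [Function.comp, v]
    rw [Finset.sum_coe_sort (Finset.Ico k₀ N)
      (fun k => if k < ρ t then L (τ (k + 1)) ω - L (τ k) ω else 0), ← Finset.sum_filter]
    have h1 : (Finset.Ico k₀ N).filter (fun k => k < ρ t) = Finset.Ico k₀ (ρ t) := by
      ext k
      simp only [Finset.mem_filter, Finset.mem_Ico]
      have h2 : ρ t ≤ J.sup ρ := Finset.le_sup (f := ρ) t.2
      have : N = k₀ + J.sup ρ := rfl
      omega
    rw [h1, sum_increments τ ω k₀ (ρ t) (hρ t t.2)]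
    simp only [shift_path, hρ' t t.2, hk₀]

theorem IsLevyProcess.comp_measurePreserving {Ω' : Type*} [MeasurableSpace Ω'] {ν : Measure Ω'}
    (hL : IsLevyProcess μ L) {f : Ω' → Ω} (hf : MeasurePreserving f ν μ) :
    IsLevyProcess ν (fun t z => L t (f z)) where
  measurable t := (hL.measurable t).comp hf.measurable
  zero := hf.quasiMeasurePreserving.ae hL.zero
  indepIncrements n t ht := by
    have h := hL.indepIncrements n t ht
    rw [iIndepFun_iff_measure_inter_preimage_eq_mul] at h ⊢
    intro S sets hsets
    have hm : ∀ i : Fin n, Measurable fun ω => L (t i.succ) ω - L (t i.castSucc) ω :=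
      fun i => (hL.measurable _).sub (hL.measurable _)
    have h1 := h S hsets
    rw [← hf.measure_preimage (Finset.measurableSet_biInter S fun i hi =>
      hm i (hsets i hi)).nullMeasurableSet] at h1
    rw [Set.preimage_iInter₂] at h1
    refine h1.trans (Finset.prod_congr rfl fun i hi => ?_)
    rw [← hf.measure_preimage (hm i (hsets i hi)).nullMeasurableSet]
    rfl
  stationaryIncrements s t := by
    have h := hL.stationaryIncrements s t
    have hm : Measurable fun ω => L (s + t) ω - L s ω :=
      (hL.measurable (s + t)).sub (hL.measurable s)
    refine ⟨(hm.comp hf.measurable).aemeasurable,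
      ((hL.measurable t).comp hf.measurable).aemeasurable, ?_⟩
    have h1 := h.map_eq
    rw [← hf.map_eq, Measure.map_map hm hf.measurable,
      Measure.map_map (hL.measurable t) hf.measurable] at h1
    exact h1
  cadlag := hf.quasiMeasurePreserving.ae hL.cadlag

theorem IsCenteredNondegenerate.comp_measurePreserving {Ω' : Type*} [MeasurableSpace Ω']
    {ν : Measure Ω'} (hL : IsLevyProcess μ L) (hL2 : IsCenteredNondegenerate μ L) {f : Ω' → Ω}
    (hf : MeasurePreserving f ν μ) : IsCenteredNondegenerate ν (fun t z => L t (f z)) where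
  memLp := hL2.memLp.comp_measurePreserving hf
  mean := by
    have h := hL2.mean
    rw [← hf.map_eq, integral_map hf.measurable.aemeasurable
      (hL.measurable 1).aestronglyMeasurable] at h
    exact h
  cov := by
    have h := hL2.cov
    have h1 : ∀ i j, ∫ ω, L 1 ω i * L 1 ω j ∂μ = ∫ z, L 1 (f z) i * L 1 (f z) j ∂ν := by
      intro i j
      have hm : Measurable fun ω => L 1 ω i * L 1 ω j :=
        ((measurable_pi_apply i).comp (hL.measurable 1)).mul
          ((measurable_pi_apply j).comp (hL.measurable 1))
      nth_rewrite 1 [← hf.map_eq]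
      rw [integral_map hf.measurable.aemeasurable hm.aestronglyMeasurable]
    simpa only [h1] using h

end Levy

section Moments

variable {Ω : Type*} [MeasurableSpace Ω] {m : ℕ} {μ : Measure Ω} [IsProbabilityMeasure μ]
  {L : ℝ≥0 → Ω → (Fin m → ℝ)}

/-- If a sum of two independent random variables is square integrable, so is each summand. -/
theorem memLp_of_indepFun_add {X Y : Ω → ℝ} (hX : Measurable X) (hY : Measurable Y)
    (hind : IndepFun X Y μ) (h : MemLp (fun ω => X ω + Y ω) 2 μ) : MemLp X 2 μ := by
  have hmap := (indepFun_iff_map_prod_eq_prod_map_map hX.aemeasurable hY.aemeasurable).1 hind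
  have hXp : IsProbabilityMeasure (μ.map X) := Measure.isProbabilityMeasure_map hX.aemeasurable
  have hYp : IsProbabilityMeasure (μ.map Y) := Measure.isProbabilityMeasure_map hY.aemeasurable
  have h1 : Integrable (fun p : ℝ × ℝ => (p.1 + p.2) ^ 2) ((μ.map X).prod (μ.map Y)) := by
    rw [← hmap]
    rw [integrable_map_measure (by fun_prop) (hX.prodMk hY).aemeasurable]
    exact h.integrable_sq
  obtain ⟨y, hy⟩ := h1.prod_left_ae.exists
  have h2 : Integrable (fun ω => (X ω + y) ^ 2) μ :=
    (integrable_map_measure (g := fun x : ℝ => (x + y) ^ 2) (by fun_prop) hX.aemeasurable).1 hy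
  have h3 : MemLp (fun ω => X ω + y) 2 μ :=
    (memLp_two_iff_integrable_sq (hX.add_const y).aestronglyMeasurable).2 h2
  convert! h3.sub (memLp_const y) using 1
  ext ω
  simp

theorem eLpNorm_two_eq_sqrt {X : Ω → ℝ} (hX : MemLp X 2 μ) :
    eLpNorm X 2 μ = ENNReal.ofReal (√(∫ ω, X ω ^ 2 ∂μ)) := by
  rw [hX.eLpNorm_eq_integral_rpow_norm (by norm_num) (by norm_num), Real.sqrt_eq_rpow]
  congr 2
  · simp
  · simp

/-- At a rational time, the coordinates of `L` have variance proportional to time: the increments over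
intervals of length `1 / n` are independent and identically distributed. -/
theorem eLpNorm_path_rat (hL : IsLevyProcess μ L) (hL2 : IsCenteredNondegenerate μ L) (i : Fin m)
    (j n : ℕ) (hn : 0 < n) :
    eLpNorm (fun ω => path L ω ((j : ℝ≥0) / n) i) 2 μ
      ≤ ENNReal.ofReal (√((j : ℝ) / n) * √(∫ ω, L 1 ω i ^ 2 ∂μ)) := by
  have hn0 : (n : ℝ≥0) ≠ 0 := by exact_mod_cast hn.ne'
  let τ : ℕ → ℝ≥0 := fun k => (k : ℝ≥0) / n
  have hτ : Monotone τ := fun a b h => by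
    simp only [τ]
    gcongr
  -- the first `n` increments add up to `L 1`, the first `j` to the value in question
  let D : ℕ → Ω → ℝ := fun k ω => (L (τ (k + 1)) ω - L (τ k) ω) i
  have hDm : ∀ k, Measurable (D k) := fun k =>
    (measurable_pi_apply i).comp ((hL.measurable _).sub (hL.measurable _))
  have hSm : ∀ (s : Finset ℕ) (g : ℕ → ℕ), Measurable (∑ k ∈ s, D (g k)) := fun s g => by
    have e : ∑ k ∈ s, D (g k) = fun ω => ∑ k ∈ s, D (g k) ω := by ext; simp
    rw [e]
    exact Finset.measurable_fun_sum _ fun k _ => hDm _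
  have hind : iIndepFun D μ := (hL.indepIncrements.nat hτ).comp (fun _ x => x i)
    (fun _ => measurable_pi_apply i)
  have hD : ∀ k, IdentDistrib (D k) (D 0) μ μ := by
    have hstep : ∀ k, IdentDistrib (D k) (fun ω => L (1 / n) ω i) μ μ := by
      intro k
      have h1 := hL.stationaryIncrements (τ k) (1 / n)
      have h2 : τ k + 1 / n = τ (k + 1) := by
        simp only [τ]; push_cast; rw [add_div]
      rw [h2] at h1
      exact h1.comp (measurable_pi_apply i)
    exact fun k => (hstep k).trans (hstep 0).symm
  have hsum : ∀ j : ℕ, (fun ω => path L ω ((j : ℝ≥0) / n) i) = ∑ k ∈ Finset.range j, D k := by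
    intro j
    ext ω
    have h := congrFun (sum_increments (L := L) τ ω 0 j zero_le) i
    simp only [τ, Nat.cast_zero, zero_div] at h
    simp only [path, ← h, Finset.sum_apply, D, τ, Finset.range_eq_Ico]
  have hone : (fun ω => path L ω 1 i) =ᵐ[μ] fun ω => L 1 ω i := by
    filter_upwards [hL.zero] with ω hω
    simp [path, hω]
  have hL1 : MemLp (fun ω => L 1 ω i) 2 μ :=
    (ContinuousLinearMap.proj (R := ℝ) (φ := fun _ : Fin m => ℝ) i).comp_memLp' hL2.memLp
  have hsumn : (fun ω => path L ω 1 i) = ∑ k ∈ Finset.range n, D k := by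
    rw [← hsum n, div_self hn0]
  have hmemsum : MemLp (∑ k ∈ Finset.range n, D k) 2 μ := by
    rw [← hsumn]
    exact hL1.ae_eq hone.symm
  have hmem0 : MemLp (D 0) 2 μ := by
    obtain ⟨n', rfl⟩ : ∃ n', n = n' + 1 := ⟨n - 1, by omega⟩
    rw [Finset.sum_range_succ'] at hmemsum
    refine memLp_of_indepFun_add (X := D 0) (Y := ∑ k ∈ Finset.range n', D (k + 1)) (hDm 0)
      (hSm _ _) ?_ ?_
    · have h := hind.indepFun_finsetSum_of_notMem hDm
        (s := (Finset.range n').image (· + 1)) (i := 0) (by simp)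
      rw [Finset.sum_image (by simp)] at h
      exact h.symm
    · convert! hmemsum using 1
      ext ω
      simp [add_comm]
  have hmem : ∀ k, MemLp (D k) 2 μ := fun k => (hD k).memLp_iff.2 hmem0
  have hmean : ∫ ω, D 0 ω ∂μ = 0 := by
    have h1 : ∫ ω, L 1 ω i ∂μ = 0 := by
      have h2 := (ContinuousLinearMap.proj (R := ℝ) (φ := fun _ : Fin m => ℝ) i).integral_comp_comm
        (hL2.memLp.integrable (by norm_num))
      rw [hL2.mean] at h2
      simpa using h2
    rw [← integral_congr_ae hone] at h1
    simp only [fun ω => congrFun hsumn ω, Finset.sum_apply] at h1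
    rw [integral_finsetSum _ fun k _ => (hmem k).integrable (by norm_num)] at h1
    simp only [fun k => (hD k).integral_eq, Finset.sum_const, Finset.card_range, nsmul_eq_mul] at h1
    have hn1 : (n : ℝ) ≠ 0 := by exact_mod_cast hn.ne'
    exact (mul_eq_zero.1 h1).resolve_left hn1
  have hvar : ∀ j : ℕ, ∫ ω, (∑ k ∈ Finset.range j, D k) ω ^ 2 ∂μ = j * ∫ ω, D 0 ω ^ 2 ∂μ := by
    intro j
    have hm0 : ∫ ω, (∑ k ∈ Finset.range j, D k) ω ∂μ = 0 := by
      simp only [Finset.sum_apply]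
      rw [integral_finsetSum _ fun k _ => (hmem k).integrable (by norm_num)]
      simp only [fun k => (hD k).integral_eq, hmean, Finset.sum_const_zero]
    rw [← variance_of_integral_eq_zero (hSm _ fun k => k).aemeasurable hm0,
      ← variance_of_integral_eq_zero (hDm 0).aemeasurable hmean,
      IndepFun.variance_sum (fun k _ => hmem k) (fun a _ b _ hab => hind.indepFun hab)]
    simp only [fun k => (hD k).variance_eq, Finset.sum_const, Finset.card_range, nsmul_eq_mul]
  have hσ : ∫ ω, L 1 ω i ^ 2 ∂μ = n * ∫ ω, D 0 ω ^ 2 ∂μ := by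
    rw [← hvar n, ← hsumn]
    refine integral_congr_ae ?_
    filter_upwards [hone] with ω hω
    rw [hω]
  rw [hsum j, eLpNorm_two_eq_sqrt (memLp_finsetSum' _ fun k _ => hmem k), hvar j,
    ← Real.sqrt_mul (by positivity), hσ]
  refine le_of_eq ?_
  congr 2
  have hn1 : (n : ℝ) ≠ 0 := by exact_mod_cast hn.ne'
  field_simp

theorem eLpNorm_path_apply_le (hL : IsLevyProcess μ L) (hL2 : IsCenteredNondegenerate μ L)
    (i : Fin m) (t : ℝ≥0) :
    eLpNorm (fun ω => path L ω t i) 2 μ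
      ≤ ENNReal.ofReal (√(t : ℝ) * √(∫ ω, L 1 ω i ^ 2 ∂μ)) := by
  -- approximate `t` from the right by rational times and use right-continuity and Fatou's lemma
  let q : ℕ → ℝ≥0 := fun n => ((⌊((n : ℝ) + 1) * t⌋₊ + 1 : ℕ) : ℝ≥0) / ((n + 1 : ℕ) : ℝ≥0)
  have hq' : Tendsto (fun n => (q n : ℝ)) atTop (𝓝[≥] (t : ℝ)) := by
    have h := (tendsto_floor_add_one_div t.coe_nonneg).comp (tendsto_add_atTop_nat 1)
    refine h.congr fun n => ?_
    simp [q]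
  have hqt : ∀ᶠ n in atTop, t ≤ q n := by
    filter_upwards [hq' self_mem_nhdsWithin] with n hn
    exact_mod_cast hn
  have hq : Tendsto q atTop (𝓝[≥] t) := by
    refine tendsto_nhdsWithin_iff.2 ⟨?_, hqt⟩
    exact NNReal.tendsto_coe.1 (hq'.mono_right nhdsWithin_le_nhds)
  have hm : Measurable fun ω => path L ω := hL.measurable_path
  refine (Lp.eLpNorm_lim_le_liminf_eLpNorm (f := fun n ω => path L ω (q n) i) (fun n => ?_) _
    ?_).trans ?_
  · exact ((measurable_pi_apply i).comp ((measurable_pi_apply (q n)).comp hm)).aestronglyMeasurable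
  · filter_upwards [hL.isRegularPath] with ω hω
    exact (continuous_apply i).continuousAt.tendsto.comp ((hω.rightCts t).tendsto.comp hq)
  · have h1 : ∀ n, eLpNorm (fun ω => path L ω (q n) i) 2 μ
        ≤ ENNReal.ofReal (√(q n : ℝ) * √(∫ ω, L 1 ω i ^ 2 ∂μ)) := by
      intro n
      refine (eLpNorm_path_rat hL hL2 i _ (n + 1) n.succ_pos).trans (le_of_eq ?_)
      simp [q]
    refine (liminf_le_liminf (Eventually.of_forall h1)).trans (le_of_eq ?_)
    refine Tendsto.liminf_eq ?_
    refine ENNReal.tendsto_ofReal (Tendsto.mul_const _ ?_)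
    exact (Real.continuous_sqrt.tendsto _).comp (hq'.mono_right nhdsWithin_le_nhds)

theorem exists_eLpNorm_path_le (hL : IsLevyProcess μ L) (hL2 : IsCenteredNondegenerate μ L) :
    ∃ c : ℝ≥0, ∀ t : ℝ≥0, eLpNorm (fun ω => path L ω t) 2 μ ≤ c * NNReal.sqrt t := by
  refine ⟨∑ i : Fin m, Real.toNNReal (√(∫ ω, L 1 ω i ^ 2 ∂μ)), fun t => ?_⟩
  have hm : ∀ i, AEStronglyMeasurable (fun ω => path L ω t i) μ := fun i =>
    ((measurable_pi_apply i).comp ((measurable_pi_apply t).comp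
      hL.measurable_path)).aestronglyMeasurable
  have h1 : eLpNorm (fun ω => path L ω t) 2 μ
      ≤ eLpNorm (∑ i : Fin m, fun ω => ‖path L ω t i‖) 2 μ := by
    refine eLpNorm_mono fun ω => ?_
    rw [Finset.sum_apply, Real.norm_of_nonneg (Finset.sum_nonneg fun i _ => norm_nonneg _)]
    refine (pi_norm_le_iff_of_nonneg (Finset.sum_nonneg fun i _ => norm_nonneg _)).2 fun i => ?_
    exact Finset.single_le_sum (f := fun i => ‖path L ω t i‖) (fun i _ => norm_nonneg _)
      (Finset.mem_univ i)
  refine h1.trans ((eLpNorm_sum_le (fun i _ => (hm i).norm) (by norm_num)).trans ?_)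
  rw [ENNReal.ofNNReal_finsetSum, Finset.sum_mul]
  refine Finset.sum_le_sum fun i _ => ?_
  rw [eLpNorm_norm]
  refine (eLpNorm_path_apply_le hL hL2 i t).trans (le_of_eq ?_)
  rw [ENNReal.ofReal, Real.toNNReal_mul (Real.sqrt_nonneg _), mul_comm, ENNReal.coe_mul,
    ← Real.coe_sqrt, Real.toNNReal_coe]

theorem memLp_path (hL : IsLevyProcess μ L) (hL2 : IsCenteredNondegenerate μ L) (t : ℝ≥0) :
    MemLp (fun ω => path L ω t) 2 μ := by
  obtain ⟨c, hc⟩ := exists_eLpNorm_path_le hL hL2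
  refine ⟨((measurable_pi_apply t).comp hL.measurable_path).aestronglyMeasurable,
    (hc t).trans_lt ?_⟩
  exact ENNReal.mul_lt_top ENNReal.coe_lt_top ENNReal.coe_lt_top

end Moments

/-! ### The invariant law of a stable linear equation driven by a Lévy process -/

section Invariant

variable {Ω : Type*} [MeasurableSpace Ω] {m : ℕ} {μ : Measure Ω} [IsProbabilityMeasure μ]
  {L : ℝ≥0 → Ω → (Fin m → ℝ)}
  {E : Type*} [NormedAddCommGroup E] [NormedSpace ℝ E] [CompleteSpace E]
  [MeasurableSpace E] [BorelSpace E] [SecondCountableTopology E]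

theorem measurable_solve_path (hL : IsLevyProcess μ L) (A : E →L[ℝ] E)
    (B : (Fin m → ℝ) →L[ℝ] E) (x : E) (t : ℝ≥0) :
    Measurable (fun ω => solve A B x (path L ω) t) :=
  (measurable_solve A B t).comp (measurable_const.prodMk hL.measurable_path)

theorem eLpNorm_clm_apply_le {F G : Type*} [NormedAddCommGroup F] [NormedSpace ℝ F]
    [NormedAddCommGroup G] [NormedSpace ℝ G] (T : F →L[ℝ] G) (f : Ω → F) :
    eLpNorm (fun ω => T (f ω)) 2 μ ≤ ‖T‖ₑ * eLpNorm f 2 μ := by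
  have h := eLpNorm_le_nnreal_smul_eLpNorm_of_ae_le_mul (f := fun ω => T (f ω)) (g := f)
    (c := ‖T‖₊) (μ := μ) (ae_of_all _ fun ω => T.le_opNNNorm (f ω)) 2
  simpa [ENNReal.smul_def, enorm_eq_nnnorm] using h

theorem exists_eLpNorm_memory_le (hL : IsLevyProcess μ L) (hL2 : IsCenteredNondegenerate μ L)
    (A : E →L[ℝ] E) (B : (Fin m → ℝ) →L[ℝ] E) (T : ℝ≥0) :
    ∃ C : ℝ≥0, ∀ t ≤ T, eLpNorm (fun ω => memory A B (path L ω) t) 2 μ ≤ t * C := by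
  obtain ⟨c, hc⟩ := exists_eLpNorm_path_le hL hL2
  obtain ⟨K, hK⟩ := (isCompact_Icc (a := (0 : ℝ)) (b := T)).exists_bound_of_continuousOn
    (continuous_flow A).continuousOn
  refine ⟨K.toNNReal * (‖A‖₊ * (‖B‖₊ * (c * NNReal.sqrt T))), fun t ht => ?_⟩
  have hm : ∀ u, Measurable fun ω => path L ω u := fun u =>
    (measurable_pi_apply u).comp hL.measurable_path
  have h1 : (fun ω => memory A B (path L ω) t) =ᵐ[μ]
      fun ω => ∫ u in (0 : ℝ)..t,
        flow A (t - u.toNNReal) (A (B (path L ω u.toNNReal))) := by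
    filter_upwards [hL.isRegularPath] with ω hω using memory_eq_integral A B hω t
  rw [eLpNorm_congr_ae h1]
  refine eLpNorm_integral_le (f := fun u ω => flow A (t - u) (A (B (path L ω u))))
    (fun u => ?_) ?_ fun u hu => ?_
  · exact ((flow A _).measurable.comp (A.measurable.comp
      (B.measurable.comp (hm u)))).aestronglyMeasurable
  · filter_upwards [hL.isRegularPath] with ω hω using isRegularPath_memory_integrand A B hω t
  · refine (eLpNorm_clm_apply_le (flow A (t - u)) (fun ω => A (B (path L ω u)))).trans ?_
    push_cast
    have hK' : ‖flow A (t - u)‖ₑ ≤ K.toNNReal := by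
      have h2 := hK (t - u) ⟨sub_nonneg.2 (by exact_mod_cast hu),
        (sub_le_self _ u.coe_nonneg).trans (by exact_mod_cast ht)⟩
      rw [← ofReal_norm, ENNReal.ofReal]
      exact_mod_cast Real.toNNReal_le_toNNReal h2
    gcongr
    refine (eLpNorm_clm_apply_le A (fun ω => B (path L ω u))).trans ?_
    rw [← enorm_eq_nnnorm, ← enorm_eq_nnnorm]
    gcongr
    refine (eLpNorm_clm_apply_le B (fun ω => path L ω u)).trans ?_
    gcongr
    refine (hc u).trans ?_
    gcongr
    exact hu.trans ht

theorem memLp_memory (hL : IsLevyProcess μ L) (hL2 : IsCenteredNondegenerate μ L)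
    (A : E →L[ℝ] E) (B : (Fin m → ℝ) →L[ℝ] E) (t : ℝ≥0) :
    MemLp (fun ω => memory A B (path L ω) t) 2 μ := by
  obtain ⟨C, hC⟩ := exists_eLpNorm_memory_le hL hL2 A B t
  exact ⟨((measurable_memory A B t).comp hL.measurable_path).aestronglyMeasurable,
    (hC t le_rfl).trans_lt (ENNReal.mul_lt_top ENNReal.coe_lt_top ENNReal.coe_lt_top)⟩

theorem memLp_solve (hL : IsLevyProcess μ L) (hL2 : IsCenteredNondegenerate μ L)
    (A : E →L[ℝ] E) (B : (Fin m → ℝ) →L[ℝ] E) (x : E) (t : ℝ≥0) :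
    MemLp (fun ω => solve A B x (path L ω) t) 2 μ := by
  have h1 : MemLp (fun _ : Ω => flow A t x) 2 μ := memLp_const _
  have h2 : MemLp (fun ω => B (path L ω t)) 2 μ := B.comp_memLp' (memLp_path hL hL2 t)
  have h3 := h1.add (h2.add (memLp_memory hL hL2 A B t))
  exact h3

/-- The characteristic function of a functional of the past plus a functional of the future. -/
theorem charFunDual_past_add_future (hL : IsLevyProcess μ L) (s : ℝ≥0)
    {Φ Ψ : (ℝ≥0 → Fin m → ℝ) → E} (hΦ : Measurable Φ) (hΨ : Measurable Ψ) (T : E →L[ℝ] E)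
    (θ : StrongDual ℝ E) :
    charFunDual (μ.map fun ω => T (Φ (stopAt s (path L ω))) + Ψ (shift s (path L ω))) θ
      = charFunDual (μ.map fun ω => Φ (stopAt s (path L ω))) (θ ∘L T)
        * charFunDual (μ.map fun ω => Ψ (path L ω)) θ := by
  have hΦm : Measurable fun ω => Φ (stopAt s (path L ω)) :=
    hΦ.comp ((measurable_stopAt s).comp hL.measurable_path)
  have hΨm : Measurable fun ω => Ψ (shift s (path L ω)) :=
    hΨ.comp ((measurable_shift s).comp hL.measurable_path)
  have hind : IndepFun (fun ω => T (Φ (stopAt s (path L ω)))) (fun ω => Ψ (shift s (path L ω))) μ :=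
    (hL.indepFun_stopAt_shift s).comp (T.measurable.comp hΦ) hΨ
  have hTm : Measurable fun ω => T (Φ (stopAt s (path L ω))) := T.measurable.comp hΦm
  rw [hind.charFunDual_map_fun_add_eq_mul hTm.aemeasurable hΨm.aemeasurable]
  have h1 : μ.map (fun ω => Ψ (shift s (path L ω))) = μ.map fun ω => Ψ (path L ω) :=
    ((hL.identDistrib_shift s).comp hΨ).map_eq
  have h2 : μ.map (fun ω => T (Φ (stopAt s (path L ω))))
      = (μ.map fun ω => Φ (stopAt s (path L ω))).map T := by
    rw [Measure.map_map T.measurable hΦm]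
    rfl
  rw [Pi.mul_apply, h1, h2, charFunDual_map]

/-- The characteristic function at time `t` of the solution starting from zero. -/
noncomputable def solveChar (μ : Measure Ω) (L : ℝ≥0 → Ω → (Fin m → ℝ)) (A : E →L[ℝ] E)
    (B : (Fin m → ℝ) →L[ℝ] E) (t : ℝ≥0) (θ : StrongDual ℝ E) : ℂ :=
  charFunDual (μ.map fun ω => solve A B 0 (path L ω) t) θ

theorem solveChar_add (hL : IsLevyProcess μ L) (A : E →L[ℝ] E) (B : (Fin m → ℝ) →L[ℝ] E)
    (s t : ℝ≥0) (θ : StrongDual ℝ E) :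
    solveChar μ L A B (s + t) θ = solveChar μ L A B s (θ ∘L flow A t) * solveChar μ L A B t θ := by
  have hm : ∀ t, Measurable fun l : ℝ≥0 → Fin m → ℝ => solve A B 0 l t := fun t =>
    (measurable_solve A B t).comp (measurable_const.prodMk measurable_id)
  have h := charFunDual_past_add_future hL s (hm s) (hm t) (flow A t) θ
  simp only [solve_stopAt] at h
  rw [solveChar, solveChar, solveChar, ← h]
  congr 1
  refine Measure.map_congr ?_
  filter_upwards [hL.isRegularPath] with ω hω
  rw [solve_add A B 0 hω (path_zero ω), solve_eq_flow_add]

/-- A law `ν` is invariant for the equation if adding to `exp (s A) ξ`, with `ξ` of law `ν`, an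
independent copy of the solution started from zero gives the law `ν` again; this is expressed in
terms of characteristic functions. -/
def IsInvariantLaw (μ : Measure Ω) (L : ℝ≥0 → Ω → (Fin m → ℝ)) (A : E →L[ℝ] E)
    (B : (Fin m → ℝ) →L[ℝ] E) (ν : Measure E) : Prop :=
  ∀ (s : ℝ≥0) (θ : StrongDual ℝ E),
    charFunDual ν (θ ∘L flow A s) * solveChar μ L A B s θ = charFunDual ν θ

/-- The sum `∑_{k<n} exp (k A) Zₖ`, where `Zₖ` is the solution at time one, started from zero and
driven by the increments after time `k`. -/
noncomputable def discountedSum (A : E →L[ℝ] E) (B : (Fin m → ℝ) →L[ℝ] E)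
    (l : ℝ≥0 → Fin m → ℝ) (n : ℕ) : E :=
  ∑ k ∈ Finset.range n, flow A k (solve A B 0 (shift k l) 1)

theorem measurable_discountedSum (A : E →L[ℝ] E) (B : (Fin m → ℝ) →L[ℝ] E) (n : ℕ) :
    Measurable fun l => discountedSum A B l n :=
  Finset.measurable_fun_sum _ fun k _ => (flow A k).measurable.comp
    ((measurable_solve A B 1).comp (measurable_const.prodMk (measurable_shift k)))

theorem discountedSum_succ (A : E →L[ℝ] E) (B : (Fin m → ℝ) →L[ℝ] E) {l : ℝ≥0 → Fin m → ℝ}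
    (h0 : l 0 = 0) (n : ℕ) : discountedSum A B l (n + 1)
      = solve A B 0 l 1 + flow A 1 (discountedSum A B (shift 1 l) n) := by
  unfold discountedSum
  rw [Finset.sum_range_succ', add_comm, map_sum]
  congr 1
  · have : shift ((0 : ℕ) : ℝ≥0) l = l := by ext t; simp [shift, h0]
    rw [this]
    simp
  · refine Finset.sum_congr rfl fun k _ => ?_
    rw [shift_shift, Nat.cast_succ, Nat.cast_succ, add_comm (k : ℝ) 1, flow_add, mul_apply_eq_comp,
      add_comm (k : ℝ≥0) 1]

/-- Reversing the order of the independent increments does not change the law. -/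
theorem charFunDual_discountedSum (hL : IsLevyProcess μ L) (A : E →L[ℝ] E)
    (B : (Fin m → ℝ) →L[ℝ] E) (n : ℕ) (θ : StrongDual ℝ E) :
    charFunDual (μ.map fun ω => discountedSum A B (path L ω) n) θ = solveChar μ L A B n θ := by
  have hm : ∀ t, Measurable fun l : ℝ≥0 → Fin m → ℝ => solve A B 0 l t := fun t =>
    (measurable_solve A B t).comp (measurable_const.prodMk measurable_id)
  induction n generalizing θ with
  | zero =>
    have h1 : (fun ω => solve A B 0 (path L ω) ((0 : ℕ) : ℝ≥0)) = fun _ => 0 := by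
      ext ω
      rw [Nat.cast_zero, solve_zero A B 0 (path_zero ω)]
    rw [solveChar, h1]
    rfl
  | succ n ih =>
    have h := charFunDual_past_add_future hL 1 (hm 1)
      ((flow A 1).measurable.comp (measurable_discountedSum A B n)) (ContinuousLinearMap.id ℝ E) θ
    simp only [solve_stopAt, ContinuousLinearMap.id_apply, ContinuousLinearMap.comp_id,
      Function.comp_def] at h
    have h2 : μ.map (fun ω => flow A 1 (discountedSum A B (path L ω) n))
        = (μ.map fun ω => discountedSum A B (path L ω) n).map (flow A 1) := by
      have hU : Measurable fun ω => discountedSum A B (path L ω) n :=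
        (measurable_discountedSum A B n).comp hL.measurable_path
      rw [Measure.map_map (flow A 1).measurable hU]
      rfl
    rw [h2, charFunDual_map, ih] at h
    simp only [discountedSum_succ A B (path_zero _)]
    rw [h, Nat.cast_succ, solveChar_add hL, mul_comm]
    simp [solveChar]

theorem tendsto_solveChar_comp (hL : IsLevyProcess μ L) (A : E →L[ℝ] E)
    (B : (Fin m → ℝ) →L[ℝ] E) (s : ℝ≥0) (θ : StrongDual ℝ E) {T : ℕ → E →L[ℝ] E}
    (hT : Tendsto T atTop (𝓝 0)) :
    Tendsto (fun n => solveChar μ L A B s (θ ∘L T n)) atTop (𝓝 1) := by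
  have hm := measurable_solve_path hL A B 0 s
  have h : ∀ θ : StrongDual ℝ E, solveChar μ L A B s θ
      = ∫ ω, Complex.exp (θ (solve A B 0 (path L ω) s) * Complex.I) ∂μ := by
    intro θ
    rw [solveChar, charFunDual_apply, integral_map hm.aemeasurable]
    exact (Continuous.aestronglyMeasurable (by fun_prop))
  simp only [h]
  have h1 : (1 : ℂ) = ∫ ω : Ω, (1 : ℂ) ∂μ := by simp
  rw [h1]
  refine tendsto_integral_of_dominated_convergence (fun _ => 1) ?_ (integrable_const _) ?_ ?_
  · intro n
    refine Continuous.comp_aestronglyMeasurable (g := fun x : E =>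
      Complex.exp (((θ ∘L T n) x : ℝ) * Complex.I)) (by fun_prop) hm.aestronglyMeasurable
  · intro n
    refine ae_of_all _ fun ω => ?_
    rw [Complex.norm_exp_ofReal_mul_I]
  · refine ae_of_all _ fun ω => ?_
    have h2 : Tendsto (fun n => T n (solve A B 0 (path L ω) s)) atTop (𝓝 0) := by
      have := ((ContinuousLinearMap.apply ℝ E (solve A B 0 (path L ω) s)).continuous.tendsto 0).comp
        hT
      simpa [Function.comp_def] using this
    have h3 : Continuous fun x : E => Complex.exp ((θ x : ℝ) * Complex.I) := by fun_prop
    have h4 := (h3.tendsto 0).comp h2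
    simpa [Function.comp_def] using h4

end Invariant

section Invariant

variable {Ω : Type*} [MeasurableSpace Ω] {m : ℕ} {μ : Measure Ω} [IsProbabilityMeasure μ]
  {L : ℝ≥0 → Ω → (Fin m → ℝ)}
  {E : Type*} [NormedAddCommGroup E] [NormedSpace ℝ E] [CompleteSpace E]
  [MeasurableSpace E] [BorelSpace E] [SecondCountableTopology E]

theorem eLpNorm_discountedSum_term_le (hL : IsLevyProcess μ L) (A : E →L[ℝ] E)
    (B : (Fin m → ℝ) →L[ℝ] E) (k : ℕ) :
    eLpNorm (fun ω => flow A k (solve A B 0 (shift k (path L ω)) 1)) 2 μ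
      ≤ ‖flow A k‖ₑ * eLpNorm (fun ω => solve A B 0 (path L ω) 1) 2 μ := by
  refine (eLpNorm_clm_apply_le _ _).trans (le_of_eq ?_)
  congr 1
  have hm : Measurable fun l : ℝ≥0 → Fin m → ℝ => solve A B 0 l 1 :=
    (measurable_solve A B 1).comp (measurable_const.prodMk measurable_id)
  exact ((hL.identDistrib_shift k).comp hm).eLpNorm_eq 2

theorem memLp_discountedSum_term (hL : IsLevyProcess μ L) (hL2 : IsCenteredNondegenerate μ L)
    (A : E →L[ℝ] E) (B : (Fin m → ℝ) →L[ℝ] E) (k : ℕ) :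
    MemLp (fun ω => flow A k (solve A B 0 (shift k (path L ω)) 1)) 2 μ := by
  have hm : Measurable fun l : ℝ≥0 → Fin m → ℝ => solve A B 0 l 1 :=
    (measurable_solve A B 1).comp (measurable_const.prodMk measurable_id)
  exact (flow A k).comp_memLp'
    (((hL.identDistrib_shift k).comp hm).memLp_iff.2 (memLp_solve hL hL2 A B 0 1))

/-- In the stable case the discounted sums converge in mean square. -/
theorem exists_limit_discountedSum (hL : IsLevyProcess μ L) (hL2 : IsCenteredNondegenerate μ L)
    (A : E →L[ℝ] E) (B : (Fin m → ℝ) →L[ℝ] E) {K lam : ℝ} (hlam : 0 < lam)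
    (hA : ∀ t : ℝ, 0 ≤ t → ‖flow A t‖ ≤ K * Real.exp (-lam * t)) :
    ∃ ξ : Ω → E, MemLp ξ 2 μ ∧ ∃ n : ℕ → ℕ, StrictMono n ∧ ∀ᵐ ω ∂μ,
      Tendsto (fun i => discountedSum A B (path L ω) (n i)) atTop (𝓝 (ξ ω)) := by
  have hf := memLp_discountedSum_term hL hL2 A B
  let g : ℕ → Lp E 2 μ := fun k => (hf k).toLp
  have hM := (memLp_solve hL hL2 A B 0 1).eLpNorm_ne_top
  set M := (eLpNorm (fun ω => solve A B 0 (path L ω) 1) 2 μ).toReal with hMdef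
  have hg : ∀ k, ‖g k‖ ≤ K * Real.exp (-lam) ^ k * M := by
    intro k
    have h1 := eLpNorm_discountedSum_term_le hL A B k
    rw [Lp.norm_toLp]
    refine (ENNReal.toReal_mono (ENNReal.mul_ne_top enorm_ne_top hM) h1).trans ?_
    rw [ENNReal.toReal_mul, toReal_enorm, ← Real.exp_nat_mul, mul_comm (k : ℝ)]
    exact mul_le_mul_of_nonneg_right (hA k k.cast_nonneg) ENNReal.toReal_nonneg
  have hr : Real.exp (-lam) < 1 := by rw [Real.exp_lt_one_iff]; linarith
  have hsum : Summable g := by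
    refine Summable.of_norm_bounded ?_ hg
    exact ((summable_geometric_of_lt_one (Real.exp_pos _).le hr).mul_left K).mul_right M
  have htend := tendstoInMeasure_of_tendsto_Lp hsum.hasSum.tendsto_sum_nat
  obtain ⟨n, hn, hae⟩ := htend.exists_seq_tendsto_ae
  refine ⟨_, Lp.memLp (∑' k, g k), n, hn, ?_⟩
  have hcoe : ∀ N : ℕ, ∀ᵐ ω ∂μ, (∑ k ∈ Finset.range N, g k : Lp E 2 μ) ω
      = discountedSum A B (path L ω) N := by
    intro N
    induction N with
    | zero =>
      filter_upwards [Lp.coeFn_zero E 2 μ] with ω hω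
      rw [Finset.sum_range_zero, hω]
      rfl
    | succ N ih =>
      rw [Finset.sum_range_succ]
      filter_upwards [ih, Lp.coeFn_add (∑ k ∈ Finset.range N, g k) (g N),
        (hf N).coeFn_toLp] with ω h1 h2 h3
      rw [h2, Pi.add_apply, h1, h3]
      simp [discountedSum, Finset.sum_range_succ]
  filter_upwards [hae, ae_all_iff.2 hcoe] with ω h1 h2
  simpa only [h2] using h1

theorem exists_isInvariantLaw (hL : IsLevyProcess μ L) (hL2 : IsCenteredNondegenerate μ L)
    (A : E →L[ℝ] E) (B : (Fin m → ℝ) →L[ℝ] E) {K lam : ℝ} (hlam : 0 < lam)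
    (hA : ∀ t : ℝ, 0 ≤ t → ‖flow A t‖ ≤ K * Real.exp (-lam * t)) :
    ∃ ν : Measure E, IsProbabilityMeasure ν ∧ MemLp id 2 ν ∧ IsInvariantLaw μ L A B ν := by
  obtain ⟨ξ, hξ, n, hn, hlim⟩ := exists_limit_discountedSum hL hL2 A B hlam hA
  have hξm : AEMeasurable ξ μ := hξ.aestronglyMeasurable.aemeasurable
  refine ⟨μ.map ξ, Measure.isProbabilityMeasure_map hξm, ?_, ?_⟩
  · rw [memLp_map_measure_iff aestronglyMeasurable_id hξm]
    exact hξ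
  have hchar : ∀ θ, Tendsto (fun i => solveChar μ L A B (n i) θ) atTop
      (𝓝 (charFunDual (μ.map ξ) θ)) := by
    intro θ
    have hm : ∀ N, Measurable fun ω => discountedSum A B (path L ω) N := fun N =>
      (measurable_discountedSum A B N).comp hL.measurable_path
    have hc : Continuous fun x : E => Complex.exp ((θ x : ℝ) * Complex.I) := by fun_prop
    have hint : ∀ N : ℕ, solveChar μ L A B N θ
        = ∫ ω, Complex.exp ((θ (discountedSum A B (path L ω) N) : ℝ) * Complex.I) ∂μ := fun N => by
      rw [← charFunDual_discountedSum hL A B, charFunDual_apply,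
        integral_map (hm N).aemeasurable hc.aestronglyMeasurable]
    rw [charFunDual_apply, integral_map hξm hc.aestronglyMeasurable]
    simp only [hint]
    refine tendsto_integral_of_dominated_convergence (fun _ => 1) ?_ (integrable_const _) ?_ ?_
    · exact fun i => hc.comp_aestronglyMeasurable (hm _).aestronglyMeasurable
    · refine fun i => ae_of_all _ fun ω => ?_
      rw [Complex.norm_exp_ofReal_mul_I]
    · filter_upwards [hlim] with ω hω
      exact (hc.tendsto _).comp hω
  have hflow : Tendsto (fun i => flow A (n i)) atTop (𝓝 0) := by
    rw [tendsto_zero_iff_norm_tendsto_zero]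
    have h1 : Tendsto (fun t : ℝ => K * Real.exp (-lam * t)) atTop (𝓝 (K * 0)) := by
      refine Tendsto.const_mul K (Real.tendsto_exp_atBot.comp ?_)
      exact tendsto_id.const_mul_atTop_of_neg (by linarith)
    rw [mul_zero] at h1
    refine squeeze_zero (fun _ => norm_nonneg _) (fun i => hA _ (n i).cast_nonneg) ?_
    exact h1.comp (tendsto_natCast_atTop_atTop.comp hn.tendsto_atTop)
  intro s θ
  -- both sides are limits of the characteristic function at the times `n i + s`
  have h1 : Tendsto (fun i => solveChar μ L A B (n i + s) θ) atTop
      (𝓝 (charFunDual (μ.map ξ) (θ ∘L flow A s) * solveChar μ L A B s θ)) := by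
    simp only [solveChar_add hL]
    exact (hchar _).mul_const _
  have h2 : Tendsto (fun i => solveChar μ L A B (n i + s) θ) atTop
      (𝓝 (1 * charFunDual (μ.map ξ) θ)) := by
    have h3 : ∀ i, solveChar μ L A B (n i + s) θ
        = solveChar μ L A B s (θ ∘L flow A (n i)) * solveChar μ L A B (n i) θ := by
      intro i
      rw [add_comm, solveChar_add hL, NNReal.coe_natCast]
    simp only [h3]
    exact (tendsto_solveChar_comp hL A B s θ hflow).mul (hchar θ)
  rw [tendsto_nhds_unique h1 h2, one_mul]

/-- The image of an invariant law under an intertwining map. -/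
theorem IsInvariantLaw.map (hL : IsLevyProcess μ L) {A : E →L[ℝ] E} {B : (Fin m → ℝ) →L[ℝ] E}
    {ν : Measure E} (hν : IsInvariantLaw μ L A B ν) (S : E →L[ℝ] E)
    (hS : ∀ x, S (A x) = A (S x)) (hSB : S ∘L B = B) : IsInvariantLaw μ L A B (ν.map S) := by
  intro s θ
  have hflow : ∀ x, flow A s (S x) = S (flow A s x) := by
    have hc : Commute S A := ContinuousLinearMap.ext hS
    have : Commute S (flow A s) := (hc.smul_right _).exp_right
    intro x
    exact (congrArg (fun T : E →L[ℝ] E => T x) this.eq).symm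
  have h1 : solveChar μ L A B s θ = solveChar μ L A B s (θ ∘L S) := by
    have hm := measurable_solve_path hL A B 0 s
    rw [solveChar, solveChar, ← charFunDual_map, Measure.map_map S.measurable hm]
    congr 1
    refine Measure.map_congr ?_
    filter_upwards [hL.isRegularPath] with ω hω
    have h := map_solve A B 0 hω (path_zero ω) S hS s
    rw [hSB, map_zero] at h
    exact h.symm
  have h2 : (θ ∘L flow A s) ∘L S = (θ ∘L S) ∘L flow A s := by
    ext x
    simp [hflow]
  rw [charFunDual_map, charFunDual_map, h1, h2]
  exact hν s (θ ∘L S)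

theorem map_prod_fst {α γ : Type*} [MeasurableSpace α] [MeasurableSpace γ] {π : Measure γ}
    [IsProbabilityMeasure π] {f : Ω → α} (hf : Measurable f) :
    (μ.prod π).map (fun z : Ω × γ => f z.1) = μ.map f := by
  have h := congrArg (Measure.map f) (measurePreserving_fst (μ := μ) (ν := π)).map_eq
  rwa [Measure.map_map hf measurable_fst] at h

theorem map_prod_snd {α γ : Type*} [MeasurableSpace α] [MeasurableSpace γ] {π : Measure γ}
    [IsProbabilityMeasure π] {f : γ → α} (hf : Measurable f) :
    (μ.prod π).map (fun z : Ω × γ => f z.2) = π.map f := by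
  have h := congrArg (Measure.map f) (measurePreserving_snd (μ := μ) (ν := π)).map_eq
  rwa [Measure.map_map hf measurable_snd] at h

theorem indepFun_prod_left {α β γ : Type*} [MeasurableSpace α] [MeasurableSpace β]
    [MeasurableSpace γ] {π : Measure γ} [IsProbabilityMeasure π] {f : Ω → α} {g : Ω → β}
    (hf : Measurable f) (hg : Measurable g) (h : IndepFun f g μ) :
    IndepFun (fun z : Ω × γ => (z.2, f z.1)) (fun z : Ω × γ => g z.1) (μ.prod π) := by
  rw [indepFun_iff_measure_inter_preimage_eq_mul] at h ⊢
  intro s t hs ht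
  have hfm : Measurable fun z : Ω × γ => (z.2, f z.1) :=
    measurable_snd.prodMk (hf.comp measurable_fst)
  have hgm : Measurable fun z : Ω × γ => g z.1 := hg.comp measurable_fst
  rw [Measure.prod_apply_symm ((hfm hs).inter (hgm ht)), Measure.prod_apply_symm (hfm hs)]
  have h1 : (μ.prod π) ((fun z : Ω × γ => g z.1) ⁻¹' t) = μ (g ⁻¹' t) :=
    measurePreserving_fst.measure_preimage (hg ht).nullMeasurableSet
  rw [h1, ← lintegral_mul_const]
  · refine lintegral_congr fun y => ?_
    exact h (Prod.mk y ⁻¹' s) t (measurable_prodMk_left hs) ht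
  · exact measurable_measure_prodMk_right (hfm hs)

/-- If the initial value of the solution has an invariant law and is independent of `L`, then
the solution together with the later increments of `L` does not depend in law on the time. -/
theorem IsInvariantLaw.identDistrib (hL : IsLevyProcess μ L) {A : E →L[ℝ] E}
    {B : (Fin m → ℝ) →L[ℝ] E} {ν : Measure E} (hν : IsInvariantLaw μ L A B ν)
    {γ : Type*} [MeasurableSpace γ] {π : Measure γ} [IsProbabilityMeasure π] {g : γ → E}
    (hg : Measurable g) (hgν : π.map g = ν) (s : ℝ≥0) :
    IdentDistrib (fun z : Ω × γ => (solve A B (g z.2) (path L z.1) s, shift s (path L z.1)))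
      (fun z => (g z.2, path L z.1)) (μ.prod π) (μ.prod π) := by
  have hνp : IsProbabilityMeasure ν := hgν ▸ Measure.isProbabilityMeasure_map hg.aemeasurable
  have hpm : Measurable fun z : Ω × γ => path L z.1 := hL.measurable_path.comp measurable_fst
  have hgm : Measurable fun z : Ω × γ => g z.2 := hg.comp measurable_snd
  have hVm : Measurable fun z : Ω × γ => solve A B (g z.2) (path L z.1) s :=
    (measurable_solve A B s).comp (hgm.prodMk hpm)
  have hgmap : (μ.prod π).map (fun z : Ω × γ => g z.2) = ν := by
    rw [map_prod_snd hg, hgν]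
  refine IdentDistrib.prodMk ⟨hVm.aemeasurable, hgm.aemeasurable, ?_⟩ ?_ ?_ ?_
  · have : IsProbabilityMeasure ((μ.prod π).map fun z : Ω × γ => solve A B (g z.2) (path L z.1) s) :=
      Measure.isProbabilityMeasure_map hVm.aemeasurable
    rw [hgmap]
    refine Measure.ext_of_charFunDual ?_
    ext θ
    rw [← hν s θ]
    have h0 : Measurable fun z : Ω × γ => solve A B 0 (path L z.1) s :=
      (measurable_solve_path hL A B 0 s).comp measurable_fst
    have h1 : Measurable fun z : Ω × γ => flow A s (g z.2) := (flow A s).measurable.comp hgm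
    have hind : IndepFun (fun z : Ω × γ => solve A B 0 (path L z.1) s)
        (fun z : Ω × γ => flow A s (g z.2)) (μ.prod π) :=
      indepFun_prod (measurable_solve_path hL A B 0 s) ((flow A s).measurable.comp hg)
    simp only [fun z : Ω × γ => solve_eq_flow_add A B (g z.2) (path L z.1) s]
    rw [hind.symm.charFunDual_map_fun_add_eq_mul h1.aemeasurable h0.aemeasurable, Pi.mul_apply]
    congr 1
    · rw [← hgmap, ← charFunDual_map, Measure.map_map (flow A s).measurable hgm]
      rfl
    · rw [solveChar, map_prod_fst (measurable_solve_path hL A B 0 s)]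
  · have h := hL.identDistrib_shift s
    refine ⟨((measurable_shift s).comp hpm).aemeasurable, hpm.aemeasurable, ?_⟩
    have h1 : (μ.prod π).map (fun z => shift s (path L z.1)) = μ.map fun ω => shift s (path L ω) :=
      map_prod_fst ((measurable_shift s).comp hL.measurable_path)
    rw [h1, h.map_eq, map_prod_fst hL.measurable_path]
  · have h := indepFun_prod_left (π := π) ((measurable_stopAt s).comp hL.measurable_path)
      ((measurable_shift s).comp hL.measurable_path) (hL.indepFun_stopAt_shift s)
    have h1 : Measurable fun p : γ × (ℝ≥0 → Fin m → ℝ) => solve A B (g p.1) p.2 s :=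
      (measurable_solve A B s).comp ((hg.comp measurable_fst).prodMk measurable_snd)
    have h2 := h.comp h1 measurable_id
    convert! h2 using 1
    ext z
    simp only [Function.comp, solve_stopAt]
  · exact (indepFun_prod hL.measurable_path hg).symm

end Invariant

/-! ### The companion matrix -/

theorem eq_zero_of_mulVec_eq_zero {κ ι : Type*} [Fintype κ] [Fintype ι] {M : Matrix κ ι ℝ}
    (h : M.rank = Fintype.card ι) {x : ι → ℝ} (hx : M *ᵥ x = 0) : x = 0 := by
  have h1 := LinearMap.finrank_range_add_finrank_ker M.mulVecLin
  rw [Module.finrank_fintype_fun_eq_card] at h1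
  have h2 : Module.finrank ℝ (LinearMap.ker M.mulVecLin) = 0 := by
    have : M.rank = Module.finrank ℝ (LinearMap.range M.mulVecLin) := rfl
    omega
  have h3 : LinearMap.ker M.mulVecLin = ⊥ := Submodule.finrank_eq_zero.1 h2
  have h4 : x ∈ LinearMap.ker M.mulVecLin := hx
  rwa [h3] at h4

theorem isUnit_det_of_rank {ι : Type*} [Fintype ι] [DecidableEq ι] {M : Matrix ι ι ℝ}
    (h : M.rank = Fintype.card ι) : IsUnit M.det := by
  rw [isUnit_iff_ne_zero]
  intro h0
  obtain ⟨v, hv, hv0⟩ := Matrix.exists_mulVec_eq_zero_iff.2 h0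
  exact hv (eq_zero_of_mulVec_eq_zero h hv0)

/-- If the columns of `β` and of `βp` are bases of orthogonal complements of each other, the kernel
of `βᵀ` is the range of `βp`. -/
theorem exists_eq_mulVec_of_transpose_mulVec_eq_zero {d r : ℕ} (hrd : r ≤ d)
    {β : Matrix (Fin d) (Fin r) ℝ} {βp : Matrix (Fin d) (Fin (d - r)) ℝ} (hβ : β.rank = r)
    (hβp : βp.rank = d - r) (hββp : βᵀ * βp = 0) {x : Fin d → ℝ} (hx : βᵀ *ᵥ x = 0) :
    ∃ u, x = βp *ᵥ u := by
  have h1 := LinearMap.finrank_range_add_finrank_ker βᵀ.mulVecLin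
  have h2 : Module.finrank ℝ (LinearMap.range βᵀ.mulVecLin) = r := by
    have : βᵀ.rank = r := (Matrix.rank_transpose β).trans hβ
    exact this
  rw [h2, Module.finrank_fintype_fun_eq_card, Fintype.card_fin] at h1
  have hle : LinearMap.range βp.mulVecLin ≤ LinearMap.ker βᵀ.mulVecLin := by
    rintro _ ⟨u, rfl⟩
    change βᵀ *ᵥ (βp *ᵥ u) = 0
    rw [Matrix.mulVec_mulVec, hββp, Matrix.zero_mulVec]
  have heq := Submodule.eq_of_le_of_finrank_eq hle (by
    have : Module.finrank ℝ (LinearMap.range βp.mulVecLin) = d - r := hβp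
    omega)
  have : x ∈ LinearMap.ker βᵀ.mulVecLin := hx
  rw [← heq] at this
  obtain ⟨u, hu⟩ := this
  exact ⟨u, hu.symm⟩

section Companion

variable {d p : ℕ} {P : ℕ → Matrix (Fin d) (Fin d) ℝ}

/-- The `k`-th block of a vector. -/
def blk {R : Type*} {p d : ℕ} (x : Fin p × Fin d → R) (k : Fin p) : Fin d → R := fun i => x (k, i)

theorem companion_map_mulVec {R : Type*} [CommRing R] (f : ℝ →+* R) (x : Fin p × Fin d → R)
    (k : Fin p) (i : Fin d) :
    ((companion p P).map f *ᵥ x) (k, i)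
      = if h : (k : ℕ) + 1 < p then x (⟨k + 1, h⟩, i)
        else -∑ j : Fin p, ((P (p - j)).map f *ᵥ blk x j) i := by
  have hk := k.2
  simp only [Matrix.mulVec, dotProduct, Matrix.map_apply, companion, Matrix.of_apply,
    Fintype.sum_prod_type]
  by_cases h : (k : ℕ) + 1 < p
  · have h1 : (k : ℕ) + 1 ≠ p := by omega
    simp only [h, h1, if_false, dif_pos]
    rw [Finset.sum_eq_single ⟨k + 1, h⟩]
    · simp [Matrix.one_apply, apply_ite f]
    · intro j _ hj
      have : (j : ℕ) ≠ k + 1 := fun h' => hj (Fin.ext h')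
      simp [this]
    · simp
  · have h1 : (k : ℕ) + 1 = p := by omega
    simp only [h1, if_true, lt_irrefl, dif_neg, not_false_eq_true, blk]
    simp [Finset.sum_neg_distrib]

theorem companion_mulVec (x : Fin p × Fin d → ℝ) (k : Fin p) (i : Fin d) :
    (companion p P *ᵥ x) (k, i)
      = if h : (k : ℕ) + 1 < p then x (⟨k + 1, h⟩, i)
        else -∑ j : Fin p, (P (p - j) *ᵥ blk x j) i := by
  have h := companion_map_mulVec (P := P) (RingHom.id ℝ) x k i
  simpa using h

/-- A complex eigenvector of the companion matrix has the form `(v, z v, …, zᵖ⁻¹ v)` with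
`P(z) v = 0`. -/
theorem det_arPoly_eq_zero_of_eigenvector (hp : 0 < p) (hP0 : P 0 = 1) {z : ℂ}
    {v : Fin p × Fin d → ℂ} (hv : v ≠ 0)
    (h : (companion p P).map (algebraMap ℝ ℂ) *ᵥ v = z • v) : (arPoly p P z).det = 0 := by
  have hrec : ∀ (k : ℕ) (hk : k < p) (i : Fin d), v (⟨k, hk⟩, i) = z ^ k * v (⟨0, hp⟩, i) := by
    intro k
    induction k with
    | zero => simp
    | succ k ih =>
      intro hk i
      have h1 := congrFun h (⟨k, by omega⟩, i)
      rw [companion_map_mulVec, dif_pos hk] at h1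
      rw [h1, Pi.smul_apply, ih (by omega), smul_eq_mul, pow_succ]
      ring
  refine Matrix.exists_mulVec_eq_zero_iff.1 ⟨blk v ⟨0, hp⟩, ?_, ?_⟩
  · intro h0
    apply hv
    ext ⟨k, i⟩
    rw [show k = ⟨(k : ℕ), k.2⟩ from rfl, hrec k k.2 i]
    have : v (⟨0, hp⟩, i) = 0 := congrFun h0 i
    simp [this]
  · ext i
    obtain ⟨p, rfl⟩ : ∃ n, p = n + 1 := ⟨p - 1, by omega⟩
    have h1 := congrFun h (⟨p, by omega⟩, i)
    rw [companion_map_mulVec, dif_neg (by simp)] at h1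
    have hblk : ∀ j : Fin (p + 1), blk v j = z ^ (j : ℕ) • blk v ⟨0, hp⟩ := by
      intro j
      ext i
      exact hrec j j.2 i
    have hsmul : ∀ j : Fin (p + 1), ((P (p + 1 - j)).map (algebraMap ℝ ℂ) *ᵥ blk v j) i
        = z ^ (j : ℕ) * ((P (p + 1 - j)).map (algebraMap ℝ ℂ) *ᵥ blk v ⟨0, hp⟩) i := by
      intro j
      rw [hblk j, Matrix.mulVec_smul]
      rfl
    rw [Finset.sum_congr rfl fun j _ => hsmul j, Pi.smul_apply, smul_eq_mul] at h1
    rw [hrec p (by omega) i] at h1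
    rw [arPoly, Matrix.sum_mulVec]
    simp only [Finset.sum_apply, Matrix.smul_mulVec, Pi.smul_apply, smul_eq_mul, Pi.zero_apply]
    rw [← Finset.sum_range_reflect, Finset.sum_range_succ]
    have h2 : ∀ j ∈ Finset.range (p + 1),
        z ^ (p + 1 - (p + 1 + 1 - 1 - j))
            * ((P (p + 1 + 1 - 1 - j)).map (algebraMap ℝ ℂ) *ᵥ blk v ⟨0, hp⟩) i
          = z ^ j * ((P (p + 1 - j)).map (algebraMap ℝ ℂ) *ᵥ blk v ⟨0, hp⟩) i := by
      intro j hj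
      have := Finset.mem_range.1 hj
      rw [show p + 1 + 1 - 1 - j = p + 1 - j by omega, show p + 1 - (p + 1 - j) = j by omega]
    rw [Finset.sum_congr rfl h2, Finset.sum_range
      (fun j => z ^ j * ((P (p + 1 - j)).map (algebraMap ℝ ℂ) *ᵥ blk v ⟨0, hp⟩) i)]
    have h3 := neg_eq_iff_eq_neg.1 h1
    rw [h3, show p + 1 + 1 - 1 - (p + 1) = 0 by omega, hP0]
    simp [blk]
    ring

variable {r m q : ℕ}

/-- The embedding `u ↦ (βp u, 0, …, 0)`, whose range is the kernel of the companion matrix. -/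
def kernelMatrix (p : ℕ) (βp : Matrix (Fin d) (Fin (d - r)) ℝ) :
    Matrix (Fin p × Fin d) (Fin (d - r)) ℝ :=
  Matrix.of fun k j => if (k.1 : ℕ) = 0 then βp k.2 j else 0

/-- The matrix `αpᵀ (Pₚ₋₁, …, P₁, P₀)`, whose rows annihilate the companion matrix from the left. -/
def cokernelMatrix (p : ℕ) (P : ℕ → Matrix (Fin d) (Fin d) ℝ)
    (αp : Matrix (Fin d) (Fin (d - r)) ℝ) : Matrix (Fin (d - r)) (Fin p × Fin d) ℝ :=
  Matrix.of fun i k => (αpᵀ * P (p - 1 - k.1)) i k.2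

theorem blk_kernelMatrix_mulVec (βp : Matrix (Fin d) (Fin (d - r)) ℝ) (u : Fin (d - r) → ℝ)
    (k : Fin p) : blk (kernelMatrix p βp *ᵥ u) k = if (k : ℕ) = 0 then βp *ᵥ u else 0 := by
  ext i
  by_cases h : (k : ℕ) = 0 <;> simp [blk, kernelMatrix, Matrix.mulVec, dotProduct, h]

theorem cokernelMatrix_mulVec (αp : Matrix (Fin d) (Fin (d - r)) ℝ) (x : Fin p × Fin d → ℝ) :
    cokernelMatrix p P αp *ᵥ x = αpᵀ *ᵥ ∑ k : Fin p, P (p - 1 - k) *ᵥ blk x k := by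
  rw [Matrix.mulVec_sum]
  ext i
  simp only [Matrix.mulVec_mulVec, Finset.sum_apply]
  simp only [cokernelMatrix, Matrix.mulVec, dotProduct, Matrix.of_apply, Fintype.sum_prod_type, blk]

theorem cokernelMatrix_mul_companion (hP0 : P 0 = 1) {αp : Matrix (Fin d) (Fin (d - r)) ℝ}
    (h : αpᵀ * P p = 0) : cokernelMatrix p P αp * companion p P = 0 := by
  rcases p with _ | p
  · ext i ⟨k, _⟩
    exact k.elim0
  refine Matrix.ext_of_mulVec_single fun j => ?_
  generalize (Pi.single j 1 : Fin (p + 1) × Fin d → ℝ) = x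
  rw [← Matrix.mulVec_mulVec, cokernelMatrix_mulVec, Fin.sum_univ_castSucc, Matrix.zero_mulVec]
  have h1 : ∀ k : Fin p, blk (companion (p + 1) P *ᵥ x) k.castSucc = blk x k.succ := by
    intro k
    ext i
    have hk := k.2
    rw [blk, companion_mulVec, dif_pos (by simp)]
    rfl
  have h2 : blk (companion (p + 1) P *ᵥ x) (Fin.last p)
      = -∑ j : Fin (p + 1), P (p + 1 - j) *ᵥ blk x j := by
    ext i
    rw [blk, companion_mulVec, dif_neg (by simp)]
    simp
  rw [h2, Fin.sum_univ_succ]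
  simp only [h1, Fin.val_castSucc, Fin.val_last, Fin.val_zero, Fin.val_succ]
  simp only [Nat.add_sub_add_right, Nat.add_sub_cancel, Nat.sub_self, hP0, Matrix.one_mulVec,
    Nat.sub_zero]
  have h4 : ∀ a b : Fin d → ℝ, a + -(b + a) = -b := fun a b => by abel
  rw [h4, Matrix.mulVec_neg, Matrix.mulVec_mulVec, h, Matrix.zero_mulVec, neg_zero]

theorem companion_mul_kernelMatrix {βp : Matrix (Fin d) (Fin (d - r)) ℝ} (h : P p * βp = 0) :
    companion p P * kernelMatrix p βp = 0 := by
  refine Matrix.ext_of_mulVec_single fun j => ?_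
  generalize (Pi.single j 1 : Fin (d - r) → ℝ) = u
  rw [← Matrix.mulVec_mulVec, Matrix.zero_mulVec]
  ext ⟨k, i⟩
  rw [companion_mulVec, Pi.zero_apply]
  split_ifs with hk
  · have := congrFun (blk_kernelMatrix_mulVec (p := p) βp u ⟨k + 1, hk⟩) i
    simpa [blk] using this
  · rw [neg_eq_zero]
    refine Finset.sum_eq_zero fun j _ => ?_
    rw [blk_kernelMatrix_mulVec]
    by_cases hj : (j : ℕ) = 0
    · simp [hj, Matrix.mulVec_mulVec, h]
    · simp [hj]

theorem cokernelMatrix_mul_kernelMatrix (hp : 0 < p) (αp βp : Matrix (Fin d) (Fin (d - r)) ℝ) :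
    cokernelMatrix p P αp * kernelMatrix p βp = αpᵀ * P (p - 1) * βp := by
  refine Matrix.ext_of_mulVec_single fun j => ?_
  generalize (Pi.single j 1 : Fin (d - r) → ℝ) = u
  rw [← Matrix.mulVec_mulVec, cokernelMatrix_mulVec, Finset.sum_eq_single ⟨0, hp⟩]
  · simp [blk_kernelMatrix_mulVec, Matrix.mulVec_mulVec, Matrix.mul_assoc]
  · intro k _ hk
    have : (k : ℕ) ≠ 0 := fun h => hk (Fin.ext h)
    simp [blk_kernelMatrix_mulVec, this]
  · simp

theorem inputBlock_last {Q : ℕ → Matrix (Fin d) (Fin m) ℝ} (p : ℕ) :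
    inputBlock (p + 1) q P Q (p + 1)
      = Q q - ∑ i : Fin p, P (i + 1) * inputBlock (p + 1) q P Q (p - i) := by
  rw [inputBlock, if_neg (by omega)]
  congr 2
  omega

theorem cokernelMatrix_mul_inputMatrix (hp : 0 < p) (hP0 : P 0 = 1)
    (Q : ℕ → Matrix (Fin d) (Fin m) ℝ) (αp : Matrix (Fin d) (Fin (d - r)) ℝ) :
    cokernelMatrix p P αp * inputMatrix p q P Q = αpᵀ * Q q := by
  obtain ⟨p, rfl⟩ : ∃ n, p = n + 1 := ⟨p - 1, by omega⟩
  refine Matrix.ext_of_mulVec_single fun j => ?_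
  generalize (Pi.single j 1 : Fin m → ℝ) = x
  have hblk : ∀ k : Fin (p + 1), blk (inputMatrix (p + 1) q P Q *ᵥ x) k
      = inputBlock (p + 1) q P Q (k + 1) *ᵥ x := fun k => rfl
  rw [← Matrix.mulVec_mulVec, cokernelMatrix_mulVec, ← Matrix.mulVec_mulVec]
  congr 1
  simp only [hblk]
  rw [Fin.sum_univ_castSucc]
  simp only [Fin.val_castSucc, Fin.val_last, Nat.add_sub_cancel, Nat.sub_self, hP0,
    Matrix.one_mulVec, inputBlock_last, Matrix.sub_mulVec, Matrix.sum_mulVec]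
  have h1 : ∑ k : Fin p, P (p - k) *ᵥ inputBlock (p + 1) q P Q (k + 1) *ᵥ x
      = ∑ k : Fin p, (P (k + 1) * inputBlock (p + 1) q P Q (p - k)) *ᵥ x := by
    rw [← Equiv.sum_comp Fin.revPerm]
    refine Finset.sum_congr rfl fun k _ => ?_
    have hk := k.2
    rw [Fin.revPerm_apply, Fin.val_rev, Matrix.mulVec_mulVec,
      show p - (p - (k + 1)) = k + 1 by omega, show p - ((k : ℕ) + 1) + 1 = p - k by omega]
  rw [h1]
  abel

theorem outputMatrix_mulVec (hp : 0 < p) (x : Fin p × Fin d → ℝ) :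
    outputMatrix p d *ᵥ x = blk x ⟨0, hp⟩ := by
  ext i
  simp only [outputMatrix, Matrix.mulVec, dotProduct, Matrix.of_apply, Fintype.sum_prod_type, blk]
  rw [Finset.sum_eq_single ⟨0, hp⟩]
  · simp [Matrix.one_apply]
  · intro k _ hk
    have : (k : ℕ) ≠ 0 := fun h => hk (Fin.ext h)
    simp [this]
  · simp

theorem outputMatrix_mul_kernelMatrix (hp : 0 < p) (βp : Matrix (Fin d) (Fin (d - r)) ℝ) :
    outputMatrix p d * kernelMatrix p βp = βp := by
  refine Matrix.ext_of_mulVec_single fun j => ?_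
  generalize (Pi.single j 1 : Fin (d - r) → ℝ) = x
  rw [← Matrix.mulVec_mulVec, outputMatrix_mulVec hp, blk_kernelMatrix_mulVec]
  simp

theorem outputMatrix_mul_inputMatrix (h : q + 1 < p) (Q : ℕ → Matrix (Fin d) (Fin m) ℝ) :
    outputMatrix p d * inputMatrix p q P Q = 0 := by
  refine Matrix.ext_of_mulVec_single fun j => ?_
  generalize (Pi.single j 1 : Fin m → ℝ) = x
  rw [← Matrix.mulVec_mulVec, outputMatrix_mulVec (by omega)]
  have h1 : blk (inputMatrix p q P Q *ᵥ x) ⟨0, by omega⟩ = inputBlock p q P Q (0 + 1) *ᵥ x := rfl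
  rw [h1, inputBlock, if_pos (by omega)]

end Companion

/-! ### Splitting off a semisimple eigenvalue zero -/

section Splitting

variable {ι κ : Type*} [Fintype ι] [DecidableEq ι] [Fintype κ] [DecidableEq κ]

/-- The projection onto the range of `N` along the kernel of `W`. -/
noncomputable def kerProj (N : Matrix ι κ ℝ) (W : Matrix κ ι ℝ) : Matrix ι ι ℝ :=
  N * (W * N)⁻¹ * W

/-- The columns of `N` form a basis of the kernel of `A`, the rows of `W` annihilate `A` from the
left, and the pairing `W N` is invertible, so that the eigenvalue zero of `A` is semisimple. -/
structure IsKernelSplitting (A : Matrix ι ι ℝ) (N : Matrix ι κ ℝ) (W : Matrix κ ι ℝ) : Prop where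
  mul_right : A * N = 0
  mul_left : W * A = 0
  isUnit : IsUnit (W * N).det
  exists_of_ker : ∀ x, A *ᵥ x = 0 → ∃ u, x = N *ᵥ u

variable {A : Matrix ι ι ℝ} {N : Matrix ι κ ℝ} {W : Matrix κ ι ℝ}

namespace IsKernelSplitting

theorem mul_kerProj (h : IsKernelSplitting A N W) : A * kerProj N W = 0 := by
  rw [kerProj, Matrix.mul_assoc, ← Matrix.mul_assoc, h.mul_right, Matrix.zero_mul]

theorem kerProj_mul (h : IsKernelSplitting A N W) : kerProj N W * A = 0 := by
  rw [kerProj, Matrix.mul_assoc, h.mul_left, Matrix.mul_zero]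

theorem kerProj_mul_N (h : IsKernelSplitting A N W) : kerProj N W * N = N := by
  rw [kerProj, Matrix.mul_assoc, Matrix.mul_assoc, Matrix.nonsing_inv_mul _ h.isUnit,
    Matrix.mul_one]

theorem kerProj_mul_kerProj (h : IsKernelSplitting A N W) :
    kerProj N W * kerProj N W = kerProj N W := by
  nth_rewrite 2 [kerProj]
  rw [← Matrix.mul_assoc, ← Matrix.mul_assoc, h.kerProj_mul_N]
  rfl

theorem eq_zero_of_mulVec_N (h : IsKernelSplitting A N W) {u : κ → ℝ} (hu : W *ᵥ (N *ᵥ u) = 0) :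
    u = 0 := by
  rw [Matrix.mulVec_mulVec] at hu
  have h1 := congrArg (fun v => (W * N)⁻¹ *ᵥ v) hu
  simpa [Matrix.mulVec_mulVec, Matrix.nonsing_inv_mul _ h.isUnit] using h1

theorem ker_sq (h : IsKernelSplitting A N W) {x : ι → ℝ} (hx : A *ᵥ (A *ᵥ x) = 0) :
    A *ᵥ x = 0 := by
  obtain ⟨u, hu⟩ := h.exists_of_ker _ hx
  have h1 : W *ᵥ (N *ᵥ u) = 0 := by
    rw [← hu, Matrix.mulVec_mulVec, h.mul_left, Matrix.zero_mulVec]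
  rw [hu, h.eq_zero_of_mulVec_N h1, Matrix.mulVec_zero]

/-- Subtracting the projection moves the eigenvalue zero to `-1`, so `A - kerProj N W` is Hurwitz if
all eigenvalues of `A` have negative real part or are zero. -/
theorem re_neg_of_eigenvector (h : IsKernelSplitting A N W)
    (hspec : ∀ (z : ℂ) (v : ι → ℂ), v ≠ 0 → A.map (algebraMap ℝ ℂ) *ᵥ v = z • v →
      z.re < 0 ∨ z = 0)
    (z : ℂ) (v : ι → ℂ) (hv : v ≠ 0)
    (hz : (A - kerProj N W).map (algebraMap ℝ ℂ) *ᵥ v = z • v) : z.re < 0 := by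
  set Q := (kerProj N W).map (algebraMap ℝ ℂ) with hQ
  have hmapsub : (A - kerProj N W).map (algebraMap ℝ ℂ) = A.map (algebraMap ℝ ℂ) - Q :=
    Matrix.map_sub _ (map_sub _) _ _
  have hQA : Q * A.map (algebraMap ℝ ℂ) = 0 := by
    rw [hQ, ← Matrix.map_mul, h.kerProj_mul, Matrix.map_zero _ (map_zero _)]
  have hQQ : Q * Q = Q := by rw [hQ, ← Matrix.map_mul, h.kerProj_mul_kerProj]
  have h1 : -(Q *ᵥ v) = z • (Q *ᵥ v) := by
    rw [← Matrix.mulVec_smul, ← hz, hmapsub, Matrix.sub_mulVec, Matrix.mulVec_sub,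
      Matrix.mulVec_mulVec, Matrix.mulVec_mulVec, hQA, hQQ, Matrix.zero_mulVec, zero_sub]
  by_cases hQv : Q *ᵥ v = 0
  · have hAv : A.map (algebraMap ℝ ℂ) *ᵥ v = z • v := by
      rw [← hz, hmapsub, Matrix.sub_mulVec, hQv, sub_zero]
    rcases hspec z v hv hAv with h2 | rfl
    · exact h2
    · exfalso
      have h3 : ((A - kerProj N W).map (algebraMap ℝ ℂ)).det = 0 :=
        Matrix.exists_mulVec_eq_zero_iff.1 ⟨v, hv, by rw [hz, zero_smul]⟩
      have h4 : (A - kerProj N W).det = 0 := by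
        have h5 := (RingHom.map_det (algebraMap ℝ ℂ) (A - kerProj N W)).trans h3
        exact (algebraMap ℝ ℂ).injective (by simpa using h5)
      obtain ⟨x, hx, hx0⟩ := Matrix.exists_mulVec_eq_zero_iff.2 h4
      have h6 : kerProj N W *ᵥ x = 0 := by
        have h7 := congrArg (fun y => kerProj N W *ᵥ y) hx0
        simpa [Matrix.mulVec_mulVec, Matrix.mul_sub, h.kerProj_mul, h.kerProj_mul_kerProj,
          Matrix.neg_mulVec] using h7
      have h8 : A *ᵥ x = 0 := by
        rwa [Matrix.sub_mulVec, h6, sub_zero] at hx0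
      obtain ⟨u, rfl⟩ := h.exists_of_ker x h8
      rw [Matrix.mulVec_mulVec, h.kerProj_mul_N] at h6
      exact hx h6
  · have h2 : (z + 1) • (Q *ᵥ v) = 0 := by
      rw [add_smul, ← h1, one_smul, neg_add_cancel]
    have h3 : z = -1 := eq_neg_of_add_eq_zero_left ((smul_eq_zero.1 h2).resolve_right hQv)
    simp [h3]

theorem hasCointegratedSpectrum (h : IsKernelSplitting A N W)
    (hspec : ∀ (z : ℂ) (v : ι → ℂ), v ≠ 0 → A.map (algebraMap ℝ ℂ) *ᵥ v = z • v →
      z.re < 0 ∨ z = 0) : HasCointegratedSpectrum A (Fintype.card κ) := by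
  have hker : LinearMap.ker A.mulVecLin = LinearMap.range N.mulVecLin := by
    ext x
    constructor
    · intro hx
      obtain ⟨u, rfl⟩ := h.exists_of_ker x hx
      exact ⟨u, rfl⟩
    · rintro ⟨u, rfl⟩
      change A *ᵥ (N *ᵥ u) = 0
      rw [Matrix.mulVec_mulVec, h.mul_right, Matrix.zero_mulVec]
  have hgeo : Module.finrank ℝ (LinearMap.ker A.mulVecLin) = Fintype.card κ := by
    rw [hker, LinearMap.finrank_range_of_inj, Module.finrank_fintype_fun_eq_card]
    refine (injective_iff_map_eq_zero _).2 fun u hu => ?_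
    have hu' : N *ᵥ u = 0 := hu
    exact h.eq_zero_of_mulVec_N (by rw [hu', Matrix.mulVec_zero])
  refine ⟨fun z hz => ?_, ?_, hgeo⟩
  · have h1 : ((algebraMap ℂ (Matrix ι ι ℂ) z) - A.map (algebraMap ℝ ℂ)).det = 0 := by
      by_contra hne
      exact hz ((Matrix.isUnit_iff_isUnit_det _).2 (isUnit_iff_ne_zero.2 hne))
    obtain ⟨v, hv, hv0⟩ := Matrix.exists_mulVec_eq_zero_iff.2 h1
    refine hspec z v hv ?_
    rw [Matrix.sub_mulVec, sub_eq_zero] at hv0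
    rw [← hv0]
    simp [Algebra.algebraMap_eq_smul_one, Matrix.smul_mulVec]
  · rw [← Matrix.charpoly_mulVecLin, ← LinearMap.finrank_maxGenEigenspace_eq, ← hgeo]
    have : Module.End.maxGenEigenspace A.mulVecLin 0 = LinearMap.ker A.mulVecLin := by
      ext x
      rw [Module.End.mem_maxGenEigenspace]
      simp only [zero_smul, sub_zero]
      constructor
      · rintro ⟨k, hk⟩
        induction k with
        | zero => simp_all
        | succ k ih =>
          rcases k with _ | k
          · simpa using hk
          · refine ih ?_
            rw [pow_succ', Module.End.mul_apply, pow_succ', Module.End.mul_apply] at hk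
            rw [pow_succ', Module.End.mul_apply]
            exact h.ker_sq hk
      · intro hx
        exact ⟨1, by simpa using hx⟩
    rw [this]

end IsKernelSplitting

end Splitting

/-! ### Minimality -/

section Minimal

variable {ι : Type*} [Fintype ι] [DecidableEq ι]

theorem isUnit_det_scalar_sub {ι : Type*} [Fintype ι] [DecidableEq ι] (A : Matrix ι ι ℝ) :
    IsUnit (Matrix.scalar ι (RatFunc.X : RatFunc ℝ) - A.map RatFunc.C).det := by
  have h1 : Matrix.scalar ι (RatFunc.X : RatFunc ℝ) - A.map RatFunc.C
      = (algebraMap (Polynomial ℝ) (RatFunc ℝ)).mapMatrix A.charmatrix := by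
    ext i j
    by_cases h : i = j
    · subst h
      simp [Matrix.charmatrix_apply_eq]
    · simp [h]
  rw [h1, ← RingHom.map_det, isUnit_iff_ne_zero]
  intro h0
  have h2 : A.charpoly = 0 := by
    refine RatFunc.algebraMap_injective ℝ ?_
    rw [map_zero]
    exact h0
  exact A.charpoly_monic.ne_zero h2

/-- Intertwined state-space models have the same transfer function. -/
theorem transferFunction_eq_of_intertwining {κ : Type*} [Fintype κ] [DecidableEq κ] {d m : ℕ}
    {A : Matrix ι ι ℝ} {B : Matrix ι (Fin m) ℝ} (C : Matrix (Fin d) ι ℝ) {A' : Matrix κ κ ℝ}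
    {B' : Matrix κ (Fin m) ℝ} {T : Matrix ι κ ℝ} (hA : A * T = T * A') (hB : B = T * B') :
    transferFunction A' B' (C * T) = transferFunction A B C := by
  unfold transferFunction
  set X := Matrix.scalar ι (RatFunc.X : RatFunc ℝ) - A.map RatFunc.C with hX
  set X' := Matrix.scalar κ (RatFunc.X : RatFunc ℝ) - A'.map RatFunc.C with hX'
  have h1 : X * T.map RatFunc.C = T.map RatFunc.C * X' := by
    rw [hX, hX', Matrix.sub_mul, Matrix.mul_sub, ← Matrix.map_mul, ← Matrix.map_mul, hA]
    congr 1
    ext i j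
    simp [mul_comm]
  have h2 : T.map RatFunc.C * X'⁻¹ = X⁻¹ * T.map RatFunc.C := by
    calc T.map RatFunc.C * X'⁻¹ = X⁻¹ * (X * T.map RatFunc.C) * X'⁻¹ := by
          rw [← Matrix.mul_assoc X⁻¹, Matrix.nonsing_inv_mul _ (isUnit_det_scalar_sub A),
            Matrix.one_mul]
      _ = X⁻¹ * T.map RatFunc.C := by
          rw [h1, Matrix.mul_assoc, Matrix.mul_assoc,
            Matrix.mul_nonsing_inv _ (isUnit_det_scalar_sub A'), Matrix.mul_one]
  rw [hB, Matrix.map_mul, Matrix.map_mul, Matrix.mul_assoc (C.map _), h2]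
  simp only [Matrix.mul_assoc]

/-- A state-space model with a left null vector orthogonal to the input is not minimal: the state
space can be restricted to the orthogonal complement of that vector. -/
theorem not_isMinimal_of_vecMul_eq_zero {d m : ℕ} {A : Matrix ι ι ℝ} {B : Matrix ι (Fin m) ℝ}
    (C : Matrix (Fin d) ι ℝ) {w : ι → ℝ} (hw : w ≠ 0) (hA : w ᵥ* A = 0) (hB : w ᵥ* B = 0) :
    ¬ IsMinimal A B C := by
  let φ : (ι → ℝ) →ₗ[ℝ] ℝ :=
    { toFun := fun x => w ⬝ᵥ x
      map_add' := dotProduct_add w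
      map_smul' := fun c x => dotProduct_smul c w x }
  let V := LinearMap.ker φ
  let n := Module.finrank ℝ V
  have hlt : n < Fintype.card ι := by
    have h1 : V < ⊤ := by
      refine lt_top_iff_ne_top.2 fun h => hw ?_
      have : w ∈ V := h ▸ Submodule.mem_top
      exact dotProduct_self_eq_zero.1 this
    have h2 := Submodule.finrank_lt h1.ne
    rwa [Module.finrank_fintype_fun_eq_card] at h2
  let e : V ≃ₗ[ℝ] (Fin n → ℝ) := (Module.finBasis ℝ V).equivFun
  let τ : (Fin n → ℝ) →ₗ[ℝ] (ι → ℝ) := V.subtype ∘ₗ e.symm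
  have hτ : LinearMap.ker τ = ⊥ := by
    rw [LinearMap.ker_eq_bot]
    exact V.injective_subtype.comp e.symm.injective
  obtain ⟨ρ, hρ⟩ := LinearMap.exists_leftInverse_of_injective τ hτ
  let T := LinearMap.toMatrix' τ
  let R := LinearMap.toMatrix' ρ
  have hTR : ∀ {κ : Type} [Fintype κ] [DecidableEq κ] (M : Matrix ι κ ℝ), w ᵥ* M = 0 →
      T * (R * M) = M := by
    intro κ _ _ M hM
    refine Matrix.ext_of_mulVec_single fun j => ?_
    rw [← Matrix.mulVec_mulVec, ← Matrix.mulVec_mulVec]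
    have hmem : M *ᵥ Pi.single j 1 ∈ V := by
      change w ⬝ᵥ (M *ᵥ Pi.single j 1) = 0
      rw [Matrix.dotProduct_mulVec, hM, zero_dotProduct]
    have h1 : M *ᵥ Pi.single j 1 = τ (e ⟨_, hmem⟩) := by simp [τ]
    rw [h1]
    simp only [T, R, LinearMap.toMatrix'_mulVec]
    congr 1
    exact congrArg (fun f => f (e ⟨_, hmem⟩)) hρ
  intro hmin
  refine absurd (hmin n (R * (A * T)) (R * B) (C * T) ?_) (not_le.2 hlt)
  refine transferFunction_eq_of_intertwining C ?_ ?_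
  · rw [hTR (A * T)]
    rw [← Matrix.vecMul_vecMul, hA, Matrix.zero_vecMul]
  · rw [hTR B hB]

end Minimal

/-! ### Random walks with stationary perturbations -/

section RandomWalk

variable {Ω : Type*} [MeasurableSpace Ω] {m : ℕ} {μ : Measure Ω} [IsProbabilityMeasure μ]

/-- If a centred random walk differs from a sequence with constant marginal law by errors which are
small compared to `√n`, the central limit theorem shows that its steps have variance zero. -/
theorem variance_eq_zero_of_identDistrib {X y a w : ℕ → Ω → ℝ} (hX : MemLp (X 0) 2 μ)
    (h0 : ∫ ω, X 0 ω ∂μ = 0) (hindep : iIndepFun X μ)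
    (hident : ∀ i, IdentDistrib (X i) (X 0) μ μ) (hy : ∀ n, IdentDistrib (y n) (y 0) μ μ)
    (ham : ∀ n, AEMeasurable (a n) μ)
    (ha : ∀ᵐ ω ∂μ, Tendsto (fun n : ℕ => (√n)⁻¹ * a n ω) atTop (𝓝 0))
    (hwm : ∀ n, AEMeasurable (w n) μ) {M : ℝ≥0∞} (hM : M ≠ ⊤) (hw : ∀ n, eLpNorm (w n) 2 μ ≤ M)
    (h : ∀ n, ∀ᵐ ω ∂μ, y n ω = ∑ k ∈ Finset.range n, X k ω + a n ω + w n ω) :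
    Var[X 0; μ] = 0 := by
  have hsqrt : Tendsto (fun n : ℕ => (√(n : ℝ))⁻¹) atTop (𝓝 0) :=
    tendsto_inv_atTop_zero.comp (Real.tendsto_sqrt_atTop.comp tendsto_natCast_atTop_atTop)
  have hclt := tendstoInDistribution_inv_sqrt_mul_sum_sub (P := μ)
    (P' := gaussianReal 0 Var[X 0; μ].toNNReal) (Y := id) (X := X) ⟨aemeasurable_id, by simp⟩ hX hindep hident
  simp only [h0, mul_zero, sub_zero] at hclt
  have ha' : TendstoInMeasure μ (fun (n : ℕ) ω => (√n)⁻¹ * a n ω) atTop fun _ => 0 :=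
    tendstoInMeasure_of_tendsto_ae (fun n => ((ham n).const_mul _).aestronglyMeasurable) ha
  have hw' : TendstoInMeasure μ (fun (n : ℕ) ω => (√n)⁻¹ * w n ω) atTop fun _ => 0 := by
    refine tendstoInMeasure_of_tendsto_eLpNorm two_ne_zero
      (fun n => ((hwm n).const_mul _).aestronglyMeasurable) aestronglyMeasurable_const ?_
    have h1 : Tendsto (fun n : ℕ => ‖(√(n : ℝ))⁻¹‖ₑ * M) atTop (𝓝 0) := by
      have := ENNReal.Tendsto.mul_const (b := M) hsqrt.enorm (Or.inr hM)
      simpa using this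
    refine tendsto_of_tendsto_of_tendsto_of_le_of_le tendsto_const_nhds h1 (fun _ => zero_le) ?_
    intro n
    have h2 : ((fun ω => (√(n : ℝ))⁻¹ * w n ω) - fun _ => 0) = (√(n : ℝ))⁻¹ • w n := by
      ext ω
      simp
    simp only [h2, eLpNorm_const_smul]
    gcongr
    exact hw n
  have h1 := (hclt.add_of_tendstoInMeasure_const ha'
    (fun n => (ham n).const_mul _)).add_of_tendstoInMeasure_const hw' (fun n => (hwm n).const_mul _)
  have h2 : TendstoInDistribution (fun (n : ℕ) ω => (√n)⁻¹ * y n ω) atTop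
      (fun x : ℝ => id x + 0 + 0) (fun _ => μ) (gaussianReal 0 Var[X 0; μ].toNNReal) := by
    refine h1.congr (fun n => ?_) (ae_eq_refl _)
    filter_upwards [h n] with ω hω
    simp only [Pi.add_apply, hω]
    ring
  have h3 : TendstoInDistribution (fun (n : ℕ) ω => (√n)⁻¹ * y 0 ω) atTop
      (fun _ : Ω => (0 : ℝ)) (fun _ => μ) μ := by
    refine tendstoInDistribution_of_ae_tendsto
      (fun n => (hy 0).aemeasurable_fst.const_mul _) aemeasurable_const (ae_of_all _ fun ω => ?_)
    simpa using hsqrt.mul_const (y 0 ω)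
  have h4 : TendstoInDistribution (fun (n : ℕ) ω => (√n)⁻¹ * y n ω) atTop
      (fun _ : Ω => (0 : ℝ)) (fun _ => μ) μ := by
    refine ⟨h2.forall_aemeasurable, aemeasurable_const, ?_⟩
    refine h3.tendsto.congr fun n => ?_
    exact Subtype.ext ((hy n).comp (measurable_const_mul (√(n : ℝ))⁻¹)).map_eq.symm
  have h5 := tendstoInDistribution_unique _ h2 h4
  have h6 : gaussianReal 0 Var[X 0; μ].toNNReal = Measure.dirac 0 := by
    simpa [Measure.map_const] using h5
  have h7 := congrArg (fun ν : Measure ℝ => Var[id; ν]) h6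
  simp only [variance_id_gaussianReal, variance_dirac] at h7
  rw [Real.coe_toNNReal _ (variance_nonneg _ _)] at h7
  exact h7

end RandomWalk

section Nonstationary

variable {Ω : Type*} [MeasurableSpace Ω] {m : ℕ} {μ : Measure Ω} [IsProbabilityMeasure μ]
  {L : ℝ≥0 → Ω → (Fin m → ℝ)}

theorem IsCenteredNondegenerate.memLp_dotProduct (hL2 : IsCenteredNondegenerate μ L)
    (u : Fin m → ℝ) : MemLp (fun ω => u ⬝ᵥ L 1 ω) 2 μ :=
  memLp_finsetSum _ fun i _ => (memLp_pi_iff.1 hL2.memLp i).const_mul (u i)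

theorem IsCenteredNondegenerate.integral_dotProduct (hL2 : IsCenteredNondegenerate μ L)
    (u : Fin m → ℝ) : ∫ ω, u ⬝ᵥ L 1 ω ∂μ = 0 := by
  have hi : ∀ i, MemLp (fun ω => L 1 ω i) 2 μ := fun i => memLp_pi_iff.1 hL2.memLp i
  have h1 : ∀ i, ∫ ω, L 1 ω i ∂μ = 0 := fun i => by
    have := eval_integral (μ := μ) (f := L 1) (fun i => (hi i).integrable (by norm_num)) i
    rw [← this, hL2.mean]
    rfl
  simp only [dotProduct]
  rw [integral_finsetSum _ fun i _ => ((hi i).integrable (by norm_num)).const_mul _]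
  simp [integral_const_mul, h1]

/-- The increments of a Lévy process with non-singular covariance have no degenerate direction. -/
theorem eq_zero_of_variance_eq_zero (hL2 : IsCenteredNondegenerate μ L) (u : Fin m → ℝ)
    (h : Var[fun ω => u ⬝ᵥ L 1 ω; μ] = 0) : u = 0 := by
  by_contra hu
  have hi : ∀ i, MemLp (fun ω => L 1 ω i) 2 μ := fun i => memLp_pi_iff.1 hL2.memLp i
  have hz := ae_eq_integral_of_variance_eq_zero (hL2.memLp_dotProduct u) h
  rw [hL2.integral_dotProduct] at hz
  refine hL2.cov (Matrix.exists_mulVec_eq_zero_iff.1 ⟨u, hu, ?_⟩)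
  ext i
  simp only [Matrix.mulVec, dotProduct, Matrix.of_apply, Pi.zero_apply]
  calc ∑ j, (∫ ω, L 1 ω i * L 1 ω j ∂μ) * u j
      = ∫ ω, ∑ j, L 1 ω i * L 1 ω j * u j ∂μ := by
        rw [integral_finsetSum]
        · simp [integral_mul_const]
        · exact fun j _ => ((hi i).integrable_mul (hi j)).mul_const _
    _ = ∫ ω, 0 ∂μ := by
        refine integral_congr_ae ?_
        filter_upwards [hz] with ω hω
        have h2 : ∑ j, L 1 ω i * L 1 ω j * u j = L 1 ω i * (u ⬝ᵥ L 1 ω) := by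
          rw [dotProduct, Finset.mul_sum]
          exact Finset.sum_congr rfl fun j _ => by ring
        rw [h2, hω, mul_zero]
    _ = 0 := by simp

variable {E : Type*} [NormedAddCommGroup E] [NormedSpace ℝ E] [CompleteSpace E]
  [MeasurableSpace E] [BorelSpace E] [SecondCountableTopology E]

/-- In the stable case the solution started from zero is bounded in mean square. -/
theorem exists_eLpNorm_solve_natCast_le (hL : IsLevyProcess μ L) (hL2 : IsCenteredNondegenerate μ L)
    (A : E →L[ℝ] E) (B : (Fin m → ℝ) →L[ℝ] E) {K lam : ℝ} (hlam : 0 < lam)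
    (hA : ∀ t : ℝ, 0 ≤ t → ‖flow A t‖ ≤ K * Real.exp (-lam * t)) :
    ∃ M : ℝ≥0∞, M ≠ ⊤ ∧ ∀ n : ℕ, eLpNorm (fun ω => solve A B 0 (path L ω) n) 2 μ ≤ M := by
  have hsum : Summable fun k : ℕ => K * Real.exp (-lam) ^ k :=
    (summable_geometric_of_lt_one (Real.exp_nonneg _) (Real.exp_lt_one_iff.2 (by linarith))).mul_left K
  refine ⟨(∑' k : ℕ, ENNReal.ofReal (K * Real.exp (-lam) ^ k))
    * eLpNorm (fun ω => solve A B 0 (path L ω) 1) 2 μ,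
    ENNReal.mul_ne_top hsum.tsum_ofReal_ne_top (memLp_solve hL hL2 A B 0 1).eLpNorm_ne_top,
    fun n => ?_⟩
  have hlaw : IdentDistrib (fun ω => solve A B 0 (path L ω) n)
      (fun ω => discountedSum A B (path L ω) n) μ μ := by
    have h1 := measurable_solve_path hL A B 0 n
    have h2 : Measurable fun ω => discountedSum A B (path L ω) n :=
      (measurable_discountedSum A B n).comp hL.measurable_path
    refine ⟨h1.aemeasurable, h2.aemeasurable, ?_⟩
    have := Measure.isProbabilityMeasure_map (μ := μ) h1.aemeasurable
    have := Measure.isProbabilityMeasure_map (μ := μ) h2.aemeasurable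
    refine Measure.ext_of_charFunDual ?_
    ext θ
    rw [charFunDual_discountedSum hL]
    rfl
  rw [hlaw.eLpNorm_eq 2]
  have h3 : (fun ω => discountedSum A B (path L ω) n)
      = ∑ k ∈ Finset.range n, fun ω => flow A k (solve A B 0 (shift k (path L ω)) 1) := by
    ext ω
    simp [discountedSum, Finset.sum_apply]
  rw [h3]
  refine (eLpNorm_sum_le (fun k _ => (memLp_discountedSum_term hL hL2 A B k).1)
    (by norm_num)).trans ?_
  rw [← ENNReal.tsum_mul_right]
  refine le_trans ?_ (ENNReal.sum_le_tsum (Finset.range n))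
  refine Finset.sum_le_sum fun k _ => (eLpNorm_discountedSum_term_le hL A B k).trans ?_
  gcongr
  rw [← ofReal_norm]
  refine ENNReal.ofReal_le_ofReal ((hA k k.cast_nonneg).trans (le_of_eq ?_))
  rw [← Real.exp_nat_mul]
  ring_nf

/-- A real process of the form `a + u · (L(t) - L(0)) + f (V(t))`, where `V` is a solution of a stable
linear equation, is stationary only if `u = 0`. -/
theorem eq_zero_of_isStrictlyStationary (hL : IsLevyProcess μ L)
    (hL2 : IsCenteredNondegenerate μ L)
    {A : E →L[ℝ] E} (B : (Fin m → ℝ) →L[ℝ] E) {K lam : ℝ} (hlam : 0 < lam)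
    (hA : ∀ t : ℝ, 0 ≤ t → ‖flow A t‖ ≤ K * Real.exp (-lam * t))
    {y : ℝ≥0 → Ω → ℝ} (hy : IsStrictlyStationary μ y) {a : Ω → ℝ} (ha : Measurable a)
    {V₀ : Ω → E} (hV₀ : Measurable V₀) (f : E →L[ℝ] ℝ) (u : Fin m → ℝ)
    (h : ∀ᵐ ω ∂μ, ∀ t, y t ω = a ω + u ⬝ᵥ path L ω t + f (solve A B (V₀ ω) (path L ω) t)) :
    u = 0 := by
  refine eq_zero_of_variance_eq_zero hL2 u ?_
  have hdot : Measurable fun x : Fin m → ℝ => u ⬝ᵥ x := by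
    simp only [dotProduct]
    fun_prop
  let X : ℕ → Ω → ℝ := fun k ω => u ⬝ᵥ (L ((k + 1 : ℕ) : ℝ≥0) ω - L (k : ℝ≥0) ω)
  have hX : ∀ k, IdentDistrib (X k) (fun ω => u ⬝ᵥ L 1 ω) μ μ := by
    intro k
    have h1 := (hL.stationaryIncrements k 1).comp hdot
    simpa [X, Function.comp_def] using h1
  have hindep : iIndepFun X μ :=
    (hL.indepIncrements.nat (t := fun k : ℕ => (k : ℝ≥0)) Nat.mono_cast).comp
      (fun _ x => u ⬝ᵥ x) fun _ => hdot
  obtain ⟨M, hM, hMn⟩ := exists_eLpNorm_solve_natCast_le hL hL2 A B hlam hA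
  rw [← (hX 0).variance_eq]
  refine variance_eq_zero_of_identDistrib (y := fun n : ℕ => y n)
    (a := fun (n : ℕ) ω => a ω + f (flow A n (V₀ ω)))
    (w := fun (n : ℕ) ω => f (solve A B 0 (path L ω) n)) (M := ‖f‖ₑ * M)
    ((hX 0).memLp_iff.2 (hL2.memLp_dotProduct u))
    ((hX 0).integral_eq.trans (hL2.integral_dotProduct u)) hindep
    (fun i => (hX i).trans (hX 0).symm) ?_ ?_ ?_ ?_ ?_ ?_ ?_
  · intro n
    have h1 := (hy n).comp (measurable_pi_apply 0)
    simpa [Function.comp_def] using h1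
  · exact fun n => (ha.add (f.measurable.comp ((flow A n).measurable.comp hV₀))).aemeasurable
  · refine ae_of_all _ fun ω => ?_
    have hsqrt : Tendsto (fun n : ℕ => (√(n : ℝ))⁻¹) atTop (𝓝 0) :=
      tendsto_inv_atTop_zero.comp (Real.tendsto_sqrt_atTop.comp tendsto_natCast_atTop_atTop)
    refine hsqrt.zero_mul_isBoundedUnder_le (isBoundedUnder_of ⟨|a ω| + ‖f‖ * (|K| * ‖V₀ ω‖), ?_⟩)
    intro n
    refine (norm_add_le _ _).trans (add_le_add le_rfl ?_)
    refine (f.le_opNorm _).trans (mul_le_mul_of_nonneg_left ?_ (norm_nonneg _))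
    refine ((flow A n).le_opNorm _).trans (mul_le_mul_of_nonneg_right ?_ (norm_nonneg _))
    refine (hA n n.cast_nonneg).trans ?_
    have h1 : Real.exp (-lam * n) ≤ 1 := Real.exp_le_one_iff.2 (by
      have := mul_nonneg hlam.le (n.cast_nonneg : (0 : ℝ) ≤ n)
      linarith)
    calc K * Real.exp (-lam * n) ≤ |K| * Real.exp (-lam * n) := by
          gcongr
          exact le_abs_self K
      _ ≤ |K| * 1 := by gcongr
      _ = |K| := mul_one _
  · exact fun n => (f.measurable.comp (measurable_solve_path hL A B 0 n)).aemeasurable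
  · exact ENNReal.mul_ne_top enorm_ne_top hM
  · intro n
    refine (eLpNorm_clm_apply_le f _).trans ?_
    gcongr
    exact hMn n
  · intro n
    filter_upwards [h] with ω hω
    have h1 : ∑ k ∈ Finset.range n, X k ω = u ⬝ᵥ path L ω n := by
      have h2 := Finset.sum_range_sub (fun k : ℕ => u ⬝ᵥ L (k : ℝ≥0) ω) n
      simp only [X, dotProduct_sub, path]
      simpa using h2
    rw [hω, h1, solve_eq_flow_add A B (V₀ ω), map_add, NNReal.coe_natCast]
    ring

end Nonstationary

/-! ### Mean square derivatives -/

/-- A process with regular paths which is uniformly continuous in mean square is the mean square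
derivative of its integral. -/
theorem isMeanSquareDeriv_of_integral {Ω : Type*} [MeasurableSpace Ω] {μ : Measure Ω}
    {E : Type*} [NormedAddCommGroup E] [NormedSpace ℝ E] [CompleteSpace E]
    {Y f : ℝ≥0 → Ω → E} (hf : ∀ t, MemLp (f t) 2 μ)
    (hreg : ∀ᵐ ω ∂μ, IsRegularPath (fun t => f t ω))
    (hcont : ∀ ε : ℝ≥0∞, 0 < ε → ∃ δ > 0, ∀ s t, dist s t < δ →
      eLpNorm (fun ω => f s ω - f t ω) 2 μ ≤ ε)
    (hY : ∀ᵐ ω ∂μ, ∀ t : ℝ≥0, Y t ω = Y 0 ω + ∫ u in (0 : ℝ)..t, f u.toNNReal ω) :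
    IsMeanSquareDeriv μ Y f := by
  intro t
  refine ⟨hf t, ENNReal.tendsto_nhds_zero.2 fun ε hε => ?_⟩
  obtain ⟨δ, hδ, hδε⟩ := hcont ε hε
  have hnear : ∀ᶠ s in 𝓝[≠] t, dist s t < δ ∧ s ≠ t :=
    (eventually_mem_set.2 (mem_nhdsWithin_of_mem_nhds (Metric.ball_mem_nhds t hδ))).and
      self_mem_nhdsWithin
  filter_upwards [hnear] with s ⟨hst, hne⟩
  -- `a ≤ a + h` are `s` and `t` in increasing order
  obtain ⟨a, h, hh, hah, hsymm⟩ : ∃ a h : ℝ≥0, 0 < h ∧ (∀ u ≤ h, dist (a + u) t ≤ dist s t) ∧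
      ∀ ω, ((s : ℝ) - t)⁻¹ • (Y s ω - Y t ω) = (h : ℝ)⁻¹ • (Y (a + h) ω - Y a ω) := by
    rcases lt_or_gt_of_ne hne with hlt | hlt
    · refine ⟨s, t - s, tsub_pos_of_lt hlt, fun u hu => ?_, fun ω => ?_⟩
      · have h1 : s + u ≤ t := (add_le_add_right hu s).trans (add_tsub_cancel_of_le hlt.le).le
        have h1' : (s : ℝ) + u ≤ t := by exact_mod_cast h1
        have h2 := u.coe_nonneg
        rw [NNReal.dist_eq, NNReal.dist_eq, NNReal.coe_add, abs_sub_comm, abs_sub_comm (s : ℝ),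
          abs_of_nonneg (by linarith), abs_of_nonneg (by linarith)]
        linarith
      · rw [add_tsub_cancel_of_le hlt.le, NNReal.coe_sub hlt.le, ← neg_sub (t : ℝ) s,
          ← neg_sub (Y t ω), inv_neg, neg_smul_neg]
    · refine ⟨t, s - t, tsub_pos_of_lt hlt, fun u hu => ?_, fun ω => ?_⟩
      · have h1 : t + u ≤ s := (add_le_add_right hu t).trans (add_tsub_cancel_of_le hlt.le).le
        have h1' : (t : ℝ) + u ≤ s := by exact_mod_cast h1
        have h2 := u.coe_nonneg
        rw [NNReal.dist_eq, NNReal.dist_eq, NNReal.coe_add,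
          abs_of_nonneg (by linarith), abs_of_nonneg (by linarith)]
        linarith
      · rw [add_tsub_cancel_of_le hlt.le, NNReal.coe_sub hlt.le]
  have hrepr : ∀ᵐ ω ∂μ, ((s : ℝ) - t)⁻¹ • (Y s ω - Y t ω) - f t ω
      = (h : ℝ)⁻¹ • ∫ u in (0 : ℝ)..h, (f (a + u.toNNReal) ω - f t ω) := by
    filter_upwards [hreg, hY] with ω h1 h2
    have hsh : ∫ u in (0 : ℝ)..h, f (a + u.toNNReal) ω = ∫ u in (a : ℝ)..(a + h : ℝ≥0),
        f u.toNNReal ω := by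
      have h4 := intervalIntegral.integral_comp_add_left (a := 0) (b := h)
        (fun u => f u.toNNReal ω) (a : ℝ)
      rw [add_zero, ← NNReal.coe_add] at h4
      rw [← h4]
      refine intervalIntegral.integral_congr fun u hu => ?_
      rw [Set.uIcc_of_le h.coe_nonneg] at hu
      rw [Real.toNNReal_add a.coe_nonneg hu.1, Real.toNNReal_coe]
    have h5 : IntervalIntegrable (fun u : ℝ => f (a + u.toNNReal) ω) volume 0 h :=
      (h1.comp_add a).intervalIntegrable le_rfl h.coe_nonneg
    rw [intervalIntegral.integral_sub h5 intervalIntegrable_const,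
      intervalIntegral.integral_const, sub_zero, hsymm, smul_sub _ _ ((h : ℝ) • f t ω), smul_smul,
      inv_mul_cancel₀ (NNReal.coe_ne_zero.2 hh.ne'), one_smul, h2 (a + h), h2 a, hsh,
      add_sub_add_left_eq_sub, intervalIntegral.integral_interval_sub_left
        (h1.intervalIntegrable le_rfl (NNReal.coe_nonneg _))
        (h1.intervalIntegrable le_rfl a.coe_nonneg)]
  rw [eLpNorm_congr_ae hrepr]
  change eLpNorm ((h : ℝ)⁻¹ • fun ω => ∫ u in (0 : ℝ)..h, (f (a + u.toNNReal) ω - f t ω)) 2 μ ≤ ε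
  rw [eLpNorm_const_smul]
  have hint := eLpNorm_integral_le (f := fun u ω => f (a + u) ω - f t ω) (t := h) (M := ε)
    (fun u => ((hf _).sub (hf t)).1)
    (by filter_upwards [hreg] with ω h1 using (h1.comp_add a).sub_const _)
    (fun u hu => hδε _ _ ((hah u hu).trans_lt hst))
  refine (mul_le_mul_right hint _).trans (le_of_eq ?_)
  have h6 : ‖(h : ℝ)⁻¹‖ₑ = (h : ℝ≥0∞)⁻¹ := by
    rw [← NNReal.coe_inv, Real.enorm_eq_ofReal (NNReal.coe_nonneg _), ENNReal.ofReal_coe_nnreal,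
      ENNReal.coe_inv hh.ne']
  rw [h6, ← mul_assoc, ENNReal.inv_mul_cancel (ENNReal.coe_ne_zero.2 hh.ne') ENNReal.coe_ne_top,
    one_mul]

/-! ### The stationary solution of a stable equation -/

section Stationary

variable {Ω : Type*} [MeasurableSpace Ω] {m : ℕ} {μ : Measure Ω} [IsProbabilityMeasure μ]
  {L : ℝ≥0 → Ω → (Fin m → ℝ)}
  {E : Type*} [NormedAddCommGroup E] [NormedSpace ℝ E] [CompleteSpace E]
  [MeasurableSpace E] [BorelSpace E] [SecondCountableTopology E]
  {γ : Type*} [MeasurableSpace γ] {π : Measure γ} [IsProbabilityMeasure π]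

theorem ae_isRegularPath_fst (hL : IsLevyProcess μ L) :
    ∀ᵐ z ∂μ.prod π, IsRegularPath (path L z.1) :=
  Measure.quasiMeasurePreserving_fst.ae hL.isRegularPath

/-- Started from an invariant law independent of `L`, the solution and the increments of `L` are
jointly stationary. -/
theorem IsInvariantLaw.identDistrib_process (hL : IsLevyProcess μ L) {A : E →L[ℝ] E}
    {B : (Fin m → ℝ) →L[ℝ] E} {ν : Measure E} (hν : IsInvariantLaw μ L A B ν) {g : γ → E}
    (hg : Measurable g) (hgν : π.map g = ν) (s : ℝ≥0) :
    IdentDistrib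
      (fun (z : Ω × γ) t => (solve A B (g z.2) (path L z.1) (s + t), shift s (path L z.1) t))
      (fun z t => (solve A B (g z.2) (path L z.1) t, path L z.1 t)) (μ.prod π) (μ.prod π) := by
  have hΦ : Measurable fun (p : E × (ℝ≥0 → Fin m → ℝ)) t => (solve A B p.1 p.2 t, p.2 t) :=
    measurable_pi_lambda _ fun t =>
      (measurable_solve A B t).prodMk ((measurable_pi_apply t).comp measurable_snd)
  have h1 := (hν.identDistrib hL hg hgν s).comp hΦ
  refine IdentDistrib.trans (IdentDistrib.of_ae_eq ?_ ?_) h1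
  · refine (measurable_pi_lambda _ fun t => ?_).aemeasurable
    have hpm : Measurable fun z : Ω × γ => path L z.1 := hL.measurable_path.comp measurable_fst
    exact ((measurable_solve A B (s + t)).comp ((hg.comp measurable_snd).prodMk hpm)).prodMk
      ((measurable_pi_apply t).comp ((measurable_shift s).comp hpm))
  · filter_upwards [ae_isRegularPath_fst hL] with z hz
    funext t
    simp only [Function.comp, solve_add A B (g z.2) hz (path_zero z.1) s t]

theorem memLp_solve_prod (hL : IsLevyProcess μ L) (hL2 : IsCenteredNondegenerate μ L)
    (A : E →L[ℝ] E) (B : (Fin m → ℝ) →L[ℝ] E) {g : γ → E} (hg : MemLp g 2 π) (t : ℝ≥0) :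
    MemLp (fun z : Ω × γ => solve A B (g z.2) (path L z.1) t) 2 (μ.prod π) := by
  have h1 : MemLp (fun z : Ω × γ => flow A t (g z.2)) 2 (μ.prod π) :=
    (flow A t).comp_memLp' (hg.comp_measurePreserving measurePreserving_snd)
  have h2 : MemLp (fun z : Ω × γ => solve A B 0 (path L z.1) t) 2 (μ.prod π) :=
    (memLp_solve hL hL2 A B 0 t).comp_measurePreserving measurePreserving_fst
  simp only [fun z : Ω × γ => solve_eq_flow_add A B (g z.2) (path L z.1) t]
  exact h1.add h2

/-- By stationarity of its increments, the stationary solution is uniformly continuous in mean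
square. -/
theorem IsInvariantLaw.exists_eLpNorm_sub_le (hL : IsLevyProcess μ L)
    (hL2 : IsCenteredNondegenerate μ L) {A : E →L[ℝ] E}
    {B : (Fin m → ℝ) →L[ℝ] E} {ν : Measure E} (hν : IsInvariantLaw μ L A B ν) {g : γ → E}
    (hg : Measurable g) (hg2 : MemLp g 2 π) (hgν : π.map g = ν) (ε : ℝ≥0∞) (hε : 0 < ε) :
    ∃ δ > 0, ∀ s t, dist s t < δ →
      eLpNorm (fun z : Ω × γ => solve A B (g z.2) (path L z.1) s
        - solve A B (g z.2) (path L z.1) t) 2 (μ.prod π) ≤ ε := by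
  obtain ⟨c, hc⟩ := exists_eLpNorm_path_le hL hL2
  obtain ⟨C, hC⟩ := exists_eLpNorm_memory_le hL hL2 A B 1
  let w : ℝ≥0 → ℝ≥0∞ := fun h => ‖flow A h - 1‖ₑ * eLpNorm g 2 π
    + (‖B‖ₑ * (c * NNReal.sqrt h) + h * C)
  have hpath : ∀ h, MemLp (fun z : Ω × γ => B (path L z.1 h)) 2 (μ.prod π) := fun h =>
    B.comp_memLp' ((memLp_path hL hL2 h).comp_measurePreserving measurePreserving_fst)
  have hmem : ∀ h, MemLp (fun z : Ω × γ => memory A B (path L z.1) h) 2 (μ.prod π) := fun h =>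
    (memLp_memory hL hL2 A B h).comp_measurePreserving measurePreserving_fst
  have hg2' : MemLp (fun z : Ω × γ => g z.2) 2 (μ.prod π) :=
    hg2.comp_measurePreserving measurePreserving_snd
  have hfwd : ∀ s h : ℝ≥0, h ≤ 1 → eLpNorm (fun z : Ω × γ =>
      solve A B (g z.2) (path L z.1) (s + h) - solve A B (g z.2) (path L z.1) s) 2 (μ.prod π)
        ≤ w h := by
    intro s h hh
    have hΨ : Measurable fun v : ℝ≥0 → E × (Fin m → ℝ) => (v h).1 - (v 0).1 := by fun_prop
    have h1 := ((hν.identDistrib_process hL hg hgν s).comp hΨ).eLpNorm_eq 2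
    simp only [Function.comp_def, add_zero, solve_zero A B _ (path_zero _)] at h1
    rw [h1]
    have h2 : (fun z : Ω × γ => solve A B (g z.2) (path L z.1) h - g z.2)
        = (fun z => (flow A h - 1) (g z.2))
          + ((fun z => B (path L z.1 h)) + fun z => memory A B (path L z.1) h) := by
      ext z
      simp only [solve, Pi.add_apply, sub_apply, one_apply_eq_self]
      abel
    rw [h2]
    refine (eLpNorm_add_le ((flow A h - 1).comp_memLp' hg2').1 ((hpath h).add (hmem h)).1
      (by norm_num)).trans (add_le_add ?_ ?_)
    · refine (eLpNorm_clm_apply_le _ _).trans (le_of_eq ?_)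
      rw [← eLpNorm_comp_measurePreserving hg2.1 (measurePreserving_snd (μ := μ))]
      rfl
    · refine (eLpNorm_add_le (hpath h).1 (hmem h).1 (by norm_num)).trans (add_le_add ?_ ?_)
      · refine (eLpNorm_clm_apply_le _ _).trans ?_
        gcongr
        have := eLpNorm_comp_measurePreserving (memLp_path hL hL2 h).1
          (measurePreserving_fst (μ := μ) (ν := π)) (p := 2)
        exact this.trans_le (hc h)
      · have := eLpNorm_comp_measurePreserving (memLp_memory hL hL2 A B h).1
          (measurePreserving_fst (μ := μ) (ν := π)) (p := 2)
        exact this.trans_le (hC h hh)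
  have hw : Tendsto w (𝓝 0) (𝓝 0) := by
    have h1 : Tendsto (fun h : ℝ≥0 => ‖flow A h - 1‖ₑ) (𝓝 0) (𝓝 0) := by
      have h2 : Continuous fun h : ℝ≥0 => ‖flow A h - 1‖ₑ :=
        (((continuous_flow A).comp NNReal.continuous_coe).sub continuous_const).enorm
      have h3 := h2.tendsto 0
      rwa [NNReal.coe_zero, flow_zero, sub_self, ← ofReal_norm, norm_zero, ENNReal.ofReal_zero] at h3
    have h2 : Tendsto (fun h : ℝ≥0 => (c : ℝ≥0∞) * NNReal.sqrt h) (𝓝 0) (𝓝 0) := by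
      have h3 : Continuous fun h : ℝ≥0 => c * NNReal.sqrt h := by fun_prop
      have h4 := ENNReal.tendsto_coe.2 (h3.tendsto 0)
      simpa using h4
    have h3 : Tendsto (fun h : ℝ≥0 => (h : ℝ≥0∞) * C) (𝓝 0) (𝓝 0) := by
      have h3 : Continuous fun h : ℝ≥0 => h * C := by fun_prop
      have h4 := ENNReal.tendsto_coe.2 (h3.tendsto 0)
      simpa using h4
    have h4 := (ENNReal.Tendsto.mul_const (b := eLpNorm g 2 π) h1 (Or.inr hg2.eLpNorm_ne_top)).add
      ((ENNReal.Tendsto.const_mul (a := ‖B‖ₑ) h2 (Or.inr enorm_ne_top)).add h3)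
    simpa [w] using h4
  obtain ⟨δ, hδ, hδw⟩ := Metric.eventually_nhds_iff.1 (ENNReal.tendsto_nhds_zero.1 hw ε hε)
  have key : ∀ s t, s ≤ t → dist s t < min δ 1 →
      eLpNorm (fun z : Ω × γ => solve A B (g z.2) (path L z.1) t
        - solve A B (g z.2) (path L z.1) s) 2 (μ.prod π) ≤ ε := by
    intro s t hst hd
    have hd' : dist (t - s) 0 < min δ 1 := by
      rw [NNReal.dist_eq, NNReal.coe_sub hst, NNReal.coe_zero, sub_zero, ← NNReal.dist_eq,
        dist_comm]
      exact hd
    have h1 : t - s ≤ 1 := by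
      have := hd'.trans_le (min_le_right _ _)
      rw [NNReal.dist_eq, NNReal.coe_zero, sub_zero, abs_of_nonneg (NNReal.coe_nonneg _)] at this
      exact_mod_cast this.le
    have h2 := hfwd s (t - s) h1
    rw [add_tsub_cancel_of_le hst] at h2
    exact h2.trans (hδw (hd'.trans_le (min_le_left _ _)))
  refine ⟨min δ 1, lt_min hδ one_pos, fun s t hd => ?_⟩
  rcases le_total s t with hst | hst
  · have h1 := key s t hst hd
    rwa [← eLpNorm_neg, show (-fun z : Ω × γ => solve A B (g z.2) (path L z.1) t
        - solve A B (g z.2) (path L z.1) s) = fun z : Ω × γ => solve A B (g z.2) (path L z.1) s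
        - solve A B (g z.2) (path L z.1) t by ext z; simp] at h1
  · exact key t s hst (dist_comm s t ▸ hd)

end Stationary

/-! ### Decomposition into a stable part and a random walk part -/

section Decomposition

variable {E F : Type*} [NormedAddCommGroup E] [NormedSpace ℝ E] [CompleteSpace E]
  [NormedAddCommGroup F] [NormedSpace ℝ F]

/-- `R` is a projection onto a subspace of the kernel of `A`, along a subspace containing the range
of `A`. If `R` is the spectral projection of the semisimple eigenvalue zero, then `1 - R` intertwines
`A` with `A - R`, which has the same eigenvalues except that zero is replaced by `-1`. -/
structure IsZeroProjection (A R : E →L[ℝ] E) : Prop where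
  apply_proj : ∀ x, A (R x) = 0
  proj_apply : ∀ x, R (A x) = 0
  proj_proj : ∀ x, R (R x) = R x

variable {A R : E →L[ℝ] E}

theorem IsZeroProjection.intertwining (h : IsZeroProjection A R) (x : E) :
    (1 - R) (A x) = (A - R) ((1 - R) x) := by
  simp [h.apply_proj, h.proj_apply, h.proj_proj]

theorem IsZeroProjection.intertwining_sub (h : IsZeroProjection A R) (x : E) :
    (1 - R) ((A - R) x) = (A - R) ((1 - R) x) := by
  simp [h.apply_proj, h.proj_apply, h.proj_proj]

/-- The stable part of a solution solves the stable equation. -/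
theorem IsPathSolution.one_sub_apply (h : IsZeroProjection A R) {B : F →L[ℝ] E} {l : ℝ≥0 → F}
    {X : ℝ≥0 → E} (hX : IsPathSolution A B l X) :
    IsPathSolution (A - R) ((1 - R) ∘L B) l (fun t => (1 - R) (X t)) :=
  hX.map (1 - R) h.intertwining

/-- The remaining part of a solution follows the driving path. -/
theorem IsPathSolution.proj_apply (h : IsZeroProjection A R) {B : F →L[ℝ] E} {l : ℝ≥0 → F}
    {X : ℝ≥0 → E} (hX : IsPathSolution A B l X) (t : ℝ≥0) :
    R (X t) = R (X 0) + R (B (l t)) := by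
  have h1 := (hX.map R (A' := 0) fun x => by simp [h.proj_apply]).equation t
  simpa using h1

theorem norm_flow_sub_one_le {K lam : ℝ} (hlam : 0 < lam)
    (hA : ∀ t : ℝ, 0 ≤ t → ‖flow A t‖ ≤ K * Real.exp (-lam * t)) {t : ℝ} (ht : 0 ≤ t) :
    ‖flow A t - 1‖ ≤ ‖A‖ * K * t := by
  have hK : 0 ≤ K := by
    have := (norm_nonneg _).trans (hA 0 le_rfl)
    simpa using this
  have h1 := norm_image_sub_le_of_norm_deriv_le_segment' (f := flow A) (a := 0) (b := t)
    (C := ‖A‖ * K) (fun x _ => (hasDerivAt_flow A x).hasDerivWithinAt) (fun x hx => ?_) t ⟨ht, le_rfl⟩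
  · rwa [flow_zero, sub_zero] at h1
  · refine (norm_mul_le _ _).trans (mul_le_mul_of_nonneg_left ?_ (norm_nonneg _))
    refine (hA x hx.1).trans (mul_le_of_le_one_right hK (Real.exp_le_one_iff.2 ?_))
    have := mul_nonneg hlam.le hx.1
    linarith

/-- Linear maps which vanish on the range of the projection forget the initial state
exponentially fast. -/
theorem IsPathSolution.norm_sub_le {G : Type*} [NormedAddCommGroup G] [NormedSpace ℝ G]
    (h : IsZeroProjection A R) {K lam : ℝ}
    (hA : ∀ t : ℝ, 0 ≤ t → ‖flow (A - R) t‖ ≤ K * Real.exp (-lam * t))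
    {B : F →L[ℝ] E} {l : ℝ≥0 → F} {X Y : ℝ≥0 → E} (hX : IsPathSolution A B l X)
    (hY : IsPathSolution A B l Y) (T : E →L[ℝ] G) (hT : ∀ x, T (R x) = 0) (t : ℝ≥0) :
    ‖T (X t) - T (Y t)‖ ≤ ‖T‖ * K * ‖1 - R‖ * Real.exp (-lam * t) * ‖X 0 - Y 0‖ := by
  have h1 := (hX.one_sub_apply h).sub_eq (hY.one_sub_apply h) t
  have h2 : T (X t) - T (Y t) = T (flow (A - R) t ((1 - R) (X 0 - Y 0))) := by
    rw [map_sub (1 - R), ← h1]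
    simp [hT]
  rw [h2]
  calc _ ≤ ‖T‖ * (‖flow (A - R) t‖ * (‖1 - R‖ * ‖X 0 - Y 0‖)) := by
        refine (T.le_opNorm _).trans (mul_le_mul_of_nonneg_left ?_ (norm_nonneg _))
        refine ((flow (A - R) t).le_opNorm _).trans (mul_le_mul_of_nonneg_left ?_ (norm_nonneg _))
        exact (1 - R).le_opNorm _
    _ ≤ ‖T‖ * (K * Real.exp (-lam * t) * (‖1 - R‖ * ‖X 0 - Y 0‖)) := by
        gcongr
        exact hA t t.coe_nonneg
    _ = _ := by ring

/-- The increments of all solutions approach each other exponentially fast, because the part in the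
range of the projection has the same increments for all solutions. -/
theorem IsPathSolution.norm_increment_sub_le {G : Type*} [NormedAddCommGroup G] [NormedSpace ℝ G]
    (h : IsZeroProjection A R) {K lam : ℝ} (hlam : 0 < lam)
    (hA : ∀ t : ℝ, 0 ≤ t → ‖flow (A - R) t‖ ≤ K * Real.exp (-lam * t))
    {B : F →L[ℝ] E} {l : ℝ≥0 → F} {X Y : ℝ≥0 → E} (hX : IsPathSolution A B l X)
    (hY : IsPathSolution A B l Y) (T : E →L[ℝ] G) (t s : ℝ≥0) :
    ‖(T (X (t + s)) - T (X t)) - (T (Y (t + s)) - T (Y t))‖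
      ≤ ‖T‖ * (‖A - R‖ * K) * K * ‖1 - R‖ * s * Real.exp (-lam * t) * ‖X 0 - Y 0‖ := by
  have h1 := (hX.one_sub_apply h).sub_eq (hY.one_sub_apply h)
  have hsplit : ∀ x : E, x = (1 - R) x + R x := fun x => by simp
  have hdiff : ∀ u, X u - Y u = flow (A - R) u ((1 - R) (X 0 - Y 0)) + R (X 0 - Y 0) := by
    intro u
    rw [map_sub (1 - R) (X 0), ← h1 u, map_sub, hsplit (X u - Y u), map_sub, map_sub,
      hX.proj_apply h u, hY.proj_apply h u]
    abel
  have h2 : (T (X (t + s)) - T (X t)) - (T (Y (t + s)) - T (Y t))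
      = T ((flow (A - R) s - 1) (flow (A - R) t ((1 - R) (X 0 - Y 0)))) := by
    have h3 : (T (X (t + s)) - T (X t)) - (T (Y (t + s)) - T (Y t))
        = T ((X (t + s) - Y (t + s)) - (X t - Y t)) := by
      simp only [map_sub]
      abel
    rw [h3, hdiff (t + s), hdiff t, NNReal.coe_add, add_comm (t : ℝ), flow_add]
    congr 1
    simp only [mul_apply_eq_comp, sub_apply, one_apply_eq_self]
    abel
  rw [h2]
  calc _ ≤ ‖T‖ * (‖flow (A - R) s - 1‖ * (‖flow (A - R) t‖ * (‖1 - R‖ * ‖X 0 - Y 0‖))) := by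
        refine (T.le_opNorm _).trans (mul_le_mul_of_nonneg_left ?_ (norm_nonneg _))
        refine (ContinuousLinearMap.le_opNorm _ _).trans
          (mul_le_mul_of_nonneg_left ?_ (norm_nonneg _))
        refine ((flow (A - R) t).le_opNorm _).trans (mul_le_mul_of_nonneg_left ?_ (norm_nonneg _))
        exact (1 - R).le_opNorm _
    _ ≤ ‖T‖ * (‖A - R‖ * K * s * (K * Real.exp (-lam * t) * (‖1 - R‖ * ‖X 0 - Y 0‖))) := by
        refine mul_le_mul_of_nonneg_left ?_ (norm_nonneg _)
        refine mul_le_mul (norm_flow_sub_one_le hlam hA s.coe_nonneg) ?_ (by positivity)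
          ((norm_nonneg _).trans (norm_flow_sub_one_le hlam hA s.coe_nonneg))
        exact mul_le_mul_of_nonneg_right (hA t t.coe_nonneg) (by positivity)
    _ = _ := by ring

end Decomposition

/-! ### The solution with stationary increments -/

section StationaryIncrements

variable {Ω : Type*} [MeasurableSpace Ω] {m : ℕ} {μ : Measure Ω} [IsProbabilityMeasure μ]
  {L : ℝ≥0 → Ω → (Fin m → ℝ)}
  {E : Type*} [NormedAddCommGroup E] [NormedSpace ℝ E] [CompleteSpace E]
  [MeasurableSpace E] [BorelSpace E] [SecondCountableTopology E]
  {F : Type*} [NormedAddCommGroup F] [NormedSpace ℝ F] [CompleteSpace F]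
  [MeasurableSpace F] [BorelSpace F]
  {A R : E →L[ℝ] E} {B : (Fin m → ℝ) →L[ℝ] E}

/-- If `T R B ≠ 0`, then `T X` contains a multiple of the driving process and is not stationary, for
any solution `X`. -/
theorem not_isStrictlyStationary (hL : IsLevyProcess μ L) (hL2 : IsCenteredNondegenerate μ L)
    (h : IsZeroProjection A R) {K lam : ℝ} (hlam : 0 < lam)
    (hA : ∀ t : ℝ, 0 ≤ t → ‖flow (A - R) t‖ ≤ K * Real.exp (-lam * t))
    {X : ℝ≥0 → Ω → E} (hX0 : Measurable (X 0))
    (hX : ∀ᵐ ω ∂μ, IsPathSolution A B (path L ω) (fun t => X t ω)) {d : ℕ}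
    (T : E →L[ℝ] (Fin d → ℝ)) (hT : ∃ x, T (R (B x)) ≠ 0) :
    ¬ IsStrictlyStationary μ (fun t ω => T (X t ω)) := by
  intro hs
  obtain ⟨x, hx⟩ := hT
  obtain ⟨j, hj⟩ := Function.ne_iff.1 hx
  let f : E →L[ℝ] ℝ := (ContinuousLinearMap.proj j) ∘L T
  let u : Fin m → ℝ := fun i => f (R (B (Pi.single i 1)))
  have hu : ∀ y, u ⬝ᵥ y = f (R (B y)) := by
    intro y
    conv_rhs => rw [pi_eq_sum_univ' y]
    simp [u, dotProduct, mul_comm]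
  have hy : IsStrictlyStationary μ (fun t ω => f (X t ω)) := by
    intro s
    have hm : Measurable fun (v : ℝ≥0 → Fin d → ℝ) t => v t j := by fun_prop
    exact (hs s).comp hm
  have hzero := eq_zero_of_isStrictlyStationary hL hL2 ((1 - R) ∘L B) hlam hA hy
    (a := fun ω => f (R (X 0 ω))) (f.measurable.comp (R.measurable.comp hX0))
    (V₀ := fun ω => (1 - R) (X 0 ω)) ((1 - R).measurable.comp hX0) f u (by
      filter_upwards [hX, hL.isRegularPath] with ω h1 h2 t
      rw [← solve_eq_of_isPathSolution h2 (path_zero ω) (h1.one_sub_apply h) t, hu, ← map_add,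
        ← map_add, ← h1.proj_apply h t]
      simp)
  apply hj
  have := hu x
  rw [hzero, zero_dotProduct] at this
  exact this.symm

/-- The law `π` has finite second moments, and its image under `1 - R`, which is the initial law of the
stable part of the solution started from `π`, is an invariant law of the stable equation. -/
structure IsStationaryStart (μ : Measure Ω) (L : ℝ≥0 → Ω → (Fin m → ℝ)) (A R : E →L[ℝ] E)
    (B : (Fin m → ℝ) →L[ℝ] E) (π : Measure E) : Prop where
  memLp : MemLp id 2 π
  invariant : IsInvariantLaw μ L (A - R) ((1 - R) ∘L B) (π.map ⇑(1 - R))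

/-- Stationary starts exist, and may be chosen on the kernel of a linear map `T`: the image of an
invariant law under a map `G` with `T G = 0` will do, if `G` changes only the component in the range
of `R`. -/
theorem exists_isStationaryStart (hL : IsLevyProcess μ L) (hL2 : IsCenteredNondegenerate μ L)
    (h : IsZeroProjection A R) (B : (Fin m → ℝ) →L[ℝ] E) {K lam : ℝ} (hlam : 0 < lam)
    (hA : ∀ t : ℝ, 0 ≤ t → ‖flow (A - R) t‖ ≤ K * Real.exp (-lam * t))
    (G : E →L[ℝ] E) (hG : ∀ x, (1 - R) (G x) = (1 - R) x) {T : E →L[ℝ] F}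
    (hT : ∀ x, T (G x) = 0) :
    ∃ π : Measure E, IsProbabilityMeasure π ∧ IsStationaryStart μ L A R B π ∧
      ∀ᵐ x ∂π, T x = 0 := by
  obtain ⟨ν, hν, hν2, hinv⟩ := exists_isInvariantLaw hL hL2 (A - R) ((1 - R) ∘L B) hlam hA
  refine ⟨ν.map G, Measure.isProbabilityMeasure_map G.measurable.aemeasurable, ⟨?_, ?_⟩, ?_⟩
  · rw [memLp_map_measure_iff aestronglyMeasurable_id G.measurable.aemeasurable]
    exact G.comp_memLp' hν2
  · have h1 := hinv.map hL (1 - R) h.intertwining_sub (by ext x; simp [h.proj_proj])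
    rw [Measure.map_map (1 - R).measurable G.measurable]
    convert! h1 using 2
    ext x
    exact hG x
  · rw [ae_map_iff G.measurable.aemeasurable 
      (isClosed_eq T.continuous continuous_const).measurableSet]
    exact ae_of_all _ hT

/-- The solution on the product space whose initial state is the second coordinate. -/
noncomputable def startedSolution (L : ℝ≥0 → Ω → (Fin m → ℝ)) (A : E →L[ℝ] E)
    (B : (Fin m → ℝ) →L[ℝ] E) : ℝ≥0 → Ω × E → E :=
  fun t z => solve A B z.2 (path L z.1) t

variable {π : Measure E} [IsProbabilityMeasure π]

theorem startedSolution_zero (z : Ω × E) : startedSolution L A B 0 z = z.2 :=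
  solve_zero A B z.2 (path_zero z.1)

theorem measurable_startedSolution (hL : IsLevyProcess μ L) (t : ℝ≥0) :
    Measurable (startedSolution L A B t) :=
  (measurable_solve A B t).comp
    (measurable_snd.prodMk (hL.measurable_path.comp measurable_fst))

theorem ae_isPathSolution_startedSolution (hL : IsLevyProcess μ L) :
    ∀ᵐ z ∂μ.prod π, IsPathSolution A B (path L z.1) (fun t => startedSolution L A B t z) := by
  filter_upwards [ae_isRegularPath_fst hL] with z hz
  exact isPathSolution_solve A B z.2 hz (path_zero z.1)

theorem ae_startedSolution_eq (hL : IsLevyProcess μ L) (h : IsZeroProjection A R) :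
    ∀ᵐ z ∂μ.prod π, ∀ t, startedSolution L A B t z
      = solve (A - R) ((1 - R) ∘L B) ((1 - R) z.2) (path L z.1) t
        + (R z.2 + R (B (path L z.1 t))) := by
  filter_upwards [ae_isRegularPath_fst hL, ae_isPathSolution_startedSolution (A := A) (B := B) hL]
    with z hz h1 t
  have h2 := solve_eq_of_isPathSolution hz (path_zero z.1) (h1.one_sub_apply h) t
  have h3 := h1.proj_apply h t
  simp only [startedSolution_zero] at h2 h3
  rw [← h2, ← h3]
  simp

theorem memLp_startedSolution (hL : IsLevyProcess μ L) (hL2 : IsCenteredNondegenerate μ L)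
    (hπ : MemLp id 2 π) (t : ℝ≥0) : MemLp (startedSolution L A B t) 2 (μ.prod π) :=
  memLp_solve_prod hL hL2 A B hπ t

/-- The stable part and the increments of the driving process are jointly stationary. -/
theorem IsStationaryStart.identDistrib (hL : IsLevyProcess μ L)
    (hπ : IsStationaryStart μ L A R B π) (s : ℝ≥0) :
    IdentDistrib
      (fun (z : Ω × E) t => (solve (A - R) ((1 - R) ∘L B) ((1 - R) z.2) (path L z.1) (s + t),
        shift s (path L z.1) t))
      (fun z t => (solve (A - R) ((1 - R) ∘L B) ((1 - R) z.2) (path L z.1) t, path L z.1 t))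
      (μ.prod π) (μ.prod π) :=
  hπ.invariant.identDistrib_process hL (1 - R).measurable rfl s

theorem IsStationaryStart.isStrictlyStationary (hL : IsLevyProcess μ L) (h : IsZeroProjection A R)
    (hπ : IsStationaryStart μ L A R B π) (T : E →L[ℝ] F) (hT : ∀ x, T (R x) = 0) :
    IsStrictlyStationary (μ.prod π) (fun t z => T (startedSolution L A B t z)) := by
  intro s
  have hΨ : Measurable fun (v : ℝ≥0 → E × (Fin m → ℝ)) t => T (v t).1 :=
    measurable_pi_lambda _ fun t => T.measurable.comp (by fun_prop)
  have hm : ∀ t, Measurable fun z => T (startedSolution L A B t z) := fun t =>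
    T.measurable.comp (measurable_startedSolution hL t)
  have heq : ∀ᵐ z ∂μ.prod π, ∀ t, T (startedSolution L A B t z)
      = T (solve (A - R) ((1 - R) ∘L B) ((1 - R) z.2) (path L z.1) t) := by
    filter_upwards [ae_startedSolution_eq hL h] with z hz t
    rw [hz t]
    simp [hT]
  refine (IdentDistrib.of_ae_eq ?_ ?_).trans (((hπ.identDistrib hL s).comp hΨ).trans
    (IdentDistrib.of_ae_eq (g := fun z t => T (startedSolution L A B t z)) ?_ ?_))
  · exact (measurable_pi_lambda _ fun t => hm (s + t)).aemeasurable
  · filter_upwards [heq] with z hz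
    funext t
    exact hz (s + t)
  · exact ((hπ.identDistrib hL s).comp hΨ).aemeasurable_snd
  · filter_upwards [heq] with z hz
    funext t
    exact (hz t).symm

theorem IsStationaryStart.hasStrictlyStationaryIncrements (hL : IsLevyProcess μ L)
    (h : IsZeroProjection A R) (hπ : IsStationaryStart μ L A R B π) (T : E →L[ℝ] F)
    [SecondCountableTopology F] :
    HasStrictlyStationaryIncrements (μ.prod π) (fun t z => T (startedSolution L A B t z)) := by
  intro s
  have hΨ : Measurable fun (v : ℝ≥0 → E × (Fin m → ℝ)) t =>
      T ((v t).1 - (v 0).1) + T (R (B (v t).2)) :=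
    measurable_pi_lambda _ fun t => (T.measurable.comp (by fun_prop)).add
      (T.measurable.comp (R.measurable.comp (B.measurable.comp (by fun_prop))))
  have hm : ∀ t, Measurable fun z => T (startedSolution L A B t z) := fun t =>
    T.measurable.comp (measurable_startedSolution hL t)
  have heq : ∀ᵐ z ∂μ.prod π, ∀ s t, T (startedSolution L A B (s + t) z)
        - T (startedSolution L A B s z)
      = T (solve (A - R) ((1 - R) ∘L B) ((1 - R) z.2) (path L z.1) (s + t)
          - solve (A - R) ((1 - R) ∘L B) ((1 - R) z.2) (path L z.1) s)
        + T (R (B (shift s (path L z.1) t))) := by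
    filter_upwards [ae_startedSolution_eq hL h] with z hz s t
    rw [hz, hz]
    simp only [shift, map_add, map_sub]
    abel
  refine (IdentDistrib.of_ae_eq ?_ ?_).trans (((hπ.identDistrib hL s).comp hΨ).trans
    (IdentDistrib.of_ae_eq (g := fun z t => T (startedSolution L A B t z)
      - T (startedSolution L A B 0 z)) ?_ ?_))
  · exact (measurable_pi_lambda _ fun t => (hm (s + t)).sub (hm s)).aemeasurable
  · filter_upwards [heq] with z hz
    funext t
    simp only [Function.comp, add_zero]
    exact hz s t
  · exact ((hπ.identDistrib hL s).comp hΨ).aemeasurable_snd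
  · filter_upwards [heq] with z hz
    funext t
    have h1 := hz 0 t
    rw [zero_add] at h1
    simp only [Function.comp]
    rw [h1]
    simp [shift]

/-- If the input does not enter the output directly, the output is differentiable in mean square,
and its derivative is a function of the stable part. -/
theorem IsStationaryStart.isMeanSquareDeriv (hL : IsLevyProcess μ L)
    (hL2 : IsCenteredNondegenerate μ L) (h : IsZeroProjection A R)
    (hπ : IsStationaryStart μ L A R B π) (T : E →L[ℝ] F) (hT : ∀ x, T (B x) = 0) :
    IsMeanSquareDeriv (μ.prod π) (fun t z => T (startedSolution L A B t z))
      (fun t z => T (A (startedSolution L A B t z))) := by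
  refine isMeanSquareDeriv_of_integral ?_ ?_ ?_ ?_
  · exact fun t => (T ∘L A).comp_memLp' (memLp_startedSolution hL hL2 hπ.memLp t)
  · filter_upwards [ae_isRegularPath_fst hL] with z hz
    exact (isRegularPath_solve A B z.2 hz).map (T ∘L A)
  · intro ε hε
    have hTA : ‖T ∘L A‖ₑ ≠ ⊤ := enorm_ne_top
    -- the additional one keeps the divisor different from zero
    obtain ⟨δ, hδ, hle⟩ := hπ.invariant.exists_eLpNorm_sub_le hL hL2 (1 - R).measurable
      ((1 - R).comp_memLp' hπ.memLp) rfl (ε / (‖T ∘L A‖ₑ + 1))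
      (ENNReal.div_pos hε.ne' (ENNReal.add_ne_top.2 ⟨hTA, ENNReal.one_ne_top⟩))
    refine ⟨δ, hδ, fun s t hst => ?_⟩
    have hae : (fun z : Ω × E =>
        T (A (startedSolution L A B s z)) - T (A (startedSolution L A B t z)))
        =ᵐ[μ.prod π] fun z => (T ∘L A)
          (solve (A - R) ((1 - R) ∘L B) ((1 - R) z.2) (path L z.1) s
            - solve (A - R) ((1 - R) ∘L B) ((1 - R) z.2) (path L z.1) t) := by
      filter_upwards [ae_startedSolution_eq hL h] with z hz
      rw [hz, hz]
      simp [h.apply_proj]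
    rw [eLpNorm_congr_ae hae]
    refine (eLpNorm_clm_apply_le _ _).trans ((mul_le_mul_right (hle s t hst) _).trans ?_)
    refine (mul_le_mul_left (le_self_add (b := 1)) _).trans ?_
    rw [ENNReal.mul_div_cancel (by simp) (ENNReal.add_ne_top.2 ⟨hTA, ENNReal.one_ne_top⟩)]
  · filter_upwards [ae_isPathSolution_startedSolution (A := A) (B := B) hL] with z hz t
    have h1 := congrArg T (hz.equation t)
    rw [map_add, map_add, hT, add_zero] at h1
    rw [h1, ← T.intervalIntegral_comp_comm
      ⟨A.integrable_comp (hz.integrable t).1, A.integrable_comp (hz.integrable t).2⟩]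

end StationaryIncrements

/-! ### MCARMA state-space models -/

section Matrices

variable {ι κ : Type*} [Fintype ι] [DecidableEq ι] [Fintype κ] [DecidableEq κ]

theorem toCLM_sub (M M' : Matrix κ ι ℝ) : toCLM (M - M') = toCLM M - toCLM M' := by
  ext1 x
  simp [toCLM_apply, Matrix.sub_mulVec]

theorem IsKernelSplitting.isZeroProjection {A : Matrix ι ι ℝ} {N : Matrix ι κ ℝ}
    {W : Matrix κ ι ℝ} (h : IsKernelSplitting A N W) :
    IsZeroProjection (toCLM A) (toCLM (kerProj N W)) where
  apply_proj x := by
    rw [toCLM_apply, toCLM_apply, Matrix.mulVec_mulVec, h.mul_kerProj, Matrix.zero_mulVec]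
  proj_apply x := by
    rw [toCLM_apply, toCLM_apply, Matrix.mulVec_mulVec, h.kerProj_mul, Matrix.zero_mulVec]
  proj_proj x := by
    rw [toCLM_apply, toCLM_apply, Matrix.mulVec_mulVec, h.kerProj_mul_kerProj]

/-- The initial value can be corrected by an element of the kernel of `A` so that it satisfies the
linear condition `H x = 0`. -/
theorem IsKernelSplitting.exists_normalization {A : Matrix ι ι ℝ} {N : Matrix ι κ ℝ}
    {W : Matrix κ ι ℝ} (h : IsKernelSplitting A N W) {H : Matrix κ ι ℝ} (hH : IsUnit (H * N).det) :
    ∃ G : Matrix ι ι ℝ, (∀ x, (1 - toCLM (kerProj N W)) (toCLM G x)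
      = (1 - toCLM (kerProj N W)) x) ∧ H * G = 0 := by
  refine ⟨1 - N * (H * N)⁻¹ * H, fun x => ?_, ?_⟩
  · have h1 : kerProj N W * (1 - N * (H * N)⁻¹ * H)
        = kerProj N W - N * (H * N)⁻¹ * H := by
      rw [Matrix.mul_sub, Matrix.mul_one, ← Matrix.mul_assoc, ← Matrix.mul_assoc, h.kerProj_mul_N]
    simp only [sub_apply, one_apply_eq_self, toCLM_apply]
    rw [Matrix.mulVec_mulVec, h1, Matrix.sub_mulVec, Matrix.sub_mulVec, Matrix.one_mulVec]
    abel
  · rw [Matrix.mul_sub, Matrix.mul_one, ← Matrix.mul_assoc, ← Matrix.mul_assoc,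
      Matrix.mul_nonsing_inv _ hH, Matrix.one_mul, sub_self]

end Matrices

section StateSolution

variable {Ω ι : Type*} [MeasurableSpace Ω] [Fintype ι] {m : ℕ} {μ : Measure Ω}
  {A : Matrix ι ι ℝ} {B : Matrix ι (Fin m) ℝ} {L : ℝ≥0 → Ω → (Fin m → ℝ)}

theorem IsStateSolution.ae_isPathSolution {X : ℝ≥0 → Ω → (ι → ℝ)}
    (hX : IsStateSolution μ A B L X) :
    ∀ᵐ ω ∂μ, IsPathSolution (toCLM A) (toCLM B) (path L ω) (fun t => X t ω) := by
  filter_upwards [hX.integrable, hX.equation] with ω h1 h2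
  exact ⟨h1, h2⟩

theorem isStateSolution_startedSolution [IsProbabilityMeasure μ] (hL : IsLevyProcess μ L)
    (π : Measure (ι → ℝ)) [IsProbabilityMeasure π] :
    IsStateSolution (μ.prod π) A B (fun t z => L t z.1)
      (startedSolution L (toCLM A) (toCLM B)) where
  measurable := measurable_startedSolution hL
  integrable := by
    filter_upwards [ae_isPathSolution_startedSolution (A := toCLM A) (B := toCLM B) hL] with z hz
    exact hz.integrable
  equation := by
    filter_upwards [ae_isPathSolution_startedSolution (A := toCLM A) (B := toCLM B) hL] with z hz
    exact hz.equation

end StateSolution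

section Companion

variable {d p q r m : ℕ} {P : ℕ → Matrix (Fin d) (Fin d) ℝ}
  {α β : Matrix (Fin d) (Fin r) ℝ} {αp βp : Matrix (Fin d) (Fin (d - r)) ℝ}

theorem isKernelSplitting_companion (hp : 0 < p) (hrd : r ≤ d) (hP0 : P 0 = 1)
    (hα : α.rank = r) (hβ : β.rank = r) (hb : P p = α * βᵀ) (hααp : αᵀ * αp = 0)
    (hβp : βp.rank = d - r) (hββp : βᵀ * βp = 0)
    (hc : (αpᵀ * P (p - 1) * βp).rank = d - r) :
    IsKernelSplitting (companion p P) (kernelMatrix p βp) (cokernelMatrix p P αp) where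
  mul_right := companion_mul_kernelMatrix (by rw [hb, Matrix.mul_assoc, hββp, Matrix.mul_zero])
  mul_left := by
    refine cokernelMatrix_mul_companion hP0 ?_
    have h1 : αpᵀ * α = 0 := by
      rw [← Matrix.transpose_transpose α, ← Matrix.transpose_mul, hααp, Matrix.transpose_zero]
    rw [hb, ← Matrix.mul_assoc, h1, Matrix.zero_mul]
  isUnit := by
    rw [cokernelMatrix_mul_kernelMatrix hp]
    exact isUnit_det_of_rank (by rw [hc, Fintype.card_fin])
  exists_of_ker x hx := by
    have hsucc : ∀ (k : ℕ) (hk : k + 1 < p), blk x ⟨k + 1, hk⟩ = 0 := by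
      intro k hk
      ext i
      have h1 := congrFun hx (⟨k, by omega⟩, i)
      rwa [companion_mulVec, dif_pos hk] at h1
    have hblk : ∀ j : Fin p, j ≠ ⟨0, hp⟩ → blk x j = 0 := by
      rintro ⟨j, hj⟩ hne
      rcases j with _ | j
      · exact absurd rfl hne
      · exact hsucc j hj
    have h0 : P p *ᵥ blk x ⟨0, hp⟩ = 0 := by
      ext i
      have h1 := congrFun hx (⟨p - 1, by omega⟩, i)
      rw [companion_mulVec, dif_neg (by simp only; omega), Finset.sum_eq_single ⟨0, hp⟩] at h1
      · simpa using h1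
      · intro j _ hj
        rw [hblk j hj, Matrix.mulVec_zero]
        rfl
      · simp
    rw [hb, ← Matrix.mulVec_mulVec] at h0
    have h1 := eq_zero_of_mulVec_eq_zero (by rw [hα, Fintype.card_fin]) h0
    obtain ⟨u, hu⟩ := exists_eq_mulVec_of_transpose_mulVec_eq_zero hrd hβ hβp hββp h1
    refine ⟨u, ?_⟩
    ext ⟨k, i⟩
    have h2 := congrFun (blk_kernelMatrix_mulVec βp u k) i
    change x (k, i) = blk (kernelMatrix p βp *ᵥ u) k i
    rw [h2]
    by_cases hk : (k : ℕ) = 0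
    · rw [if_pos hk, ← hu]
      obtain rfl : k = ⟨0, hp⟩ := Fin.ext hk
      rfl
    · rw [if_neg hk]
      exact congrFun (hblk k fun h => hk (congrArg Fin.val h)) i

/-- If `αpᵀ Q_q = 0`, a left null vector of the companion matrix is orthogonal to the input. -/
theorem ne_zero_of_isMinimal (hp : 0 < p) (hrd : r < d) (hP0 : P 0 = 1)
    {Q : ℕ → Matrix (Fin d) (Fin m) ℝ}
    (h : IsKernelSplitting (companion p P) (kernelMatrix p βp) (cokernelMatrix p P αp))
    (hmin : IsMinimal (companion p P) (inputMatrix p q P Q) (outputMatrix p d)) :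
    αpᵀ * Q q ≠ 0 := by
  intro h0
  let j : Fin (d - r) := ⟨0, by omega⟩
  refine not_isMinimal_of_vecMul_eq_zero (outputMatrix p d) (w := (cokernelMatrix p P αp) j)
    ?_ ?_ ?_ hmin
  · intro hw
    refine h.isUnit.ne_zero (Matrix.det_eq_zero_of_row_eq_zero j fun i => ?_)
    rw [Matrix.mul_apply_eq_vecMul, hw, Matrix.zero_vecMul]
    rfl
  · rw [← Matrix.mul_apply_eq_vecMul, h.mul_left]
    rfl
  · rw [← Matrix.mul_apply_eq_vecMul, cokernelMatrix_mul_inputMatrix hp hP0, h0]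
    rfl

/-- The random walk part of the output is `βp M⁻¹ αpᵀ Q_q (L(t) - L(0))` with
`M = αpᵀ P_{p-1} βp`. -/
theorem exists_output_kerProj_input_ne_zero (hp : 0 < p) (hP0 : P 0 = 1)
    {Q : ℕ → Matrix (Fin d) (Fin m) ℝ} (hβp : βp.rank = d - r)
    (h : IsKernelSplitting (companion p P) (kernelMatrix p βp) (cokernelMatrix p P αp))
    (hQ : αpᵀ * Q q ≠ 0) :
    ∃ x, toCLM (outputMatrix p d) (toCLM (kerProj (kernelMatrix p βp) (cokernelMatrix p P αp))
      (toCLM (inputMatrix p q P Q) x)) ≠ 0 := by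
  by_contra! hall
  refine hQ (Matrix.ext_of_mulVec_single fun j => ?_)
  rw [Matrix.zero_mulVec]
  have h1 := hall (Pi.single j 1)
  simp only [toCLM_apply, Matrix.mulVec_mulVec, kerProj] at h1
  rw [Matrix.mul_assoc, Matrix.mul_assoc, cokernelMatrix_mul_inputMatrix hp hP0,
    ← Matrix.mul_assoc, outputMatrix_mul_kernelMatrix hp, ← Matrix.mulVec_mulVec,
    ← Matrix.mulVec_mulVec] at h1
  have h2 := eq_zero_of_mulVec_eq_zero (by rw [hβp, Fintype.card_fin]) h1
  have h3 := congrArg (fun v => (cokernelMatrix p P αp * kernelMatrix p βp) *ᵥ v) h2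
  simpa [Matrix.mulVec_mulVec, ← Matrix.mul_assoc, Matrix.mul_nonsing_inv _ h.isUnit] using h3

end Companion

end MCARMA

theorem mainTheorem3 {Ω : Type*} [MeasurableSpace Ω] (μ : Measure Ω) [IsProbabilityMeasure μ]
    {d m p q r : ℕ} (hqp : q < p) (hr0 : 0 < r) (hrd : r < d)
    (L : ℝ≥0 → Ω → (Fin m → ℝ))
    (hL : MCARMA.IsLevyProcess μ L) (hL2 : MCARMA.IsCenteredNondegenerate μ L)
    (P : ℕ → Matrix (Fin d) (Fin d) ℝ) (hP0 : P 0 = 1)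
    (Q : ℕ → Matrix (Fin d) (Fin m) ℝ)
    (ha : ∀ z : ℂ, (MCARMA.arPoly p P z).det = 0 → z.re < 0 ∨ z = 0)
    (α β : Matrix (Fin d) (Fin r) ℝ) (hα : α.rank = r) (hβ : β.rank = r)
    (hb : P p = α * βᵀ)
    (αp βp : Matrix (Fin d) (Fin (d - r)) ℝ)
    (hαp : αp.rank = d - r) (hααp : αᵀ * αp = 0)
    (hβp : βp.rank = d - r) (hββp : βᵀ * βp = 0)
    (hc : (αpᵀ * P (p - 1) * βp).rank = d - r) :
    MCARMA.HasCointegratedSpectrum (MCARMA.companion p P) (d - r) ∧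
    (MCARMA.IsMinimal (MCARMA.companion p P) (MCARMA.inputMatrix p q P Q)
        (MCARMA.outputMatrix p d) →
      MCARMA.IsCointegratedModel (MCARMA.companion p P) (MCARMA.inputMatrix p q P Q)
        (MCARMA.outputMatrix p d) ∧ αpᵀ * Q q ≠ 0) ∧
    ∃ π : Measure (Fin p × Fin d → ℝ), IsProbabilityMeasure π ∧
    ∃ X' : ℝ≥0 → Ω × (Fin p × Fin d → ℝ) → (Fin p × Fin d → ℝ),
      -- the stationary solution, on the enlarged probability space
      MCARMA.IsMCARMAState (μ.prod π) p q P Q (fun t z => L t z.1) X' ∧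
      (∀ z, X' 0 z = z.2) ∧
      (∀ᵐ z ∂(μ.prod π), βpᵀ *ᵥ MCARMA.output X' 0 z = 0) ∧
      (∀ t, MemLp (X' t) 2 (μ.prod π)) ∧
      MCARMA.IsStrictlyStationary (μ.prod π) (fun t z => βᵀ *ᵥ MCARMA.output X' t z) ∧
      MCARMA.HasStrictlyStationaryIncrements (μ.prod π) (MCARMA.output X') ∧
      (q + 1 < p → ∃ DY : ℝ≥0 → Ω × (Fin p × Fin d → ℝ) → (Fin d → ℝ),
        MCARMA.IsMeanSquareDeriv (μ.prod π) (MCARMA.output X') DY ∧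
        MCARMA.IsStrictlyStationary (μ.prod π) DY) ∧
      (αpᵀ * Q q ≠ 0 → MCARMA.IsCointegratedProcess (μ.prod π) (MCARMA.output X')) ∧
      -- every other solution approaches it exponentially fast
      (∃ K lam : ℝ, 0 < lam ∧ ∀ X : ℝ≥0 → Ω → (Fin p × Fin d → ℝ),
        MCARMA.IsMCARMAState μ p q P Q L X →
        ∀ᵐ z ∂(μ.prod π), ∀ t h : ℝ≥0,
          ‖βᵀ *ᵥ MCARMA.output X t z.1 - βᵀ *ᵥ MCARMA.output X' t z‖
            ≤ K * Real.exp (-lam * t) * ‖X 0 z.1 - z.2‖ ∧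
          ‖(MCARMA.output X (t + h) z.1 - MCARMA.output X t z.1)
              - (MCARMA.output X' (t + h) z - MCARMA.output X' t z)‖
            ≤ K * h * Real.exp (-lam * t) * ‖X 0 z.1 - z.2‖) ∧
      -- and no solution is stationary
      (αpᵀ * Q q ≠ 0 → ∀ X : ℝ≥0 → Ω → (Fin p × Fin d → ℝ),
        MCARMA.IsMCARMAState μ p q P Q L X →
        ¬ MCARMA.IsStrictlyStationary μ (MCARMA.output X)) := by
  have hp : 0 < p := by omega
  have hspl := MCARMA.isKernelSplitting_companion hp hrd.le hP0 hα hβ hb hααp hβp hββp hc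
  have hspec : ∀ (z : ℂ) (v : Fin p × Fin d → ℂ), v ≠ 0 →
      (MCARMA.companion p P).map (algebraMap ℝ ℂ) *ᵥ v = z • v → z.re < 0 ∨ z = 0 :=
    fun z v hv hz => ha z (MCARMA.det_arPoly_eq_zero_of_eigenvector hp hP0 hv hz)
  have hspectrum : MCARMA.HasCointegratedSpectrum (MCARMA.companion p P) (d - r) := by
    simpa using hspl.hasCointegratedSpectrum hspec
  refine ⟨hspectrum, fun hmin => ⟨⟨hmin, d - r, by omega, by omega, hspectrum⟩,
    MCARMA.ne_zero_of_isMinimal hp hrd hP0 hspl hmin⟩, ?_⟩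
  obtain ⟨K, lam, hlam, hA⟩ := MCARMA.exists_norm_flow_le _ (hspl.re_neg_of_eigenvector hspec)
  rw [MCARMA.toCLM_sub] at hA
  have hR := hspl.isZeroProjection
  set A := MCARMA.toCLM (MCARMA.companion p P) with hAdef
  set B := MCARMA.toCLM (MCARMA.inputMatrix p q P Q) with hBdef
  set R := MCARMA.toCLM (MCARMA.kerProj (MCARMA.kernelMatrix p βp)
    (MCARMA.cokernelMatrix p P αp)) with hRdef
  set C := MCARMA.toCLM (MCARMA.outputMatrix p d) with hCdef
  -- the normalization `βpᵀ Y°(0) = 0` is achieved by changing the initial state along the kernel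
  obtain ⟨G, hG, hHG⟩ := hspl.exists_normalization (H := βpᵀ * MCARMA.outputMatrix p d) (by
    rw [Matrix.mul_assoc, MCARMA.outputMatrix_mul_kernelMatrix hp]
    exact MCARMA.isUnit_det_of_rank (by rw [Matrix.rank_transpose_mul_self, hβp, Fintype.card_fin]))
  obtain ⟨π, hπ, hstart, hzero⟩ := MCARMA.exists_isStationaryStart hL hL2 hR B hlam hA
    (MCARMA.toCLM G) hG (T := MCARMA.toCLM (βpᵀ * MCARMA.outputMatrix p d)) (fun x => by
      rw [MCARMA.toCLM_apply, MCARMA.toCLM_apply, Matrix.mulVec_mulVec, hHG, Matrix.zero_mulVec])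
  have hβC : ∀ x, (MCARMA.toCLM βᵀ ∘L C) (R x) = 0 := by
    intro x
    have h1 : βᵀ * MCARMA.outputMatrix p d * MCARMA.kernelMatrix p βp = 0 := by
      rw [Matrix.mul_assoc, MCARMA.outputMatrix_mul_kernelMatrix hp, hββp]
    simp only [hCdef, hRdef, ContinuousLinearMap.comp_apply, MCARMA.toCLM_apply,
      Matrix.mulVec_mulVec, MCARMA.kerProj]
    rw [← Matrix.mul_assoc, ← Matrix.mul_assoc, ← Matrix.mul_assoc, h1, Matrix.zero_mul,
      Matrix.zero_mul, Matrix.zero_mulVec]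
  have hβY := hstart.isStrictlyStationary hL hR (MCARMA.toCLM βᵀ ∘L C) hβC
  have hinc := hstart.hasStrictlyStationaryIncrements hL hR C
  refine ⟨π, hπ, MCARMA.startedSolution L A B, MCARMA.isStateSolution_startedSolution hL π,
    MCARMA.startedSolution_zero, ?_, MCARMA.memLp_startedSolution hL hL2 hstart.memLp, hβY, hinc,
    fun hq1 => ?_, fun hQ => ⟨?_, hinc, ?_⟩, ?_, fun hQ X hX => ?_⟩
  · filter_upwards [Measure.quasiMeasurePreserving_snd.ae hzero] with z hz
    rw [MCARMA.toCLM_apply, ← Matrix.mulVec_mulVec] at hz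
    rw [MCARMA.output, MCARMA.startedSolution_zero, hz]
  · have hCB : ∀ x, C (B x) = 0 := fun x => by
      rw [hCdef, hBdef, MCARMA.toCLM_apply, MCARMA.toCLM_apply, Matrix.mulVec_mulVec,
        MCARMA.outputMatrix_mul_inputMatrix hq1, Matrix.zero_mulVec]
    exact ⟨_, hstart.isMeanSquareDeriv hL hL2 hR C hCB,
      hstart.isStrictlyStationary hL hR (C ∘L A) fun x => by simp [hR.apply_proj]⟩
  · exact MCARMA.not_isStrictlyStationary (hL.comp_measurePreserving measurePreserving_fst)
      (hL2.comp_measurePreserving hL measurePreserving_fst) hR hlam hA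
      (MCARMA.measurable_startedSolution hL 0) (MCARMA.ae_isPathSolution_startedSolution hL) C
      (MCARMA.exists_output_kerProj_input_ne_zero hp hP0 hβp hspl hQ)
  · refine ⟨β *ᵥ Pi.single ⟨0, hr0⟩ 1, fun h0 => ?_, fun s => ?_⟩
    · have h1 := MCARMA.eq_zero_of_mulVec_eq_zero (by rw [hβ, Fintype.card_fin]) h0
      simpa using congrFun h1 ⟨0, hr0⟩
    · have hm : Measurable fun (v : ℝ≥0 → Fin r → ℝ) t => v t ⟨0, hr0⟩ := by fun_prop
      rw [Matrix.mulVec_single_one]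
      exact (hβY s).comp hm
  · set K₁ := ‖MCARMA.toCLM βᵀ ∘L C‖ * K * ‖1 - R‖
    set K₂ := ‖C‖ * (‖A - R‖ * K) * K * ‖1 - R‖
    refine ⟨max K₁ K₂, lam, hlam, fun X hX => ?_⟩
    filter_upwards [Measure.quasiMeasurePreserving_fst.ae hX.ae_isPathSolution,
      MCARMA.ae_isPathSolution_startedSolution (A := A) (B := B) hL] with z h1 h2 t h
    have h3 := h1.norm_sub_le hR hA h2 (MCARMA.toCLM βᵀ ∘L C) hβC t
    have h4 := h1.norm_increment_sub_le hR hlam hA h2 C t h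
    simp only [MCARMA.startedSolution_zero] at h3 h4
    refine ⟨h3.trans ?_, h4.trans ?_⟩
    · gcongr
      exact le_max_left _ _
    · gcongr
      exact le_max_right _ _
  · exact MCARMA.not_isStrictlyStationary hL hL2 hR hlam hA (hX.measurable 0)
      hX.ae_isPathSolution C (MCARMA.exists_output_kerProj_input_ne_zero hp hP0 hβp hspl hQ)
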